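/- **Theorem (generalized Borchers–Du theorem).** A directed graph $G$ with edge weights $w \ge 0$ is *bidirected* if for every edge $uv$ of $G$ the reverse edge $vu$ is also an edge of $G$ and has the same weight. A *pattern* $H$ is a directed graph whose vertices (the *terminals*) are vertices of $G$. A *feasible solution* to $H$ is a subgraph $N\subseteq G$ that contains a directed $s\to t$ path for every edge $st$ of $H$. A directed graph is *planar* if its underlying undirected graph is planar. The cost $\mathrm{cost}(N)$ of a subgraph is the sum of the weights of its edges. There is an absolute constant $C>0$ such that the following holds. Let $G$ be a finite bidirected graph with non-negative edge weights, let $H$ be a pattern on a terminal set $R\subseteq V(G)$, and let $N\subseteq G$ be a planar feasible solution to $H$ of minimum cost among all planar feasible solutions to $H$. Then for every $\varepsilon>0$ there is a finite set $\mathcal H$ of patterns and, for each $H'\in\mathcal H$, a subgraph $N_{H'}\subseteq G$ such that 1. $V(H')\subseteq R$ and $|V(H')|\le 2^{C\max\{1,1/\varepsilon\}}$ for each $H'\in\mathcal H$; 2. $N_{H'}$ is a planar feasible solution to $H'$ for each $H'\in\mathcal H$; 3. the union $\bigcup_{H'\in\mathcal H}N_{H'}$ is a planar feasible solution to $H$;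 4. $\sum_{H'\in\mathcal H}\mathrm{cost}(N_{H'})\le(1+\varepsilon)\,\mathrm{cost}(N)$; 5. for every choice of feasible solutions $M_{H'}\subseteq G$ to the patterns $H'\in\mathcal H$, planar or not, the union $\bigcup_{H'\in\mathcal H}M_{H'}$ is a feasible solution to $H$. -/

import Mathlib

/-!
Directed Steiner networks on finite bidirected graphs, pattern graphs, and planarity of a
directed graph via combinatorial embeddings (rotation systems) satisfying Euler's formula.
-/

namespace SteinerNetwork

universe u

/-! ### Planar graphs -/

section Planarity

variable {V : Type u}

/-- A rotation system of a graph `Γ`: a permutation of the darts (oriented edges) that cyclically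
permutes, for every vertex `v`, the darts leaving `v` (the clockwise order of the edges around
`v` in a drawing).  That is, its cycles are exactly the sets of darts with a common source. -/
def IsRotationSystem (Γ : SimpleGraph V) (ρ : Equiv.Perm Γ.Dart) : Prop :=
  ∀ d d' : Γ.Dart, ρ.SameCycle d d' ↔ d.fst = d'.fst

/-- The reversal of darts, as a permutation. -/
def dartReverse (Γ : SimpleGraph V) : Equiv.Perm Γ.Dart where
  toFun := SimpleGraph.Dart.symm
  invFun := SimpleGraph.Dart.symm
  left_inv := SimpleGraph.Dart.symm_symm
  right_inv := SimpleGraph.Dart.symm_symm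

/-- The faces traced out by a rotation system: the cycles of the permutation
"traverse the dart, then turn to the next dart around its endpoint". -/
def Face (Γ : SimpleGraph V) (ρ : Equiv.Perm Γ.Dart) : Type u :=
  Quotient (Equiv.Perm.SameCycle.setoid (ρ * dartReverse Γ))

/-- A finite graph is planar if it has a combinatorial embedding into the sphere: a rotation
system for which Euler's formula `|V| - |E| + |F| = 2` holds on every connected component, i.e.
`|V| - |E| + |F| = 2 c`, where `c` is the number of components (a component never contributes more
than `2`, so the summed formula holds iff it holds on each component).  Isolated vertices are
irrelevant for planarity and are left out of both counts; the faces are counted for each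
component separately (each component has its own outer face). -/
def IsPlanar [Finite V] (Γ : SimpleGraph V) : Prop :=
  ∃ ρ : Equiv.Perm Γ.Dart, IsRotationSystem Γ ρ ∧
    Γ.support.ncard + Nat.card (Face Γ ρ)
      = Γ.edgeSet.ncard + 2 * (Γ.connectedComponentMk '' Γ.support).ncard

end Planarity

/-! ### Directed Steiner networks -/

section Networks

variable {V : Type u}

/-- The edge-weighted directed graph `(G, w)` is bidirected: the reverse of every edge is an edge
of the same weight.  Only the values of `w` on edges of `G` matter. -/
structure IsBidirected (G : Digraph V) (w : V → V → ℝ) : Prop where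
  adj_symm : ∀ a b, G.Adj a b → G.Adj b a
  weight_symm : ∀ a b, G.Adj a b → w b a = w a b

open Classical in
/-- The cost of a network: the total weight of its edges. -/
noncomputable def cost [Fintype V] (w : V → V → ℝ) (N : Digraph V) : ℝ :=
  ∑ e : V × V, if N.Adj e.1 e.2 then w e.1 e.2 else 0

/-- A pattern graph: a directed graph on a finite set `verts` of terminals; its edges are the
demands. -/
@[ext]
structure Pattern (V : Type u) where
  verts : Finset V
  Adj : V → V → Prop
  left_mem : ∀ s t, Adj s t → s ∈ verts
  right_mem : ∀ s t, Adj s t → t ∈ verts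

/-- `N ⊆ G` is a feasible solution to the pattern `H`: it contains a directed `s → t` path for
every edge `st` of `H`. -/
def IsSolution (G : Digraph V) (H : Pattern V) (N : Digraph V) : Prop :=
  N ≤ G ∧ ∀ s t, H.Adj s t → Relation.ReflTransGen N.Adj s t

/-- A feasible solution whose underlying undirected graph is planar. -/
def IsPlanarSolution [Finite V] (G : Digraph V) (H : Pattern V) (N : Digraph V) : Prop :=
  IsSolution G H N ∧ IsPlanar N.toSimpleGraphInclusive

/-- A cheapest planar solution. -/
def IsOptimumPlanarSolution [Fintype V] (G : Digraph V) (w : V → V → ℝ) (H : Pattern V)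
    (N : Digraph V) : Prop :=
  IsPlanarSolution G H N ∧ ∀ M : Digraph V, IsPlanarSolution G H M → cost w N ≤ cost w M

end Networks

end SteinerNetwork

/-! The network `N` is cut into pieces, and wherever a demand path passes from one piece to another
it is rerouted through a nearby terminal. If both pieces contain the shortest path from the crossing
point to that terminal, in both directions (possible since `G` is bidirected), then a demand path
breaks at the terminal into demands of single pieces. The price is the distance from the crossing
points to the terminals. So the cuts must have total distance at most a small multiple of `cost w
N`, while each piece meets boundedly many terminals.

To get there, fix an embedding of the underlying graph and let the darts be the nodes of a shortest
path forest (`exists_forestGraph`). `LengthForest.cut` splits the forest into blobs. Distances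
inside a blob agree up to a constant factor, and the distances of all blobs add up to O(cost)
(`sum_cut_dist_le`). Planar graphs being sparse, the sum over adjacent pairs of blobs is also
O(cost) (`sum_min_le`, `sum_pairs_dist_le`). Blobs may have unbounded degree, so they are refined to
the graph `contracted` of degree at most 7. This is a minor of a planar graph and so has no minor
`K_{3,7}`. Chopping it along three rounds of breadth-first levels, as in the Klein–Plotkin–Rao
theorem (`exists_bipartiteMinor_of_far`, `exists_small_parts`), loses a fraction `3 / Δ` of the
weight and leaves clusters of size 2^O(Δ). The clusters become the pieces (`exists_pieces`), with Δ
of order 1/ε.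

Planarity enters through linear algebra over the field with two elements. Euler's formula says
exactly that the first cohomology of the combinatorial map vanishes (`mapExact_iff_euler`).
Exactness passes to subgraphs (`MapExact.of_firstReturn`) and gives an algebraic dual of the
truncated map, whose nodes are the darts (`MapExact.isAlgebraicDual`). From the dual follows the
edge bound for minors (`IsAlgebraicDual.minor_card_le`), which supplies both sparsity and the
excluded `K_{3,7}`.

`reflTransGen_of_pieces` proves that arbitrary solutions of the pieces combine. The networks of the
pieces are a special case, and they stay planar because all of them lie in the underlying graph of
`N`. -/

namespace SteinerNetwork

open Module

/-! ### Duality for functions with values in the field with two elements -/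

section Duality

variable {X : Type*} [Fintype X]

/-- The orthogonal complement with respect to the dot product. -/
def perp (W : Submodule (ZMod 2) (X → ZMod 2)) : Submodule (ZMod 2) (X → ZMod 2) where
  carrier := {y | ∀ v ∈ W, v ⬝ᵥ y = 0}
  add_mem' := fun ha hb v hv => by rw [dotProduct_add, ha v hv, hb v hv, add_zero]
  zero_mem' := fun v _ => dotProduct_zero v
  smul_mem' := fun c y hy v hv => by rw [dotProduct_smul, hy v hv, smul_zero]

theorem mem_perp {W : Submodule (ZMod 2) (X → ZMod 2)} {y : X → ZMod 2} :
    y ∈ perp W ↔ ∀ v ∈ W, v ⬝ᵥ y = 0 := Iff.rfl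

theorem perp_sup (A B : Submodule (ZMod 2) (X → ZMod 2)) : perp (A ⊔ B) = perp A ⊓ perp B := by
  ext y
  simp only [Submodule.mem_inf, mem_perp]
  constructor
  · intro h
    exact ⟨fun v hv => h v (Submodule.mem_sup_left hv), fun v hv => h v (Submodule.mem_sup_right hv)⟩
  · rintro ⟨h1, h2⟩ v hv
    obtain ⟨a, ha, b, hb, rfl⟩ := Submodule.mem_sup.1 hv
    rw [add_dotProduct, h1 a ha, h2 b hb, add_zero]

theorem finrank_perp (W : Submodule (ZMod 2) (X → ZMod 2)) :
    finrank (ZMod 2) W + finrank (ZMod 2) (perp W) = Fintype.card X := by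
  classical
  have h := Subspace.finrank_add_finrank_dualAnnihilator_eq W
  rw [Module.finrank_fintype_fun_eq_card] at h
  rw [← h]
  congr 1
  have : perp W = W.dualAnnihilator.comap (dotProductEquiv (ZMod 2) X).toLinearMap := by
    ext y
    simp only [mem_perp, Submodule.mem_comap, Submodule.mem_dualAnnihilator]
    refine forall₂_congr fun v _ => ?_
    simp [dotProductEquiv, dotProduct_comm]
  rw [this]
  exact LinearEquiv.finrank_eq
    ((dotProductEquiv (ZMod 2) X).submoduleMap _ |>.trans
      (LinearEquiv.ofEq _ _ (Submodule.map_comap_eq_of_surjective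
        (dotProductEquiv (ZMod 2) X).surjective _)))

/-- Dimensions force `W` to equal its double orthogonal complement. The linear systems below are
solved this way: membership of a right-hand side is tested only on vectors orthogonal to the space
of attainable ones. -/
theorem mem_of_perp {W : Submodule (ZMod 2) (X → ZMod 2)} {b : X → ZMod 2}
    (h : ∀ y ∈ perp W, y ⬝ᵥ b = 0) : b ∈ W := by
  have h1 : W ≤ perp (perp W) := fun v hv y hy => by rw [dotProduct_comm]; exact hy v hv
  have h2 : W = perp (perp W) := by
    refine Submodule.eq_of_le_of_finrank_eq h1 ?_
    have := finrank_perp W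
    have := finrank_perp (perp W)
    omega
  rw [h2]
  exact h

/-- The functions that are constant on the classes of an equivalence relation. -/
def constOn (r : Setoid X) : Submodule (ZMod 2) (X → ZMod 2) where
  carrier := {u | ∀ x y, r x y → u x = u y}
  add_mem' := fun ha hb x y h => by simp [ha x y h, hb x y h]
  zero_mem' := fun _ _ _ => rfl
  smul_mem' := fun c u hu x y h => by simp [hu x y h]

theorem finrank_constOn (r : Setoid X) :
    finrank (ZMod 2) (constOn r) = Nat.card (Quotient r) := by
  classical
  have : Fintype (Quotient r) := Fintype.ofFinite _
  have e : constOn r ≃ₗ[ZMod 2] (Quotient r → ZMod 2) :=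
    { toFun := fun u q => Quotient.lift u.1 u.2 q
      map_add' := fun u v => by
        funext q
        induction q using Quotient.inductionOn
        rfl
      map_smul' := fun c u => by
        funext q
        induction q using Quotient.inductionOn
        rfl
      invFun := fun f => ⟨fun x => f (Quotient.mk r x), fun x y h => congrArg f (Quotient.sound h)⟩
      left_inv := fun u => by ext x; rfl
      right_inv := fun f => by
        funext q
        induction q using Quotient.inductionOn
        rfl }
  rw [e.finrank_eq, Module.finrank_fintype_fun_eq_card, Nat.card_eq_fintype_card]

/-- The functions that are invariant under a permutation. -/
def invariants (π : Equiv.Perm X) : Submodule (ZMod 2) (X → ZMod 2) where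
  carrier := {u | ∀ x, u (π x) = u x}
  add_mem' := fun ha hb x => by simp [ha x, hb x]
  zero_mem' := fun _ => rfl
  smul_mem' := fun c u hu x => by simp [hu x]

theorem mem_invariants {π : Equiv.Perm X} {u : X → ZMod 2} :
    u ∈ invariants π ↔ ∀ x, u (π x) = u x := Iff.rfl

theorem invariants_apply_zpow {π : Equiv.Perm X} {u : X → ZMod 2} (hu : u ∈ invariants π) (n : ℤ)
    (x : X) : u ((π ^ n) x) = u x := by
  induction n using Int.induction_on with
  | zero => rfl
  | succ n ih => rw [add_comm, zpow_add, zpow_one, Equiv.Perm.mul_apply, hu, ih]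
  | pred n ih =>
    rw [← ih, ← hu ((π ^ (-(n : ℤ) - 1)) x), ← Equiv.Perm.mul_apply, ← zpow_one_add]
    congr 3
    ring

theorem invariants_eq_constOn (π : Equiv.Perm X) :
    invariants π = constOn (Equiv.Perm.SameCycle.setoid π) := by
  ext u
  constructor
  · rintro hu x y ⟨n, rfl⟩
    exact (invariants_apply_zpow hu n x).symm
  · intro hu x
    exact hu _ _ ⟨-1, by simp⟩

theorem add_self_zmod_two (a : ZMod 2) : a + a = 0 := CharTwo.add_self_eq_zero a

theorem sum_perm_invariant (π : Equiv.Perm X) {s : X → ZMod 2} (hs : s ∈ invariants π)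
    (u : X → ZMod 2) : ∑ x, s x * u (π x) = ∑ x, s x * u x := by
  rw [← Equiv.sum_comp π (fun x => s x * u x)]
  exact Finset.sum_congr rfl fun x _ => by rw [hs x]

/-- A function orthogonal to the invariants of `π` is a coboundary along `π`. -/
theorem exists_add_comp_perm (π : Equiv.Perm X) {g : X → ZMod 2}
    (hg : ∀ s ∈ invariants π, s ⬝ᵥ g = 0) : ∃ p : X → ZMod 2, ∀ x, g x = p x + p (π x) := by
  classical
  let f : (X → ZMod 2) →ₗ[ZMod 2] (X → ZMod 2) :=
    LinearMap.id + LinearMap.funLeft (ZMod 2) (ZMod 2) π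
  have hf : ∀ p x, f p x = p x + p (π x) := fun p x => rfl
  have : g ∈ LinearMap.range f := by
    refine mem_of_perp fun y hy => hg y fun x => ?_
    -- Testing `y` on the coboundary of the indicator of `π x` gives `y (π x) + y x = 0`, so `y` is
    -- invariant.
    have h := hy (f (Pi.single (π x) 1)) ⟨_, rfl⟩
    have h2 : f (Pi.single (π x) 1) = Pi.single (π x) 1 + Pi.single x 1 := by
      funext z
      rw [hf, Pi.add_apply]
      congr 1
      by_cases hz : z = x
      · subst hz; simp
      · rw [Pi.single_eq_of_ne hz, Pi.single_eq_of_ne (fun h => hz (π.injective h))]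
    rw [h2, add_dotProduct, single_dotProduct, single_dotProduct, one_mul, one_mul] at h
    exact CharTwo.add_eq_zero.1 h
  obtain ⟨p, hp⟩ := this
  exact ⟨p, fun x => by rw [← hp, hf]⟩

end Duality

/-! ### Combinatorial maps: Euler's formula and vanishing cohomology -/

section Maps

variable {D : Type*} [Fintype D] (σ α : Equiv.Perm D)

/-- Every symmetric function on darts that sums to zero around every face is the difference of a
function on vertices. -/
def MapExact : Prop :=
  ∀ h ∈ invariants α, (∀ s ∈ invariants (σ * α), s ⬝ᵥ h = 0) →
    ∃ u ∈ invariants σ, ∀ d, h d = u d + u (α d)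

variable {σ α}

theorem sum_invariant_eq_zero (hα : ∀ d, α (α d) = d) (hfix : ∀ d, α d ≠ d) {h : D → ZMod 2}
    (hh : h ∈ invariants α) : ∑ d, h d = 0 :=
  Finset.sum_involution (fun d _ => α d)
    (fun d _ => by rw [hh d]; exact add_self_zmod_two _) (fun d _ _ => hfix d)
    (fun d _ => Finset.mem_univ _) (fun d _ => hα d)

/-- A product of two symmetric functions cancels on every pair `{d, α d}`, and testing against the
indicator of such a pair forces symmetry. Consequently the symmetric functions have dimension half
the number of darts. -/
theorem perp_invariants_involution (hα : ∀ d, α (α d) = d) (hfix : ∀ d, α d ≠ d) :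
    perp (invariants α) = invariants α := by
  classical
  ext k
  constructor
  · intro hk d
    have h := hk (Pi.single (α d) 1 + Pi.single d 1) (fun x => by
      simp only [Pi.add_apply, Pi.single_apply]
      rw [add_comm]
      congr 2
      · rw [← hα d, α.injective.eq_iff, hα]
      · rw [α.injective.eq_iff])
    rw [add_dotProduct, single_dotProduct, single_dotProduct, one_mul, one_mul] at h
    exact CharTwo.add_eq_zero.1 h
  · intro hk v hv
    exact sum_invariant_eq_zero hα hfix (h := fun d => v d * k d) fun d => by
      change v (α d) * k (α d) = v d * k d
      rw [hv d, hk d]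

/-- The pairs `σ, α` and `σ * α, α` generate the same group. Hence components counted through
vertices and through faces agree, which is why the number of components enters Euler's formula
twice. -/
theorem invariants_inf_face (hα : ∀ d, α (α d) = d) :
    invariants α ⊓ invariants (σ * α) = invariants σ ⊓ invariants α := by
  ext u
  simp only [Submodule.mem_inf, mem_invariants, Equiv.Perm.mul_apply]
  constructor
  · rintro ⟨h1, h2⟩
    exact ⟨fun x => by rw [← hα x, h2, h1 (α x), h1], h1⟩
  · rintro ⟨h1, h2⟩
    exact ⟨h2, fun x => by rw [h1, h2]⟩

/-- Exactness is Euler's formula. -/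
theorem mapExact_iff_euler (hα : ∀ d, α (α d) = d) (hfix : ∀ d, α d ≠ d) :
    MapExact σ α ↔ finrank (ZMod 2) (invariants σ) + finrank (ZMod 2) (invariants (σ * α))
      = finrank (ZMod 2) (invariants α)
        + 2 * finrank (ZMod 2) (invariants σ ⊓ invariants α : Submodule _ (D → ZMod 2)) := by
  let f : (D → ZMod 2) →ₗ[ZMod 2] (D → ZMod 2) :=
    LinearMap.id + LinearMap.funLeft (ZMod 2) (ZMod 2) α
  have hf : ∀ p x, f p x = p x + p (α x) := fun p x => rfl
  set Cob := (invariants σ).map f with hCob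
  set W := perp (invariants α ⊔ invariants (σ * α)) with hW
  -- Write v, e, f, c for the dimensions belonging to vertices, edges, faces and components. The
  -- coboundaries `Cob` have dimension v - c. The closed functions `W` have dimension 2e - (e + f -
  -- c). Given the inclusion, equality of the spaces is equality of these numbers, that is v + f = e
  -- + 2c.
  have hle : Cob ≤ W := by
    rintro _ ⟨u, hu, rfl⟩
    rw [hW, perp_sup]
    constructor
    · rw [perp_invariants_involution hα hfix]
      intro d
      rw [hf, hf, hα, add_comm]
    · intro s hs
      have hu' : ∀ d, u (σ d) = u d := hu
      have e : s ⬝ᵥ f u = ∑ d, s d * u d + ∑ d, s d * u ((σ * α) d) := by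
        rw [← Finset.sum_add_distrib]
        refine Finset.sum_congr rfl fun d _ => ?_
        rw [hf, Equiv.Perm.mul_apply, hu', mul_add]
      rw [e, sum_perm_invariant _ hs, add_self_zmod_two]
  have hdim1 : finrank (ZMod 2) Cob
      + finrank (ZMod 2) (invariants σ ⊓ invariants α : Submodule _ (D → ZMod 2))
      = finrank (ZMod 2) (invariants σ) := by
    have h := LinearMap.finrank_range_add_finrank_ker (f.domRestrict (invariants σ))
    rw [LinearMap.range_domRestrict] at h
    rw [← h]
    congr 1
    have : (f.domRestrict (invariants σ)).ker
        = (invariants σ ⊓ invariants α).comap (invariants σ).subtype := by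
      ext u
      simp only [LinearMap.mem_ker, LinearMap.domRestrict_apply, Submodule.mem_comap,
        Submodule.mem_inf, Submodule.subtype_apply, Subtype.prop, true_and, mem_invariants]
      rw [funext_iff]
      refine forall_congr' fun d => ?_
      rw [hf, Pi.zero_apply, CharTwo.add_eq_zero]
      exact eq_comm
    rw [this]
    exact (LinearEquiv.finrank_eq (Submodule.comapSubtypeEquivOfLe inf_le_left)).symm
  have hdim2 := finrank_perp (invariants α ⊔ invariants (σ * α))
  rw [← hW] at hdim2
  have hdim3 := Submodule.finrank_sup_add_finrank_inf_eq (invariants α) (invariants (σ * α))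
  rw [invariants_inf_face hα] at hdim3
  have hdim4 := finrank_perp (invariants α)
  rw [perp_invariants_involution hα hfix] at hdim4
  have hiff : MapExact σ α ↔ Cob = W := by
    constructor
    · intro h
      refine le_antisymm hle fun k hk => ?_
      rw [hW, perp_sup, perp_invariants_involution hα hfix] at hk
      obtain ⟨u, hu, huk⟩ := h k hk.1 hk.2
      exact ⟨u, hu, funext fun d => by rw [hf, huk]⟩
    · intro h k hk1 hk2
      have : k ∈ Cob := by
        rw [h, hW, perp_sup, perp_invariants_involution hα hfix]
        exact ⟨hk1, hk2⟩
      obtain ⟨u, hu, rfl⟩ := this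
      exact ⟨u, hu, fun d => rfl⟩
  rw [hiff]
  have hd := Submodule.finrank_mono hle
  constructor
  · intro h
    rw [h] at hdim1
    omega
  · intro h
    refine Submodule.eq_of_le_of_finrank_eq hle ?_
    omega

end Maps

end SteinerNetwork

namespace SteinerNetwork

open Module

/-! ### Exactness of submaps -/

section Maps

variable {D D' : Type*} [Fintype D] [Fintype D']

/-- The first return map of a permutation to a subset. -/
theorem exists_firstReturn (ι : D' → D) (hι : Function.Injective ι) (σ : Equiv.Perm D) :
    ∃ σ' : Equiv.Perm D', (∀ x y, σ'.SameCycle x y ↔ σ.SameCycle (ι x) (ι y)) ∧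
      ∀ x, ∃ k : ℕ, ι (σ' x) = (σ ^ (k + 1)) (ι x) ∧
        ∀ j < k, ∀ z, ι z ≠ (σ ^ (j + 1)) (ι x) := by
  classical
  have hex : ∀ x, ∃ k : ℕ, ∃ z, ι z = (σ ^ (k + 1)) (ι x) := fun x =>
    ⟨orderOf σ - 1, x, by
      rw [Nat.sub_add_cancel (orderOf_pos σ), pow_orderOf_eq_one, Equiv.Perm.one_apply]⟩
  choose f hf using fun x => Nat.find_spec (hex x)
  have hmin : ∀ x, ∀ j < Nat.find (hex x), ∀ z, ι z ≠ (σ ^ (j + 1)) (ι x) := fun x j hj z hz =>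
    Nat.find_min (hex x) hj ⟨z, hz⟩
  -- If two points had the same first return, the one with the longer return time would meet the
  -- other one earlier, against minimality.
  have hinj' : ∀ x y, Nat.find (hex x) ≤ Nat.find (hex y) → f x = f y → x = y := by
    intro x y hle hxy
    have h : (σ ^ (Nat.find (hex x) + 1)) (ι x) = (σ ^ (Nat.find (hex y) + 1)) (ι y) := by
      rw [← hf, ← hf, hxy]
    obtain ⟨m, hm⟩ := Nat.exists_eq_add_of_le hle
    rw [hm, show Nat.find (hex x) + m + 1 = (Nat.find (hex x) + 1) + m by ring,
      pow_add σ (Nat.find (hex x) + 1) m,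
      Equiv.Perm.mul_apply, EmbeddingLike.apply_eq_iff_eq] at h
    rcases m with _ | m
    · exact hι (by simpa using h)
    · exact absurd h (hmin y m (by omega) x)
  have hinj : Function.Injective f := fun x y hxy =>
    (le_total (Nat.find (hex x)) (Nat.find (hex y))).elim (fun h => hinj' x y h hxy)
      fun h => (hinj' y x h hxy.symm).symm
  refine ⟨Equiv.ofBijective f (Finite.injective_iff_bijective.1 hinj), ?_, fun x =>
    ⟨Nat.find (hex x), hf x, hmin x⟩⟩
  set σ' := Equiv.ofBijective f (Finite.injective_iff_bijective.1 hinj) with hσ'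
  have hσ'f : ∀ x, ι (σ' x) = (σ ^ (Nat.find (hex x) + 1)) (ι x) := hf
  intro x y
  constructor
  · intro h
    obtain ⟨n, -, rfl⟩ := h.exists_pow_eq'
    clear h
    induction n with
    | zero => exact Equiv.Perm.SameCycle.refl _ _
    | succ n ih =>
      refine ih.trans ?_
      rw [pow_succ', Equiv.Perm.mul_apply, hσ'f]
      exact (Equiv.Perm.sameCycle_pow_right.2 (Equiv.Perm.SameCycle.refl _ _))
  · intro h
    obtain ⟨n, -, hn⟩ := h.exists_pow_eq'
    clear h
    induction n using Nat.strong_induction_on generalizing x with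
    | _ n ih =>
      rcases n with _ | n
      · rw [pow_zero, Equiv.Perm.one_apply] at hn
        rw [hι hn]
      · have hle : Nat.find (hex x) ≤ n := Nat.find_min' (hex x) ⟨y, hn.symm⟩
        refine Equiv.Perm.sameCycle_apply_left.1 (ih (n - Nat.find (hex x)) (by omega) (σ' x) ?_)
        rw [hσ'f, ← Equiv.Perm.mul_apply, ← pow_add, ← hn]
        congr 2
        omega

/-- Exactness is inherited by submaps. -/
theorem MapExact.of_firstReturn {σ α : Equiv.Perm D} {σ' α' : Equiv.Perm D'}
    (hα : ∀ d, α (α d) = d) (hfix : ∀ d, α d ≠ d) (hex : MapExact σ α) (ι : D' → D)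
    (hι : Function.Injective ι) (hια : ∀ x, ι (α' x) = α (ι x))
    (hσ' : ∀ x, ∃ k : ℕ, ι (σ' x) = (σ ^ (k + 1)) (ι x) ∧
        ∀ j < k, ∀ z, ι z ≠ (σ ^ (j + 1)) (ι x)) : MapExact σ' α' := by
  classical
  have hα' : ∀ d, α' (α' d) = d := fun d => hι (by rw [hια, hια, hα])
  have hfix' : ∀ d, α' d ≠ d := fun d h => hfix (ι d) (by rw [← hια, h])
  intro h' hh' hface
  set W := perp (invariants α ⊔ invariants (σ * α)) with hW
  -- Every closed function on the submap is the restriction of a closed function on the whole map.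
  -- By duality it suffices that each `y` orthogonal to all restrictions is orthogonal to `h'`. The
  -- extension of `y` by zero is orthogonal to `W`, hence a sum of a symmetric and a face-invariant
  -- function.
  have key : h' ∈ W.map (LinearMap.funLeft (ZMod 2) (ZMod 2) ι) := by
    refine mem_of_perp fun y hy => ?_
    have hy' : Function.extend ι y 0 ∈ invariants α ⊔ invariants (σ * α) := by
      refine mem_of_perp fun k hk => ?_
      have h1 := hy _ ⟨k, hk, rfl⟩
      rw [← h1]
      symm
      refine Finset.sum_of_injOn ι hι.injOn (fun _ _ => Finset.mem_coe.2 (Finset.mem_univ _))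
        (fun d _ hd => ?_) fun x _ => ?_
      · have : ¬ ∃ a, ι a = d := fun ⟨a, ha⟩ =>
          hd ⟨a, Finset.mem_coe.2 (Finset.mem_univ _), ha⟩
        rw [Function.extend_apply' _ _ _ this, Pi.zero_apply, mul_zero]
      · rw [hι.extend_apply]
        rfl
    obtain ⟨a, ha, s, hs, has⟩ := Submodule.mem_sup.1 hy'
    have hys : ∀ x, y x = a (ι x) + s (ι x) := fun x => by
      rw [← Pi.add_apply, has, hι.extend_apply]
    -- At a deleted dart the sum `a + s` is zero, so `s` inherits the symmetry of `a` there. Then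
    -- `s` does not change while the rotation skips deleted darts, which makes it constant on the
    -- merged faces of the submap.
    have hsout : ∀ d, (∀ x, ι x ≠ d) → s (α d) = s d := by
      intro d hd
      have hz : ∀ e, (∀ x, ι x ≠ e) → a e = s e := fun e he => by
        have := congrFun has e
        rw [Function.extend_apply' _ _ _ (fun ⟨x, hx⟩ => he x hx), Pi.zero_apply,
          Pi.add_apply] at this
        exact CharTwo.add_eq_zero.1 this
      rw [← hz d hd, ← hz (α d) fun x hx => hd (α' x) (by rw [hια, hx, hα]), ha d]
    have hstep : ∀ e, s (σ e) = s (α e) := fun e => by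
      have := hs (α e)
      rwa [Equiv.Perm.mul_apply, hα] at this
    have hs' : (fun x => s (ι x)) ∈ invariants (σ' * α') := by
      intro x
      change s (ι (σ' (α' x))) = s (ι x)
      obtain ⟨k, hk, hmin⟩ := hσ' (α' x)
      rw [hk]
      have : ∀ j ≤ k, s ((σ ^ (j + 1)) (ι (α' x))) = s (ι x) := by
        intro j
        induction j with
        | zero =>
          intro _
          rw [zero_add, pow_one, hstep, hια, hα]
        | succ j ih =>
          intro hj
          rw [pow_succ', Equiv.Perm.mul_apply, hstep, hsout _ (hmin j hj), ih (by omega)]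
      exact this k le_rfl
    have e : y ⬝ᵥ h' = ∑ x, a (ι x) * h' x + ∑ x, s (ι x) * h' x := by
      rw [← Finset.sum_add_distrib]
      exact Finset.sum_congr rfl fun x _ => by rw [hys, add_mul]
    have e1 : ∑ x, a (ι x) * h' x = 0 :=
      sum_invariant_eq_zero hα' hfix' (h := fun x => a (ι x) * h' x) fun x => by
        change a (ι (α' x)) * h' (α' x) = a (ι x) * h' x
        rw [hια, ha, hh']
    rw [e, e1, zero_add]
    exact hface _ hs'
  obtain ⟨h, hh, rfl⟩ := key
  rw [SetLike.mem_coe, hW, perp_sup, perp_invariants_involution hα hfix] at hh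
  obtain ⟨u, hu, huh⟩ := hex h hh.1 hh.2
  refine ⟨fun x => u (ι x), fun x => ?_, fun d => ?_⟩
  · obtain ⟨k, hk, -⟩ := hσ' x
    change u (ι (σ' x)) = u (ι x)
    rw [hk]
    exact_mod_cast invariants_apply_zpow hu (k + 1 : ℕ) (ι x)
  · change h (ι d) = u (ι d) + u (ι (α' d))
    rw [hια, huh]

end Maps

/-! ### Planarity as exactness, and its passage to subgraphs -/

section Planar

universe u

variable {V : Type u} {Γ : SimpleGraph V}

theorem dartReverse_dartReverse (d : Γ.Dart) : dartReverse Γ (dartReverse Γ d) = d :=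
  SimpleGraph.Dart.symm_symm d

theorem dartReverse_ne (d : Γ.Dart) : dartReverse Γ d ≠ d :=
  SimpleGraph.Dart.symm_ne d

theorem mem_invariants_rotation [Fintype Γ.Dart] {ρ : Equiv.Perm Γ.Dart}
    (hρ : IsRotationSystem Γ ρ) {u : Γ.Dart → ZMod 2} :
    u ∈ invariants ρ ↔ ∀ d d' : Γ.Dart, d.fst = d'.fst → u d = u d' := by
  rw [invariants_eq_constOn]
  exact forall₂_congr fun d d' => by rw [← hρ d d']; rfl

theorem finrank_constOn_ker {X T : Type*} [Fintype X] (f : X → T) :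
    finrank (ZMod 2) (constOn (Setoid.ker f)) = (Set.range f).ncard := by
  rw [finrank_constOn, Nat.card_congr (Setoid.quotientKerEquivRange f), Nat.card_coe_set_eq]

theorem finrank_rotation [Fintype Γ.Dart] {ρ : Equiv.Perm Γ.Dart} (hρ : IsRotationSystem Γ ρ) :
    finrank (ZMod 2) (invariants ρ) = Γ.support.ncard := by
  have h : invariants ρ = constOn (Setoid.ker fun d : Γ.Dart => d.fst) := by
    ext u
    exact mem_invariants_rotation hρ
  rw [h, finrank_constOn_ker]
  congr 1
  ext v
  constructor
  · rintro ⟨d, rfl⟩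
    exact ⟨d.snd, d.adj⟩
  · rintro ⟨w, hw⟩
    exact ⟨⟨(v, w), hw⟩, rfl⟩

theorem finrank_dartReverse [Fintype Γ.Dart] :
    finrank (ZMod 2) (invariants (dartReverse Γ)) = Γ.edgeSet.ncard := by
  have h : invariants (dartReverse Γ) = constOn (Setoid.ker fun d : Γ.Dart => d.edge) := by
    ext u
    constructor
    · intro hu d d' h
      rcases SimpleGraph.dart_edge_eq_iff d d' |>.1 h with h | h
      · rw [h]
      · rw [h]
        exact hu d'
    · intro hu d
      exact hu _ _ (SimpleGraph.Dart.edge_symm d)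
  rw [h, finrank_constOn_ker]
  congr 1
  ext e
  constructor
  · rintro ⟨d, rfl⟩
    exact d.edge_mem
  · induction e with
    | _ v w => exact fun hw => ⟨⟨(v, w), hw⟩, rfl⟩

theorem finrank_components [Fintype Γ.Dart] {ρ : Equiv.Perm Γ.Dart} (hρ : IsRotationSystem Γ ρ) :
    finrank (ZMod 2) (invariants ρ ⊓ invariants (dartReverse Γ) : Submodule _ (Γ.Dart → ZMod 2))
      = (Γ.connectedComponentMk '' Γ.support).ncard := by
  have h : invariants ρ ⊓ invariants (dartReverse Γ)
      = constOn (Setoid.ker fun d : Γ.Dart => Γ.connectedComponentMk d.fst) := by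
    ext u
    rw [Submodule.mem_inf, mem_invariants_rotation hρ]
    constructor
    · rintro ⟨h1, h2⟩ d d' h
      obtain ⟨p⟩ := SimpleGraph.ConnectedComponent.eq.1 h
      have : ∀ {v w : V} (_ : Γ.Walk v w) (d d' : Γ.Dart), d.fst = v → d'.fst = w → u d = u d' := by
        intro v w p
        induction p with
        | nil => exact fun d d' hd hd' => h1 d d' (hd.trans hd'.symm)
        | cons hadj p ih =>
          intro d d' hd hd'
          rw [h1 d ⟨(_, _), hadj⟩ hd, ← h2]
          exact ih _ _ rfl hd'
      exact this p d d' rfl rfl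
    · intro hu
      refine ⟨fun d d' h => hu _ _ (by rw [Setoid.ker_def, h]), fun d => hu _ _ ?_⟩
      exact SimpleGraph.ConnectedComponent.sound d.adj.symm.reachable
  rw [h, finrank_constOn_ker]
  congr 1
  ext c
  constructor
  · rintro ⟨d, rfl⟩
    exact ⟨d.fst, ⟨d.snd, d.adj⟩, rfl⟩
  · rintro ⟨v, ⟨w, hw⟩, rfl⟩
    exact ⟨⟨(v, w), hw⟩, rfl⟩

/-- A graph is planar if and only if it has an exact rotation system. -/
theorem isPlanar_iff_exact [Finite V] [Fintype Γ.Dart] :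
    IsPlanar Γ ↔ ∃ ρ : Equiv.Perm Γ.Dart, IsRotationSystem Γ ρ ∧ MapExact ρ (dartReverse Γ) := by
  refine exists_congr fun ρ => and_congr_right fun hρ => ?_
  rw [mapExact_iff_euler dartReverse_dartReverse dartReverse_ne, finrank_rotation hρ,
    finrank_dartReverse, finrank_components hρ, invariants_eq_constOn (ρ * dartReverse Γ),
    finrank_constOn]
  rfl

/-- Subgraphs of planar graphs are planar. -/
theorem IsPlanar.mono [Finite V] {Γ' : SimpleGraph V} (hle : Γ' ≤ Γ) (h : IsPlanar Γ) :
    IsPlanar Γ' := by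
  have : Finite Γ.Dart := Finite.of_injective _ SimpleGraph.Dart.toProd_injective
  have : Finite Γ'.Dart := Finite.of_injective _ SimpleGraph.Dart.toProd_injective
  have := Fintype.ofFinite Γ.Dart
  have := Fintype.ofFinite Γ'.Dart
  rw [isPlanar_iff_exact] at h ⊢
  obtain ⟨ρ, hρ, hex⟩ := h
  let ι : Γ'.Dart → Γ.Dart := fun d => ⟨d.toProd, hle d.adj⟩
  have hι : Function.Injective ι := fun d d' h => by
    ext1
    exact congrArg (fun e : Γ.Dart => e.toProd) h
  obtain ⟨σ', h1, h2⟩ := exists_firstReturn ι hι ρ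
  exact ⟨σ', fun d d' => (h1 d d').trans (hρ _ _),
    hex.of_firstReturn dartReverse_dartReverse dartReverse_ne ι hι (fun _ => rfl) h2⟩

end Planar

end SteinerNetwork

namespace SteinerNetwork

open Module

/-! ### Algebraic duals and minors -/

section Minors

variable {X Y F : Type*} [Fintype X] [Fintype Y]

/-- The maps `l, r` to a type of faces are an algebraic dual of the graph with edges `a y — b y`:
a set of edges is a cycle if and only if it is the boundary of a set of faces. -/
structure IsAlgebraicDual (a b : Y → X) (l r : Y → F) : Prop where
  boundary_cycle : ∀ (s : F → ZMod 2) (u : X → ZMod 2),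
    ∑ y, (s (l y) + s (r y)) * (u (a y) + u (b y)) = 0
  cycle_boundary : ∀ k : Y → ZMod 2, (∀ u : X → ZMod 2, ∑ y, k y * (u (a y) + u (b y)) = 0) →
    ∃ s : F → ZMod 2, ∀ y, k y = s (l y) + s (r y)

/-- A connected fibre of a partial map to the vertices of a minor. -/
def FibreConnected {I : Type*} (a b : Y → X) (μ : X → Option I) : Prop :=
  ∀ i x x', μ x = some i → μ x' = some i →
    Relation.EqvGen (fun p q => μ p = some i ∧ μ q = some i ∧ ∃ y, a y = p ∧ b y = q) x x'

theorem sum_extend_mul {Z : Type*} [Fintype Z] {ι : Z → Y} (hι : Function.Injective ι)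
    (y : Y → ZMod 2) (h : Z → ZMod 2) :
    ∑ e, y e * Function.extend ι h 0 e = ∑ z, y (ι z) * h z := by
  classical
  symm
  refine Finset.sum_of_injOn ι hι.injOn (fun _ _ => Finset.mem_coe.2 (Finset.mem_univ _))
    (fun d _ hd => ?_) fun x _ => ?_
  · have : ¬ ∃ a, ι a = d := fun ⟨a, ha⟩ => hd ⟨a, Finset.mem_coe.2 (Finset.mem_univ _), ha⟩
    rw [Function.extend_apply' _ _ _ this, Pi.zero_apply, mul_zero]
  · rw [hι.extend_apply]

variable {a b : Y → X} {l r : Y → F} {I Z : Type*} [Fintype I] [Fintype Z]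

/-- Euler's inequality for minors of graphs with an algebraic dual. -/
theorem IsAlgebraicDual.minor_card_le [Finite F] (hP : IsAlgebraicDual a b l r) (ι : Z → Y)
    (hι : Function.Injective ι) (μ : X → Option I) (hconn : FibreConnected a b μ) (i j : Z → I)
    (hi : ∀ z, μ (a (ι z)) = some (i z)) (hj : ∀ z, μ (b (ι z)) = some (j z))
    (hne : ∀ z, i z ≠ j z) (g : ℕ)
    (hg : ∀ k : Z → ZMod 2, k ≠ 0 → (∀ u : I → ZMod 2, ∑ z, k z * (u (i z) + u (j z)) = 0) →
      g ≤ (Finset.univ.filter fun z => k z ≠ 0).card) :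
    g * Fintype.card Z ≤ 2 * Fintype.card Z + g * Fintype.card I := by
  classical
  -- Edges outside the image of `ι` with both ends in one fibre are contracted, which leaves the
  -- faces alone. All others outside the image are deleted, which merges the two faces at the edge.
  -- The faces of the minor are thus the classes of `S`.
  let Del : Y → Prop := fun y => (∀ z, ι z ≠ y) ∧ ¬ ∃ i, μ (a y) = some i ∧ μ (b y) = some i
  let rel : F → F → Prop := fun f f' => ∃ y, Del y ∧ l y = f ∧ r y = f'
  let S : Setoid F := Relation.EqvGen.setoid rel
  have : Fintype (Quotient S) := Fintype.ofFinite _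
  let L : Z → Quotient S := fun z => Quotient.mk S (l (ι z))
  let R : Z → Quotient S := fun z => Quotient.mk S (r (ι z))
  let Θ : (Quotient S → ZMod 2) →ₗ[ZMod 2] (Z → ZMod 2) :=
    LinearMap.funLeft (ZMod 2) (ZMod 2) L + LinearMap.funLeft (ZMod 2) (ZMod 2) R
  have hΘ : ∀ s z, Θ s z = s (L z) + s (R z) := fun _ _ => rfl
  have hbd : ∀ (s : Quotient S → ZMod 2) (u : I → ZMod 2),
      ∑ z, Θ s z * (u (i z) + u (j z)) = 0 := by
    intro s u
    rw [← hP.boundary_cycle (fun f => s (Quotient.mk S f)) (fun x => (μ x).elim 0 u)]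
    refine Finset.sum_of_injOn ι hι.injOn (fun _ _ => Finset.mem_coe.2 (Finset.mem_univ _))
      (fun y _ hy => ?_) fun z _ => ?_
    · by_cases hint : ∃ i, μ (a y) = some i ∧ μ (b y) = some i
      · obtain ⟨i, h1, h2⟩ := hint
        rw [h1, h2, add_self_zmod_two, mul_zero]
      · have hd : Del y := ⟨fun z hz => hy ⟨z, Finset.mem_coe.2 (Finset.mem_univ _), hz⟩, hint⟩
        have : Quotient.mk S (l y) = Quotient.mk S (r y) :=
          Quotient.sound (Relation.EqvGen.rel _ _ ⟨y, hd, rfl, rfl⟩)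
        rw [this, add_self_zmod_two, zero_mul]
    · rw [hi, hj]
      rfl
  let δ : (I → ZMod 2) →ₗ[ZMod 2] (Z → ZMod 2) :=
    LinearMap.funLeft (ZMod 2) (ZMod 2) i + LinearMap.funLeft (ZMod 2) (ZMod 2) j
  -- Whatever is orthogonal to all face boundaries of the minor is a coboundary there. For the zero
  -- extension of `h`, test against cycles `y` that vanish on deleted edges: such a `y` bounds a set
  -- of faces that is constant on the classes of `S`, so it comes from the minor.
  have hperp : perp (LinearMap.range Θ) ≤ LinearMap.range δ := by
    intro h hh
    let δX : (X → ZMod 2) →ₗ[ZMod 2] (Y → ZMod 2) :=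
      LinearMap.funLeft (ZMod 2) (ZMod 2) a + LinearMap.funLeft (ZMod 2) (ZMod 2) b
    let T : Submodule (ZMod 2) (Y → ZMod 2) :=
      { carrier := {k | ∀ y, ¬ Del y → k y = 0}
        add_mem' := fun h1 h2 y hy => by simp [h1 y hy, h2 y hy]
        zero_mem' := fun _ _ => rfl
        smul_mem' := fun c k hk y hy => by simp [hk y hy] }
    have hmem : Function.extend ι h 0 ∈ LinearMap.range δX ⊔ T := by
      refine mem_of_perp fun y hy => ?_
      rw [perp_sup] at hy
      obtain ⟨s, hs⟩ := hP.cycle_boundary y fun u => by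
        rw [← hy.1 (δX u) ⟨u, rfl⟩, dotProduct_comm]
        rfl
      have hdel : ∀ e, Del e → s (l e) = s (r e) := by
        intro e he
        have h1 := hy.2 (Pi.single e 1) fun e' he' =>
          Pi.single_eq_of_ne (fun h => he' (by rw [h]; exact he)) 1
        rw [single_dotProduct, one_mul, hs] at h1
        exact CharTwo.add_eq_zero.1 h1
      have hcl : ∀ f f', Relation.EqvGen rel f f' → s f = s f' := by
        intro f f' hff
        induction hff with
        | rel f f' h =>
          obtain ⟨e, he, rfl, rfl⟩ := h
          exact hdel e he
        | refl => rfl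
        | symm _ _ _ ih => exact ih.symm
        | trans _ _ _ _ _ ih1 ih2 => exact ih1.trans ih2
      have h2 := hh (Θ (Quotient.lift s hcl)) ⟨_, rfl⟩
      change ∑ e, y e * Function.extend ι h 0 e = 0
      rw [sum_extend_mul hι, ← h2]
      exact Finset.sum_congr rfl fun z _ => by rw [hs]; rfl
    obtain ⟨_, ⟨u, rfl⟩, t, ht, hut⟩ := Submodule.mem_sup.1 hmem
    have hu : ∀ e, ¬ Del e → u (a e) + u (b e) = Function.extend ι h 0 e := fun e he => by
      rw [← hut, Pi.add_apply, ht e he, add_zero]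
      rfl
    -- The potential `u` is unchanged along an edge inside a fibre, since such an edge is neither
    -- deleted nor in the image of `ι`. Fibres being connected, `u` descends to the minor.
    have hconst : ∀ i x x', μ x = some i → μ x' = some i → u x = u x' := by
      intro i x x' hx hx'
      have := hconn i x x' hx hx'
      clear hx hx'
      induction this with
      | rel p q h =>
        obtain ⟨hp, hq, e, rfl, rfl⟩ := h
        have h1 : ∀ z, ι z ≠ e := by
          rintro z rfl
          rw [hi] at hp
          rw [hj] at hq
          exact hne z (Option.some_injective _ (hp.trans hq.symm))
        have h2 := hu e fun hd => hd.2 ⟨i, hp, hq⟩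
        rw [Function.extend_apply' _ _ _ (fun ⟨z, hz⟩ => h1 z hz)] at h2
        exact CharTwo.add_eq_zero.1 h2
      | refl => rfl
      | symm _ _ _ ih => exact ih.symm
      | trans _ _ _ _ _ ih1 ih2 => exact ih1.trans ih2
    refine ⟨fun i => if hx : ∃ x, μ x = some i then u hx.choose else 0, funext fun z => ?_⟩
    have hx : ∃ x, μ x = some (i z) := ⟨_, hi z⟩
    have hx' : ∃ x, μ x = some (j z) := ⟨_, hj z⟩
    have h1 := hu (ι z) fun hd => hd.1 z rfl
    rw [hι.extend_apply] at h1
    rw [← h1]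
    change (if hx : ∃ x, μ x = some (i z) then u hx.choose else 0)
      + (if hx : ∃ x, μ x = some (j z) then u hx.choose else 0) = _
    rw [dif_pos hx, dif_pos hx', hconst _ _ _ hx.choose_spec (hi z),
      hconst _ _ _ hx'.choose_spec (hj z)]
  let kC : Quotient S → Z → ZMod 2 := fun C => Θ (Pi.single C 1)
  let A : Finset (Quotient S) := Finset.univ.filter fun C => kC C ≠ 0
  have hrange : finrank (ZMod 2) (LinearMap.range Θ) ≤ A.card := by
    have hle : LinearMap.range Θ ≤ Submodule.span (ZMod 2) (A.image kC : Set (Z → ZMod 2)) := by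
      rintro _ ⟨s, rfl⟩
      rw [← Finset.univ_sum_single s, map_sum]
      refine Submodule.sum_mem _ fun C _ => ?_
      have : Θ (Pi.single C (s C)) = s C • kC C := by
        rw [← map_smul, ← Pi.single_smul, smul_eq_mul, mul_one]
      rw [this]
      by_cases hC : kC C = 0
      · rw [hC, smul_zero]
        exact Submodule.zero_mem _
      · exact Submodule.smul_mem _ _ (Submodule.subset_span (Finset.mem_coe.2
          (Finset.mem_image_of_mem _ (Finset.mem_filter.2 ⟨Finset.mem_univ _, hC⟩))))
    exact (Submodule.finrank_mono hle).trans
      ((finrank_span_finset_le_card _).trans Finset.card_image_le)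
  have hZ := finrank_perp (LinearMap.range Θ)
  have h1 := (Submodule.finrank_mono hperp).trans (LinearMap.finrank_range_le δ)
  rw [Module.finrank_fintype_fun_eq_card] at h1
  -- Double counting of incidences: a face with non-zero boundary has at least `g` edges, and an
  -- edge lies on at most two boundaries. Together with `h1` and `hZ`, which give `|Z| - |A| ≤ |I|`,
  -- this is the inequality.
  have hcount : A.card * g ≤ 2 * Fintype.card Z := by
    calc A.card * g ≤ ∑ C ∈ A, (Finset.univ.filter fun z => kC C z ≠ 0).card := by
          rw [← smul_eq_mul]
          refine Finset.card_nsmul_le_sum _ _ _ fun C hC => ?_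
          exact hg _ (Finset.mem_filter.1 hC).2 (hbd _)
      _ ≤ ∑ C, (Finset.univ.filter fun z => kC C z ≠ 0).card :=
          Finset.sum_le_sum_of_subset (Finset.subset_univ _)
      _ = ∑ z, (Finset.univ.filter fun C => kC C z ≠ 0).card := by
          simp only [Finset.card_filter]
          exact Finset.sum_comm
      _ ≤ ∑ z : Z, 2 := by
          refine Finset.sum_le_sum fun z _ => ?_
          refine (Finset.card_le_card (t := {L z, R z}) fun C hC => ?_).trans Finset.card_le_two
          have hC := (Finset.mem_filter.1 hC).2
          by_contra hn
          simp only [Finset.mem_insert, Finset.mem_singleton, not_or] at hn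
          refine hC ?_
          change Θ (Pi.single C 1) z = 0
          rw [hΘ, Pi.single_eq_of_ne (Ne.symm hn.1), Pi.single_eq_of_ne (Ne.symm hn.2), add_zero]
      _ = 2 * Fintype.card Z := by simp [mul_comm]
  calc g * Fintype.card Z ≤ g * (A.card + Fintype.card I) := Nat.mul_le_mul_left _ (by omega)
    _ = A.card * g + g * Fintype.card I := by ring
    _ ≤ _ := Nat.add_le_add_right hcount _

/-- A simple minor of a graph with an algebraic dual has few edges. -/
theorem IsAlgebraicDual.simple_minor_card_le [Finite F] (hP : IsAlgebraicDual a b l r) (ι : Z → Y)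
    (hι : Function.Injective ι) (μ : X → Option I) (hconn : FibreConnected a b μ) (i j : Z → I)
    (hi : ∀ z, μ (a (ι z)) = some (i z)) (hj : ∀ z, μ (b (ι z)) = some (j z))
    (hne : ∀ z, i z ≠ j z) (hsimple : ∀ z z', s(i z, j z) = s(i z', j z') → z = z') :
    Fintype.card Z ≤ 3 * Fintype.card I := by
  classical
  -- In a simple graph a non-zero cycle contains, besides an edge `z`, a further edge at each end of
  -- `z`, and these two differ. Hence `g = 3`.
  have := hP.minor_card_le ι hι μ hconn i j hi hj hne 3 ?_
  · omega
  intro k hk hcyc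
  obtain ⟨z, hz⟩ := Function.ne_iff.1 hk
  rw [Pi.zero_apply] at hz
  have hother : ∀ v, (i z = v ∨ j z = v) → ∃ z', z' ≠ z ∧ k z' ≠ 0 ∧ (i z' = v ∨ j z' = v) := by
    intro v hv
    by_contra hn
    push Not at hn
    have h := hcyc (Pi.single v 1)
    rw [Finset.sum_eq_single z] at h
    · have h2 : (Pi.single v 1 : I → ZMod 2) (i z) + (Pi.single v 1 : I → ZMod 2) (j z) = 1 := by
        rcases hv with rfl | rfl
        · rw [Pi.single_eq_same, Pi.single_eq_of_ne (Ne.symm (hne z)), add_zero]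
        · rw [Pi.single_eq_same, Pi.single_eq_of_ne (hne z), zero_add]
      rw [h2, mul_one] at h
      exact hz h
    · intro z' _ hz'
      by_cases hk' : k z' = 0
      · rw [hk', zero_mul]
      · obtain ⟨h1, h2⟩ := hn z' hz' hk'
        rw [Pi.single_eq_of_ne h1, Pi.single_eq_of_ne h2, add_zero, mul_zero]
    · exact fun h => absurd (Finset.mem_univ _) h
  obtain ⟨z1, h1, hk1, hv1⟩ := hother (i z) (Or.inl rfl)
  obtain ⟨z2, h2, hk2, hv2⟩ := hother (j z) (Or.inr rfl)
  have h12 : z1 ≠ z2 := by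
    rintro rfl
    refine h1 (hsimple _ _ ?_)
    rw [Sym2.eq_iff]
    rcases hv1 with h | h <;> rcases hv2 with h' | h'
    · exact absurd (h.symm.trans h') (hne z)
    · exact Or.inl ⟨h, h'⟩
    · exact Or.inr ⟨h', h⟩
    · exact absurd (h.symm.trans h') (hne z)
  have : ({z, z1, z2} : Finset Z).card = 3 :=
    Finset.card_eq_three.2 ⟨z, z1, z2, h1.symm, h2.symm, h12, rfl⟩
  rw [← this]
  refine Finset.card_le_card fun x hx => ?_
  simp only [Finset.mem_insert, Finset.mem_singleton] at hx
  rcases hx with rfl | rfl | rfl <;> simpa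

/-- A graph with an algebraic dual has no minor `K_{3,7}`. -/
theorem IsAlgebraicDual.not_minor_bipartite [Finite F] (hP : IsAlgebraicDual a b l r)
    (ι : Fin 3 × Fin 7 → Y) (μ : X → Option (Fin 3 ⊕ Fin 7)) (hconn : FibreConnected a b μ)
    (hι : ∀ z, (μ (a (ι z)) = some (Sum.inl z.1) ∧ μ (b (ι z)) = some (Sum.inr z.2)) ∨
      (μ (a (ι z)) = some (Sum.inr z.2) ∧ μ (b (ι z)) = some (Sum.inl z.1))) : False := by
  classical
  let i : Fin 3 × Fin 7 → Fin 3 ⊕ Fin 7 := fun z =>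
    if μ (a (ι z)) = some (Sum.inl z.1) then Sum.inl z.1 else Sum.inr z.2
  let j : Fin 3 × Fin 7 → Fin 3 ⊕ Fin 7 := fun z =>
    if μ (a (ι z)) = some (Sum.inl z.1) then Sum.inr z.2 else Sum.inl z.1
  have hi : ∀ z, μ (a (ι z)) = some (i z) := fun z => by
    by_cases h : μ (a (ι z)) = some (Sum.inl z.1)
    · simp only [i, if_pos h, h]
    · simp only [i, if_neg h]
      exact ((hι z).resolve_left fun h' => h h'.1).1
  have hj : ∀ z, μ (b (ι z)) = some (j z) := fun z => by
    by_cases h : μ (a (ι z)) = some (Sum.inl z.1)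
    · simp only [j, if_pos h]
      refine ((hι z).resolve_right fun h' => ?_).2
      rw [h] at h'
      simp at h'
    · simp only [j, if_neg h]
      exact ((hι z).resolve_left fun h' => h h'.1).2
  have hsum : ∀ (u : Fin 3 ⊕ Fin 7 → ZMod 2) z,
      u (i z) + u (j z) = u (Sum.inl z.1) + u (Sum.inr z.2) := fun u z => by
    by_cases h : μ (a (ι z)) = some (Sum.inl z.1)
    · simp only [i, j, if_pos h]
    · simp only [i, j, if_neg h]
      rw [add_comm]
  have hinj : Function.Injective ι := by
    intro z z' h
    have h1 := hι z
    have h2 := hι z'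
    rw [h] at h1
    rcases h1 with h1 | h1 <;> rcases h2 with h2 | h2 <;>
      simp [h1.1, h1.2] at h2
    · exact Prod.ext h2.1 h2.2
    · exact Prod.ext h2.2 h2.1
  have hne : ∀ z, i z ≠ j z := fun z => by
    by_cases h : μ (a (ι z)) = some (Sum.inl z.1) <;> simp [i, j, h]
  -- With girth 4, 21 edges and 10 vertices the inequality would read 84 ≤ 42 + 40. For `K_{3,m}`
  -- this count, which lacks Euler's additive constant, first fails at m = 7.
  have := hP.minor_card_le ι hinj μ hconn i j hi hj hne 4 ?_
  · simp at this
  intro k hk hcyc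
  simp only [hsum] at hcyc
  have hrow : ∀ z : Fin 3 × Fin 7, k z ≠ 0 → ∃ t, t ≠ z.2 ∧ k (z.1, t) ≠ 0 := by
    intro z hz
    by_contra hn
    push Not at hn
    have h := hcyc (Pi.single (Sum.inl z.1) 1)
    rw [Finset.sum_eq_single z] at h
    · simp only [Pi.single_eq_same, ne_eq, reduceCtorEq, not_false_eq_true, Pi.single_eq_of_ne,
        add_zero, mul_one] at h
      exact hz h
    · intro z' _ hz'
      by_cases h1 : z'.1 = z.1
      · have h2 : z'.2 ≠ z.2 := fun h2 => hz' (Prod.ext h1 h2)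
        have := hn z'.2 h2
        rw [← h1] at this
        rw [this, zero_mul]
      · rw [Pi.single_eq_of_ne (by simpa using h1), Pi.single_eq_of_ne (by simp), add_zero,
          mul_zero]
    · exact fun h => absurd (Finset.mem_univ _) h
  have hcol : ∀ z : Fin 3 × Fin 7, k z ≠ 0 → ∃ c, c ≠ z.1 ∧ k (c, z.2) ≠ 0 := by
    intro z hz
    by_contra hn
    push Not at hn
    have h := hcyc (Pi.single (Sum.inr z.2) 1)
    rw [Finset.sum_eq_single z] at h
    · simp only [Pi.single_eq_same, ne_eq, reduceCtorEq, not_false_eq_true, Pi.single_eq_of_ne,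
        zero_add, mul_one] at h
      exact hz h
    · intro z' _ hz'
      by_cases h1 : z'.2 = z.2
      · have h2 : z'.1 ≠ z.1 := fun h2 => hz' (Prod.ext h2 h1)
        have := hn z'.1 h2
        rw [← h1] at this
        rw [this, zero_mul]
      · rw [Pi.single_eq_of_ne (by simp), Pi.single_eq_of_ne (by simpa using h1), add_zero,
          mul_zero]
    · exact fun h => absurd (Finset.mem_univ _) h
  obtain ⟨z, hz⟩ := Function.ne_iff.1 hk
  rw [Pi.zero_apply] at hz
  obtain ⟨t, ht, hkt⟩ := hrow z hz
  obtain ⟨c, hc, hkc⟩ := hcol z hz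
  obtain ⟨c', hc', hkc'⟩ := hcol (z.1, t) hkt
  have h4 : ({z, (z.1, t), (c, z.2), (c', t)} : Finset (Fin 3 × Fin 7)).card = 4 := by
    have d1 : z ∉ ({(z.1, t), (c, z.2), (c', t)} : Finset (Fin 3 × Fin 7)) := by
      simp only [Finset.mem_insert, Finset.mem_singleton, Prod.ext_iff, not_or, not_and]
      exact ⟨fun _ h => ht h.symm, fun h => absurd h.symm hc, fun _ h => ht h.symm⟩
    have d2 : (z.1, t) ∉ ({(c, z.2), (c', t)} : Finset (Fin 3 × Fin 7)) := by
      simp only [Finset.mem_insert, Finset.mem_singleton, Prod.ext_iff, not_or, not_and]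
      exact ⟨fun h => absurd h.symm hc, fun h => absurd h.symm hc'⟩
    have d3 : (c, z.2) ≠ (c', t) := fun h => ht (Prod.ext_iff.1 h).2.symm
    rw [Finset.card_insert_of_notMem d1, Finset.card_insert_of_notMem d2, Finset.card_pair d3]
  rw [← h4]
  refine Finset.card_le_card fun x hx => ?_
  simp only [Finset.mem_insert, Finset.mem_singleton] at hx
  rcases hx with rfl | rfl | rfl | rfl <;> simpa

end Minors

/-! ### The truncation of a combinatorial map -/

section Truncation

variable {D : Type*} [Fintype D] (σ α : Equiv.Perm D)

/-- First endpoint of the edges of the truncated map: every dart `d` is joined with `σ d` and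
with `α d`. -/
def truncFst : D ⊕ D → D := Sum.elim id id

/-- Second endpoint of the edges of the truncated map. -/
def truncSnd : D ⊕ D → D := Sum.elim σ α

/-- The faces of the truncated map: vertices, faces and edges of the map. -/
abbrev TruncFace : Type _ :=
  Quotient (Equiv.Perm.SameCycle.setoid σ) ⊕ Quotient (Equiv.Perm.SameCycle.setoid (σ * α)) ⊕
    Quotient (Equiv.Perm.SameCycle.setoid α)

/-- One of the two faces at an edge of the truncated map. -/
def truncLeft : D ⊕ D → TruncFace σ α :=
  Sum.elim (fun d => Sum.inl (Quotient.mk _ d)) (fun d => Sum.inr (Sum.inl (Quotient.mk _ d)))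

/-- The other face at an edge of the truncated map. -/
def truncRight : D ⊕ D → TruncFace σ α :=
  Sum.elim (fun d => Sum.inr (Sum.inl (Quotient.mk _ (σ d))))
    (fun d => Sum.inr (Sum.inr (Quotient.mk _ d)))

theorem quotient_mem_invariants (π : Equiv.Perm D)
    (s : Quotient (Equiv.Perm.SameCycle.setoid π) → ZMod 2) :
    (fun d => s (Quotient.mk _ d)) ∈ invariants π := by
  rw [invariants_eq_constOn]
  exact fun x y h => congrArg s (Quotient.sound h)

variable {σ α}

/-- The cycle condition is dualized: a pair `(g, h)` orthogonal to all face boundaries has to be a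
coboundary on darts. Orthogonality to the vertex faces makes `g` a coboundary of some `p` along `σ`,
and the edge faces make `h` symmetric. The remaining faces say that `h` corrected by `p` is closed,
so exactness writes it through a function `u` on vertices. Then `u + p` is the potential sought. -/
theorem MapExact.isAlgebraicDual (hα : ∀ d, α (α d) = d) (hfix : ∀ d, α d ≠ d)
    (hex : MapExact σ α) :
    IsAlgebraicDual truncFst (truncSnd σ α) (truncLeft σ α) (truncRight σ α) := by
  classical
  have hface : ∀ s ∈ invariants (σ * α), ∀ g : D → ZMod 2,
      ∑ d, s (σ d) * g d = ∑ d, s d * g (α d) := by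
    intro s hs g
    rw [← Equiv.sum_comp α (fun d => s (σ d) * g d)]
    refine Finset.sum_congr rfl fun d _ => ?_
    have := hs d
    rw [Equiv.Perm.mul_apply] at this
    rw [this]
  constructor
  · intro s u
    set s1 : D → ZMod 2 := fun d => s (Sum.inl (Quotient.mk _ d)) with h1
    set s2 : D → ZMod 2 := fun d => s (Sum.inr (Sum.inl (Quotient.mk _ d))) with h2
    set s3 : D → ZMod 2 := fun d => s (Sum.inr (Sum.inr (Quotient.mk _ d))) with h3
    have i1 : s1 ∈ invariants σ := quotient_mem_invariants σ fun q => s (Sum.inl q)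
    have i2 : s2 ∈ invariants (σ * α) :=
      quotient_mem_invariants (σ * α) fun q => s (Sum.inr (Sum.inl q))
    have i3 : s3 ∈ invariants α := quotient_mem_invariants α fun q => s (Sum.inr (Sum.inr q))
    rw [Fintype.sum_sum_type]
    change ∑ d, (s1 d + s2 (σ d)) * (u d + u (σ d)) + ∑ d, (s2 d + s3 d) * (u d + u (α d)) = 0
    have e1 := sum_perm_invariant σ i1 u
    have e3 := sum_perm_invariant α i3 u
    have e2 := hface s2 i2 u
    have e4 : ∑ d, s2 (σ d) * u (σ d) = ∑ d, s2 d * u d :=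
      Equiv.sum_comp σ (fun d => s2 d * u d)
    simp only [add_mul, mul_add, Finset.sum_add_distrib]
    rw [e1, e3, e2, e4]
    generalize ∑ d, s1 d * u d = A
    generalize ∑ d, s2 d * u d = B
    generalize ∑ d, s2 d * u (α d) = C
    generalize ∑ d, s3 d * u d = E
    revert A B C E
    decide
  · intro k hk
    let Θ : (TruncFace σ α → ZMod 2) →ₗ[ZMod 2] (D ⊕ D → ZMod 2) :=
      LinearMap.funLeft (ZMod 2) (ZMod 2) (truncLeft σ α)
        + LinearMap.funLeft (ZMod 2) (ZMod 2) (truncRight σ α)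
    have hmem : k ∈ LinearMap.range Θ := by
      refine mem_of_perp fun y hy => ?_
      set g : D → ZMod 2 := fun d => y (Sum.inl d) with hg
      set h : D → ZMod 2 := fun d => y (Sum.inr d) with hh
      have hT : ∀ s : TruncFace σ α → ZMod 2,
          ∑ d, (s (truncLeft σ α (Sum.inl d)) + s (truncRight σ α (Sum.inl d))) * g d
          + ∑ d, (s (truncLeft σ α (Sum.inr d)) + s (truncRight σ α (Sum.inr d))) * h d = 0 := by
        intro s
        have := hy (Θ s) ⟨s, rfl⟩
        rw [dotProduct, Fintype.sum_sum_type] at this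
        exact this
      have hinv : ∀ (π : Equiv.Perm D) (s : D → ZMod 2) (hs : s ∈ invariants π),
          ∃ q : Quotient (Equiv.Perm.SameCycle.setoid π) → ZMod 2,
            ∀ d, q (Quotient.mk _ d) = s d := by
        intro π s hs
        rw [invariants_eq_constOn] at hs
        exact ⟨Quotient.lift s hs, fun _ => rfl⟩
      have hσ : ∀ s ∈ invariants σ, s ⬝ᵥ g = 0 := by
        intro s hs
        obtain ⟨q, hq⟩ := hinv σ s hs
        have := hT (Sum.elim q 0)
        simpa [truncLeft, truncRight, hq, dotProduct] using this
      have hα' : h ∈ invariants α := by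
        rw [← perp_invariants_involution hα hfix]
        intro s hs
        obtain ⟨q, hq⟩ := hinv α s hs
        have := hT (Sum.elim 0 (Sum.elim 0 q))
        simpa [truncLeft, truncRight, hq, dotProduct] using this
      have hφ : ∀ s ∈ invariants (σ * α), ∑ d, s d * g (α d) + ∑ d, s d * h d = 0 := by
        intro s hs
        obtain ⟨q, hq⟩ := hinv _ s hs
        have := hT (Sum.elim 0 (Sum.elim q 0))
        rw [← hface s hs]
        simpa [truncLeft, truncRight, hq] using this
      obtain ⟨p, hp⟩ := exists_add_comp_perm σ hσ
      obtain ⟨u, hu, hup⟩ := hex (fun d => h d + p d + p (α d)) (fun d => by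
          change h (α d) + p (α d) + p (α (α d)) = h d + p d + p (α d)
          rw [hα, hα']
          ring) fun s hs => by
        have e1 := hφ s hs
        have e2 : ∑ d, s d * g (α d) = ∑ d, s d * p (α d) + ∑ d, s d * p ((σ * α) d) := by
          rw [← Finset.sum_add_distrib]
          exact Finset.sum_congr rfl fun d _ => by rw [hp, mul_add, Equiv.Perm.mul_apply]
        rw [e2, sum_perm_invariant _ hs] at e1
        rw [dotProduct, ← e1]
        simp only [mul_add, Finset.sum_add_distrib]
        ring
      rw [dotProduct, ← hk (fun d => u d + p d), Fintype.sum_sum_type, Fintype.sum_sum_type]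
      congr 1
      · refine Finset.sum_congr rfl fun d _ => ?_
        change g d * k (Sum.inl d) = k (Sum.inl d) * (u d + p d + (u (σ d) + p (σ d)))
        rw [hu d, hp d]
        generalize u d = A
        generalize p d = B
        generalize p (σ d) = C
        generalize k (Sum.inl d) = E
        revert A B C E
        decide
      · refine Finset.sum_congr rfl fun d _ => ?_
        change h d * k (Sum.inr d) = k (Sum.inr d) * (u d + p d + (u (α d) + p (α d)))
        have e : h d = u d + u (α d) + p d + p (α d) := by
          rw [← hup d]
          generalize h d = A
          generalize p d = B
          generalize p (α d) = C
          revert A B C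
          decide
        rw [e]
        ring
    obtain ⟨s, rfl⟩ := hmem
    exact ⟨s, fun _ => rfl⟩

end Truncation

end SteinerNetwork

namespace SteinerNetwork

/-! ### Chopping graphs along breadth-first search levels -/

section Chopping

variable {Q : Type*} {H : SimpleGraph Q}

/-- Two vertices are joined by a walk of length at most `n`. -/
def Within (H : SimpleGraph Q) (n : ℕ) (x y : Q) : Prop := ∃ p : H.Walk x y, p.length ≤ n

theorem Within.trans {n m : ℕ} {x y z : Q} (h : Within H n x y) (h' : Within H m y z) :
    Within H (n + m) x z := by
  obtain ⟨p, hp⟩ := h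
  obtain ⟨q, hq⟩ := h'
  exact ⟨p.append q, by rw [SimpleGraph.Walk.length_append]; omega⟩

theorem Within.symm {n : ℕ} {x y : Q} (h : Within H n x y) : Within H n y x := by
  obtain ⟨p, hp⟩ := h
  exact ⟨p.reverse, by rwa [SimpleGraph.Walk.length_reverse]⟩

theorem Within.mono {n m : ℕ} {x y : Q} (h : Within H n x y) (hnm : n ≤ m) : Within H m x y := by
  obtain ⟨p, hp⟩ := h
  exact ⟨p, hp.trans hnm⟩

theorem Within.of_le {H' : SimpleGraph Q} (hle : H ≤ H') {n : ℕ} {x y : Q} (h : Within H n x y) :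
    Within H' n x y := by
  obtain ⟨p, hp⟩ := h
  exact ⟨p.mapLe hle, by rwa [SimpleGraph.Walk.length_map]⟩

theorem Within.refl (n : ℕ) (x : Q) : Within H n x x := ⟨SimpleGraph.Walk.nil, Nat.zero_le _⟩

theorem Within.of_adj {x y : Q} (h : H.Adj x y) : Within H 1 x y := ⟨h.toWalk, le_rfl⟩

theorem Within.reachable {n : ℕ} {x y : Q} (h : Within H n x y) : H.Reachable x y := ⟨h.choose⟩

/-- A representative of the component of a vertex. -/
noncomputable def compRoot (H : SimpleGraph Q) (x : Q) : Q := Quot.out (H.connectedComponentMk x)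

theorem reachable_compRoot (H : SimpleGraph Q) (x : Q) : H.Reachable x (compRoot H x) :=
  SimpleGraph.ConnectedComponent.exact (Quot.out_eq (H.connectedComponentMk x)).symm

theorem compRoot_eq {x y : Q} (h : H.Reachable x y) : compRoot H x = compRoot H y := by
  unfold compRoot
  rw [SimpleGraph.ConnectedComponent.sound h]

/-- The distance of a vertex from the representative of its component. -/
noncomputable def bfsLevel (H : SimpleGraph Q) (x : Q) : ℕ := H.dist x (compRoot H x)

theorem within_compRoot (H : SimpleGraph Q) (x : Q) : Within H (bfsLevel H x) x (compRoot H x) := by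
  obtain ⟨p, hp⟩ := (reachable_compRoot H x).exists_walk_length_eq_dist
  exact ⟨p, hp.le⟩

theorem bfsLevel_le {n : ℕ} {x y : Q} (h : Within H n x y) : bfsLevel H y ≤ bfsLevel H x + n := by
  have h1 := h.symm.trans (within_compRoot H x)
  rw [compRoot_eq h.reachable] at h1
  obtain ⟨p, hp⟩ := h1
  exact (SimpleGraph.dist_le p).trans (by omega)

theorem exists_bfs_pred (H : SimpleGraph Q) (x : Q) :
    ∃ y, 0 < bfsLevel H x → H.Adj x y ∧ bfsLevel H y + 1 = bfsLevel H x := by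
  by_cases h0 : 0 < bfsLevel H x
  · obtain ⟨p, hp⟩ := (reachable_compRoot H x).exists_walk_length_eq_dist
    have hp' : p.length = bfsLevel H x := hp
    clear hp
    generalize hr : compRoot H x = r at p
    cases p with
    | nil => simp at hp'; omega
    | @cons _ y _ h q =>
      refine ⟨y, fun _ => ⟨h, le_antisymm ?_ ?_⟩⟩
      · rw [← hp', SimpleGraph.Walk.length_cons]
        refine Nat.succ_le_succ ?_
        unfold bfsLevel
        rw [← compRoot_eq h.reachable, hr]
        exact SimpleGraph.dist_le q
      · exact bfsLevel_le (Within.of_adj h.symm)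
  · exact ⟨x, fun h => absurd h h0⟩

/-- The next vertex on a shortest path to the representative of the component. -/
noncomputable def bfsPred (H : SimpleGraph Q) (x : Q) : Q := (exists_bfs_pred H x).choose

theorem bfsPred_spec {x : Q} (h : 0 < bfsLevel H x) :
    H.Adj x (bfsPred H x) ∧ bfsLevel H (bfsPred H x) + 1 = bfsLevel H x :=
  (exists_bfs_pred H x).choose_spec h

/-- The shortest path from a vertex to the representative of its component. -/
noncomputable def geod (H : SimpleGraph Q) (x : Q) (t : ℕ) : Q := (bfsPred H)^[t] x

theorem geod_succ (x : Q) (t : ℕ) : geod H x (t + 1) = bfsPred H (geod H x t) :=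
  Function.iterate_succ_apply' _ _ _

theorem bfsLevel_geod {x : Q} {t : ℕ} (ht : t ≤ bfsLevel H x) :
    bfsLevel H (geod H x t) + t = bfsLevel H x := by
  induction t with
  | zero => rfl
  | succ t ih =>
    have h1 := ih (by omega)
    have h2 := (bfsPred_spec (H := H) (x := geod H x t) (by omega)).2
    rw [geod_succ]
    omega

theorem adj_geod {x : Q} {t : ℕ} (ht : t < bfsLevel H x) :
    H.Adj (geod H x t) (geod H x (t + 1)) := by
  rw [geod_succ]
  refine (bfsPred_spec ?_).1
  have := bfsLevel_geod (H := H) (x := x) (t := t) ht.le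
  omega

theorem within_geod {x : Q} {t : ℕ} (ht : t ≤ bfsLevel H x) : Within H t x (geod H x t) := by
  induction t with
  | zero => exact Within.refl 0 x
  | succ t ih => exact (ih (by omega)).trans (Within.of_adj (adj_geod ht))

theorem geod_bfsLevel (x : Q) : geod H x (bfsLevel H x) = compRoot H x := by
  have h1 := bfsLevel_geod (H := H) (x := x) le_rfl
  have h2 := within_compRoot H (geod H x (bfsLevel H x))
  rw [show bfsLevel H (geod H x (bfsLevel H x)) = 0 by omega,
    ← compRoot_eq (within_geod (H := H) (x := x) le_rfl).reachable] at h2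
  obtain ⟨p, hp⟩ := h2
  exact SimpleGraph.Walk.eq_of_length_eq_zero (Nat.le_zero.1 hp)

/-- The index of the band of `Δ` consecutive levels that contains a vertex. -/
noncomputable def band (H : SimpleGraph Q) (Δ r : ℕ) (x : Q) : ℕ := (bfsLevel H x + r) / Δ

/-- Delete the edges between different bands. -/
def chop (H : SimpleGraph Q) (Δ r : ℕ) : SimpleGraph Q where
  Adj x y := H.Adj x y ∧ band H Δ r x = band H Δ r y
  symm := ⟨fun _ _ h => ⟨h.1.symm, h.2.symm⟩⟩
  loopless := ⟨fun _ h => h.1.ne rfl⟩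

theorem chop_le (H : SimpleGraph Q) (Δ r : ℕ) : chop H Δ r ≤ H := fun _ _ h => h.1

theorem band_eq_of_reachable {Δ r : ℕ} {x y : Q} (h : (chop H Δ r).Reachable x y) :
    band H Δ r x = band H Δ r y := by
  obtain ⟨p⟩ := h
  induction p with
  | nil => rfl
  | cons h _ ih => exact h.2.trans ih

theorem bfsLevel_lt_of_band_eq {Δ r : ℕ} (hΔ : 0 < Δ) {x y : Q}
    (h : band H Δ r x = band H Δ r y) : bfsLevel H x < bfsLevel H y + Δ := by
  unfold band at h
  have h1 := Nat.div_add_mod (bfsLevel H x + r) Δ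
  have h2 := Nat.div_add_mod (bfsLevel H y + r) Δ
  have h3 := Nat.mod_lt (bfsLevel H x + r) hΔ
  rw [h] at h1
  omega

theorem bfsLevel_lt_of_reachable {Δ r : ℕ} (hΔ : 0 < Δ) {x y : Q}
    (h : (chop H Δ r).Reachable x y) : bfsLevel H x < bfsLevel H y + Δ :=
  bfsLevel_lt_of_band_eq hΔ (band_eq_of_reachable h)

/-- A shortest path stays in its component of the chopped graph until it leaves the band. -/
theorem geod_within_chop {Δ r : ℕ} {x : Q} {t : ℕ} (ht : t ≤ bfsLevel H x)
    (hband : band H Δ r (geod H x t) = band H Δ r x) :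
    Within (chop H Δ r) t x (geod H x t) := by
  have hs : ∀ s ≤ t, band H Δ r (geod H x s) = band H Δ r x := by
    intro s hs
    have h1 := bfsLevel_geod ht
    have h2 := bfsLevel_geod (H := H) (x := x) (t := s) (by omega)
    refine le_antisymm (Nat.div_le_div_right (by omega)) ?_
    rw [← hband]
    exact Nat.div_le_div_right (by omega)
  have : ∀ s ≤ t, Within (chop H Δ r) s x (geod H x s) := by
    intro s
    induction s with
    | zero => exact fun _ => Within.refl 0 x
    | succ s ih =>
      intro hst
      exact (ih (by omega)).trans (Within.of_adj ⟨adj_geod (by omega),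
        (hs s (by omega)).trans (hs (s + 1) hst).symm⟩)
  exact this t le_rfl

/-- Two vertices are joined by a path inside a set. -/
def JoinedIn (H : SimpleGraph Q) (S : Set Q) : Q → Q → Prop :=
  Relation.ReflTransGen fun p q => H.Adj p q ∧ p ∈ S ∧ q ∈ S

theorem JoinedIn.symm {S : Set Q} {x y : Q} (h : JoinedIn H S x y) : JoinedIn H S y x := by
  induction h with
  | refl => exact Relation.ReflTransGen.refl
  | tail _ h ih => exact Relation.ReflTransGen.head ⟨h.1.symm, h.2.2, h.2.1⟩ ih

theorem JoinedIn.mono {H' : SimpleGraph Q} {S S' : Set Q} (hH : H ≤ H') (hS : S ⊆ S') {x y : Q}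
    (h : JoinedIn H S x y) : JoinedIn H' S' x y :=
  Relation.ReflTransGen.mono (fun _ _ h => ⟨hH h.1, hS h.2.1, hS h.2.2⟩) _ _ h

/-- A family of disjoint connected sets forming a minor `K_{3,7}`. -/
structure BipartiteMinor (H : SimpleGraph Q) (I : Fin 3 → Set Q) (L : Fin 7 → Set Q) : Prop where
  left_joined : ∀ c, ∀ x ∈ I c, ∀ y ∈ I c, JoinedIn H (I c) x y
  right_joined : ∀ t, ∀ x ∈ L t, ∀ y ∈ L t, JoinedIn H (L t) x y
  left_disjoint : ∀ c c' x, x ∈ I c → x ∈ I c' → c = c'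
  right_disjoint : ∀ t t' x, x ∈ L t → x ∈ L t' → t = t'
  disjoint : ∀ c t x, x ∈ I c → x ∉ L t
  adj : ∀ c t, ∃ x ∈ I c, ∃ y ∈ L t, H.Adj x y

/-- The first `n` vertices of a shortest path. -/
def arm (H : SimpleGraph Q) (x : Q) (n : ℕ) : Set Q := {y | ∃ s < n, geod H x s = y}

theorem arm_joined {x : Q} {n : ℕ} (hn : n ≤ bfsLevel H x) {y : Q} (hy : y ∈ arm H x n) :
    JoinedIn H (arm H x n) x y := by
  obtain ⟨s, hs, rfl⟩ := hy
  induction s with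
  | zero => exact Relation.ReflTransGen.refl
  | succ s ih =>
    exact (ih (by omega)).tail ⟨adj_geod (by omega), ⟨s, by omega, rfl⟩, ⟨s + 1, hs, rfl⟩⟩

/-- The ball around the representative of the component of `v`. -/
def innerBall (H : SimpleGraph Q) (v : Q) (n : ℕ) : Set Q :=
  {y | H.Reachable v y ∧ bfsLevel H y ≤ n}

theorem innerBall_joined {v : Q} {n : ℕ} {y : Q} (hy : y ∈ innerBall H v n) :
    JoinedIn H (innerBall H v n) y (compRoot H v) := by
  have hmem : ∀ t ≤ bfsLevel H y, geod H y t ∈ innerBall H v n := fun t ht =>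
    ⟨hy.1.trans (within_geod ht).reachable, by
      have := bfsLevel_geod ht
      have := hy.2
      omega⟩
  rw [compRoot_eq hy.1, ← geod_bfsLevel]
  have : ∀ t ≤ bfsLevel H y, JoinedIn H (innerBall H v n) y (geod H y t) := by
    intro t
    induction t with
    | zero => exact fun _ => Relation.ReflTransGen.refl
    | succ t ih =>
      exact fun ht => (ih (by omega)).tail ⟨adj_geod ht, hmem t (by omega), hmem _ ht⟩
  exact this _ le_rfl

/-- After three rounds of chopping, a component with seven vertices that are pairwise far apart
yields a minor `K_{3,7}`. -/
theorem exists_bipartiteMinor_of_far {H₀ : SimpleGraph Q} {Δ : ℕ} (hΔ : 0 < Δ) {r₀ r₁ r₂ : ℕ}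
    {H₁ H₂ H₃ : SimpleGraph Q} (e₁ : H₁ = chop H₀ Δ r₀) (e₂ : H₂ = chop H₁ Δ r₁)
    (e₃ : H₃ = chop H₂ Δ r₂) (v : Fin 7 → Q) (hreach : ∀ t t', H₃.Reachable (v t) (v t'))
    (hfar : ∀ t t', t ≠ t' → ¬ Within H₀ (24 * Δ) (v t) (v t')) :
    ∃ I L, BipartiteMinor H₀ I L := by
  have l₁ : H₁ ≤ H₀ := e₁ ▸ chop_le _ _ _
  have l₂ : H₂ ≤ H₁ := e₂ ▸ chop_le _ _ _
  have l₃ : H₃ ≤ H₂ := e₃ ▸ chop_le _ _ _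
  have reach₂ : ∀ t t', H₂.Reachable (v t) (v t') := fun t t' => (hreach t t').mono l₃
  have reach₁ : ∀ t t', H₁.Reachable (v t) (v t') := fun t t' => (reach₂ t t').mono l₂
  have band₀ : ∀ {x y}, H₁.Reachable x y → bfsLevel H₀ x < bfsLevel H₀ y + Δ := fun h =>
    bfsLevel_lt_of_reachable hΔ (e₁ ▸ h)
  have band₁ : ∀ {x y}, H₂.Reachable x y → bfsLevel H₁ x < bfsLevel H₁ y + Δ := fun h =>
    bfsLevel_lt_of_reachable hΔ (e₂ ▸ h)
  have band₂ : ∀ {x y}, H₃.Reachable x y → bfsLevel H₂ x < bfsLevel H₂ y + Δ := fun h =>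
    bfsLevel_lt_of_reachable hΔ (e₃ ▸ h)
  set k₀ := bfsLevel H₀ (v 0) with hk₀
  set k₁ := bfsLevel H₁ (v 0) with hk₁
  set k₂ := bfsLevel H₂ (v 0) with hk₂
  -- A path from `v 0` to `v 1` through the root of their component has length less than twice the
  -- level plus Δ. With a level of at most 10 Δ this would be below the separation 24 Δ.
  have far_of : ∀ K : SimpleGraph Q, K ≤ H₀ → K.Reachable (v 0) (v 1) →
      bfsLevel K (v 1) < bfsLevel K (v 0) + Δ → 10 * Δ < bfsLevel K (v 0) := by
    intro K hK hr hb
    by_contra hn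
    have h1 := within_compRoot K (v 1)
    rw [← compRoot_eq hr] at h1
    exact hfar 0 1 (by decide)
      ((((within_compRoot K (v 0)).trans h1.symm).of_le hK).mono (by omega))
  have big₀ : 10 * Δ < k₀ := far_of H₀ le_rfl ((reach₁ 0 1).mono l₁) (band₀ (reach₁ 1 0))
  have big₁ : 10 * Δ < k₁ := far_of H₁ l₁ (reach₁ 0 1) (band₁ (reach₂ 1 0))
  have big₂ : 10 * Δ < k₂ := far_of H₂ (l₂.trans l₁) (reach₂ 0 1) (band₂ (hreach 1 0))
  -- An arm of this length stops just before level `k₂ - 5 * Δ`, the radius of the ball it is to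
  -- touch; likewise for `n₁` and `n₀`.
  let n₂ : Fin 7 → ℕ := fun t => bfsLevel H₂ (v t) + 5 * Δ - k₂
  let n₁ : Fin 7 → ℕ := fun t => bfsLevel H₁ (v t) + 5 * Δ - k₁
  let m : Fin 7 → ℕ := fun t => bfsLevel H₁ (v t) + 3 * Δ - k₁
  -- The arm in `H₀` starts from this point, at level `k₁ - 3 * Δ` of `H₁`, rather than from `v t`.
  -- While it stays in the component in `H₁` it moves by less than Δ, so it keeps clear both of `I₂`
  -- (levels above `k₁ - Δ`) and of `I₁` (levels up to `k₁ - 5 * Δ`).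
  let w : Fin 7 → Q := fun t => geod H₁ (v t) (m t)
  let n₀ : Fin 7 → ℕ := fun t => bfsLevel H₀ (w t) + 5 * Δ - k₀
  have b₂ : ∀ t, k₂ < bfsLevel H₂ (v t) + Δ ∧ bfsLevel H₂ (v t) < k₂ + Δ := fun t =>
    ⟨band₂ (hreach 0 t), band₂ (hreach t 0)⟩
  have b₁ : ∀ t, k₁ < bfsLevel H₁ (v t) + Δ ∧ bfsLevel H₁ (v t) < k₁ + Δ := fun t =>
    ⟨band₁ (reach₂ 0 t), band₁ (reach₂ t 0)⟩
  have dn₂ : ∀ t, n₂ t + k₂ = bfsLevel H₂ (v t) + 5 * Δ := fun t => by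
    have := b₂ t
    simp only [n₂]; omega
  have dn₁ : ∀ t, n₁ t + k₁ = bfsLevel H₁ (v t) + 5 * Δ := fun t => by
    have := b₁ t
    simp only [n₁]; omega
  have dm : ∀ t, m t + k₁ = bfsLevel H₁ (v t) + 3 * Δ := fun t => by
    have := b₁ t
    simp only [m]; omega
  have hwithin : ∀ t, Within H₁ (m t) (v t) (w t) := fun t =>
    within_geod (by have := dm t; omega)
  have lw : ∀ t, bfsLevel H₁ (w t) + 3 * Δ = k₁ := fun t => by
    have h1 := dm t
    have h2 := bfsLevel_geod (H := H₁) (x := v t) (t := m t) (by omega)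
    simp only [w]; omega
  have b₀ : ∀ t, k₀ < bfsLevel H₀ (w t) + Δ ∧ bfsLevel H₀ (w t) < k₀ + Δ := fun t =>
    ⟨band₀ ((reach₁ 0 t).trans (hwithin t).reachable),
      band₀ ((reach₁ 0 t).trans (hwithin t).reachable).symm⟩
  have dn₀ : ∀ t, n₀ t + k₀ = bfsLevel H₀ (w t) + 5 * Δ := fun t => by
    have := b₀ t
    simp only [n₀]; omega
  let I₀ := innerBall H₀ (v 0) (k₀ - 5 * Δ)
  let I₁ := innerBall H₁ (v 0) (k₁ - 5 * Δ)
  let I₂ := innerBall H₂ (v 0) (k₂ - 5 * Δ)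
  let A₀ : Fin 7 → Set Q := fun t => arm H₀ (w t) (n₀ t)
  let A₁ : Fin 7 → Set Q := fun t => arm H₁ (v t) (n₁ t)
  let A₂ : Fin 7 → Set Q := fun t => arm H₂ (v t) (n₂ t)
  have wA₁ : ∀ t, w t ∈ A₁ t := fun t =>
    ⟨m t, by have := dm t; have := dn₁ t; omega, rfl⟩
  -- levels on the inner balls
  have I₂lev : ∀ y ∈ I₂, bfsLevel H₂ y + 5 * Δ ≤ k₂ ∧ k₁ < bfsLevel H₁ y + Δ ∧
      bfsLevel H₁ y < k₁ + Δ ∧ k₀ < bfsLevel H₀ y + Δ := fun y hy =>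
    ⟨by have := hy.2; omega, band₁ hy.1, band₁ hy.1.symm, band₀ (hy.1.mono l₂)⟩
  have I₁lev : ∀ y ∈ I₁, bfsLevel H₁ y + 5 * Δ ≤ k₁ ∧ k₀ < bfsLevel H₀ y + Δ := fun y hy =>
    ⟨by have := hy.2; omega, band₀ hy.1⟩
  have I₀lev : ∀ y ∈ I₀, bfsLevel H₀ y + 5 * Δ ≤ k₀ := fun y hy => by
    have := hy.2; omega
  -- levels on the arms
  have A₂lev : ∀ t, ∀ y ∈ A₂ t, k₂ < bfsLevel H₂ y + 5 * Δ ∧ k₁ < bfsLevel H₁ y + Δ ∧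
      k₀ < bfsLevel H₀ y + Δ := by
    rintro t y ⟨s, hs, rfl⟩
    have h1 := dn₂ t
    have h2 := bfsLevel_geod (H := H₂) (x := v t) (t := s) (by omega)
    have h3 : H₂.Reachable (v 0) (geod H₂ (v t) s) :=
      (reach₂ 0 t).trans (within_geod (by omega)).reachable
    exact ⟨by omega, band₁ h3, band₀ (h3.mono l₂)⟩
  have A₁lev : ∀ t, ∀ y ∈ A₁ t, k₁ < bfsLevel H₁ y + 5 * Δ ∧ k₀ < bfsLevel H₀ y + Δ ∧
      y ∉ I₂ := by
    rintro t y ⟨s, hs, rfl⟩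
    have h1 := dn₁ t
    have h2 := bfsLevel_geod (H := H₁) (x := v t) (t := s) (by omega)
    have h3 : H₁.Reachable (v 0) (geod H₁ (v t) s) :=
      (reach₁ 0 t).trans (within_geod (by omega)).reachable
    -- A point of `I₂` is in the component of `v t` in `H₂`. The arm has then stayed in its band, so
    -- it has made fewer than Δ steps, all of them in `H₂`. Its level in `H₂` is therefore still
    -- within 2 Δ of `k₂`, too high for `I₂`.
    refine ⟨by omega, band₀ h3, fun hI => ?_⟩
    have h4 : H₂.Reachable (geod H₁ (v t) s) (v t) := hI.1.symm.trans (reach₂ 0 t)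
    have h5 : Within H₂ s (v t) (geod H₁ (v t) s) := by
      rw [e₂]
      exact geod_within_chop (by omega) (band_eq_of_reachable (e₂ ▸ h4))
    have h6 := bfsLevel_le h5.symm
    have h7 := band₁ h4.symm
    have h8 := (I₂lev _ hI).1
    have := b₂ t
    omega
  have A₀lev : ∀ t, ∀ y ∈ A₀ t, k₀ < bfsLevel H₀ y + 5 * Δ ∧ y ∉ I₁ ∧ y ∉ I₂ := by
    rintro t y ⟨s, hs, rfl⟩
    have h1 := dn₀ t
    have h2 := bfsLevel_geod (H := H₀) (x := w t) (t := s) (by omega)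
    have hpre : H₁.Reachable (v 0) (geod H₀ (w t) s) → s < Δ ∧ Within H₁ s (w t) (geod H₀ (w t) s) := by
      intro h3
      have h4 : H₁.Reachable (geod H₀ (w t) s) (w t) :=
        h3.symm.trans ((reach₁ 0 t).trans (hwithin t).reachable)
      have h7 := band₀ h4.symm
      refine ⟨by omega, ?_⟩
      rw [e₁]
      exact geod_within_chop (by omega) (band_eq_of_reachable (e₁ ▸ h4))
    have hw := lw t
    refine ⟨by omega, fun hI => ?_, fun hI => ?_⟩
    · obtain ⟨h3, h4⟩ := hpre hI.1
      have h5 := bfsLevel_le h4.symm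
      have h6 := (I₁lev _ hI).1
      omega
    · obtain ⟨h3, h4⟩ := hpre (hI.1.mono l₂)
      have h5 := bfsLevel_le h4
      have h6 := (I₂lev _ hI).2.1
      omega
  -- arms stay close to their starting points
  have close : ∀ t, ∀ y ∈ A₂ t ∪ A₁ t ∪ A₀ t, Within H₀ (12 * Δ) (v t) y := by
    rintro t y ((⟨s, hs, rfl⟩ | ⟨s, hs, rfl⟩) | ⟨s, hs, rfl⟩)
    · have h1 := dn₂ t
      have h2 := b₂ t
      exact ((within_geod (H := H₂) (by omega)).of_le (l₂.trans l₁)).mono (by omega)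
    · have h1 := dn₁ t
      have h2 := b₁ t
      exact ((within_geod (H := H₁) (by omega)).of_le l₁).mono (by omega)
    · have h1 := dn₀ t
      have h2 := b₀ t
      have h3 := dm t
      have h4 := b₁ t
      exact (((hwithin t).of_le l₁).trans (within_geod (H := H₀) (by omega))).mono (by omega)
  have joined : ∀ t, ∀ y ∈ A₂ t ∪ A₁ t ∪ A₀ t, JoinedIn H₀ (A₂ t ∪ A₁ t ∪ A₀ t) (v t) y := by
    have j1 : ∀ t, ∀ y ∈ A₁ t, JoinedIn H₀ (A₂ t ∪ A₁ t ∪ A₀ t) (v t) y := fun t y hy =>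
      (arm_joined (by have := dn₁ t; omega) hy).mono l₁ fun x hx => Or.inl (Or.inr hx)
    rintro t y ((hy | hy) | hy)
    · exact (arm_joined (by have := dn₂ t; omega) hy).mono (l₂.trans l₁)
        fun x hx => Or.inl (Or.inl hx)
    · exact j1 t y hy
    · exact (j1 t _ (wA₁ t)).trans
        ((arm_joined (by have := dn₀ t; omega) hy).mono le_rfl fun x hx => Or.inr hx)
  have ball : ∀ (K : SimpleGraph Q) (n : ℕ), K ≤ H₀ → ∀ x ∈ innerBall K (v 0) n,
      ∀ y ∈ innerBall K (v 0) n, JoinedIn H₀ (innerBall K (v 0) n) x y := fun K n hK x hx y hy =>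
    JoinedIn.mono hK subset_rfl ((innerBall_joined hx).trans (innerBall_joined hy).symm)
  have touch : ∀ (K : SimpleGraph Q) (x : Q) (n k : ℕ), K ≤ H₀ → K.Reachable (v 0) x → 0 < n →
      5 * Δ < k → n + k = bfsLevel K x + 5 * Δ →
      ∃ a ∈ innerBall K (v 0) (k - 5 * Δ), ∃ b ∈ arm K x n, H₀.Adj a b := by
    intro K x n k hK hr hn hk hnk
    obtain ⟨n, rfl⟩ := Nat.exists_eq_succ_of_ne_zero hn.ne'
    have h1 := bfsLevel_geod (H := K) (x := x) (t := n + 1) (by omega)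
    exact ⟨_, ⟨hr.trans (within_geod (by omega)).reachable, by omega⟩, _, ⟨n, by omega, rfl⟩,
      hK (adj_geod (by omega)).symm⟩
  refine ⟨![I₀, I₁, I₂], fun t => A₂ t ∪ A₁ t ∪ A₀ t, ?_, ?_, ?_, ?_, ?_, ?_⟩
  · intro c
    fin_cases c
    · exact ball H₀ _ le_rfl
    · exact ball H₁ _ l₁
    · exact ball H₂ _ (l₂.trans l₁)
  · exact fun t x hx y hy => (joined t x hx).symm.trans (joined t y hy)
  · intro c c' x
    have c01 : x ∈ I₀ → x ∈ I₁ → False := fun h h' => by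
      have := I₀lev x h; have := I₁lev x h'; omega
    have c02 : x ∈ I₀ → x ∈ I₂ → False := fun h h' => by
      have := I₀lev x h; have := I₂lev x h'; omega
    have c12 : x ∈ I₁ → x ∈ I₂ → False := fun h h' => by
      have := I₁lev x h; have := I₂lev x h'; omega
    fin_cases c <;> fin_cases c' <;> intro h h'
    · rfl
    · exact (c01 h h').elim
    · exact (c02 h h').elim
    · exact (c01 h' h).elim
    · rfl
    · exact (c12 h h').elim
    · exact (c02 h' h).elim
    · exact (c12 h' h).elim
    · rfl
  -- Legs stay within 12 Δ of their starting points, so two legs that met would contradict the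
  -- separation 24 Δ.
  · intro t t' x hx hx'
    by_contra hne
    exact hfar t t' hne (((close t x hx).trans (close t' x hx').symm).mono (by omega))
  · intro c t x
    fin_cases c
    · rintro h ((h' | h') | h')
      · have := I₀lev x h; have := A₂lev t x h'; omega
      · have := I₀lev x h; have := A₁lev t x h'; omega
      · have := I₀lev x h; have := A₀lev t x h'; omega
    · rintro h ((h' | h') | h')
      · have := I₁lev x h; have := A₂lev t x h'; omega
      · have := I₁lev x h; have := A₁lev t x h'; omega
      · exact (A₀lev t x h').2.1 h
    · rintro h ((h' | h') | h')
      · have := I₂lev x h; have := A₂lev t x h'; omega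
      · exact (A₁lev t x h').2.2 h
      · exact (A₀lev t x h').2.2 h
  · intro c t
    fin_cases c
    · obtain ⟨a, ha, b, hb, hab⟩ := touch H₀ (w t) (n₀ t) k₀ le_rfl
        (((reach₁ 0 t).trans (hwithin t).reachable).mono l₁)
        (by have := dn₀ t; have := b₀ t; omega) (by omega) (dn₀ t)
      exact ⟨a, ha, b, Or.inr hb, hab⟩
    · obtain ⟨a, ha, b, hb, hab⟩ := touch H₁ (v t) (n₁ t) k₁ l₁ (reach₁ 0 t)
        (by have := dn₁ t; have := b₁ t; omega) (by omega) (dn₁ t)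
      exact ⟨a, ha, b, Or.inl (Or.inr hb), hab⟩
    · obtain ⟨a, ha, b, hb, hab⟩ := touch H₂ (v t) (n₂ t) k₂ (l₂.trans l₁) (reach₂ 0 t)
        (by have := dn₂ t; have := b₂ t; omega) (by omega) (dn₂ t)
      exact ⟨a, ha, b, Or.inl (Or.inl hb), hab⟩

end Chopping

end SteinerNetwork

namespace SteinerNetwork

/-! ### Cutting a bounded-degree graph without `K_{3,7}` into small parts -/

section Partition

variable {Q : Type*} [Fintype Q] {H : SimpleGraph Q}

open Classical in
theorem card_within_le {δ : ℕ} (hδ : ∀ x, (Finset.univ.filter fun y => H.Adj x y).card ≤ δ) (n : ℕ)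
    (x : Q) : (Finset.univ.filter fun y => Within H n x y).card ≤ (δ + 1) ^ n := by
  induction n generalizing x with
  | zero =>
    rw [pow_zero]
    refine Finset.card_le_one.2 fun y hy z hz => ?_
    obtain ⟨p, hp⟩ := (Finset.mem_filter.1 hy).2
    obtain ⟨q, hq⟩ := (Finset.mem_filter.1 hz).2
    rw [← SimpleGraph.Walk.eq_of_length_eq_zero (Nat.le_zero.1 hp),
      ← SimpleGraph.Walk.eq_of_length_eq_zero (Nat.le_zero.1 hq)]
  | succ n ih =>
    have hsub : (Finset.univ.filter fun y => Within H (n + 1) x y) ⊆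
        (insert x (Finset.univ.filter fun z => H.Adj x z)).biUnion
          fun z => Finset.univ.filter fun y => Within H n z y := by
      intro y hy
      obtain ⟨p, hp⟩ := (Finset.mem_filter.1 hy).2
      rw [Finset.mem_biUnion]
      cases p with
      | nil =>
        exact ⟨x, Finset.mem_insert_self _ _, Finset.mem_filter.2
          ⟨Finset.mem_univ _, Within.refl n x⟩⟩
      | @cons _ z _ h q =>
        refine ⟨z, Finset.mem_insert_of_mem (Finset.mem_filter.2 ⟨Finset.mem_univ _, h⟩),
          Finset.mem_filter.2 ⟨Finset.mem_univ _, q, ?_⟩⟩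
        rw [SimpleGraph.Walk.length_cons] at hp
        omega
    calc _ ≤ _ := Finset.card_le_card hsub
      _ ≤ (insert x (Finset.univ.filter fun z => H.Adj x z)).card * (δ + 1) ^ n :=
        Finset.card_biUnion_le_card_mul _ _ _ fun z _ => ih z
      _ ≤ (δ + 1) * (δ + 1) ^ n := Nat.mul_le_mul_right _
        ((Finset.card_insert_le _ _).trans (Nat.succ_le_succ (hδ x)))
      _ = (δ + 1) ^ (n + 1) := by ring

open Classical in
/-- For a suitable shift, chopping removes at most a `1 / Δ` fraction of the edges. -/
theorem exists_cheap_shift (H : SimpleGraph Q) {Δ : ℕ} (hΔ : 0 < Δ) (c : Q → Q → ℝ)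
    (hc : ∀ x y, 0 ≤ c x y) :
    ∃ r, ∑ e : Q × Q, (if H.Adj e.1 e.2 ∧ ¬ (chop H Δ r).Adj e.1 e.2 then c e.1 e.2 else 0)
      ≤ 1 / Δ * ∑ e : Q × Q, if H.Adj e.1 e.2 then c e.1 e.2 else 0 := by
  -- The bands separate level `a` from `a + 1` only when `a + r + 1` is a multiple of Δ, which
  -- happens for at most one of Δ consecutive shifts.
  have hstep : ∀ a b : ℕ, b = a + 1 →
      ((Finset.range Δ).filter fun r => (a + r) / Δ ≠ (b + r) / Δ).card ≤ 1 := by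
    rintro a _ rfl
    refine Finset.card_le_one.2 fun r hr s hs => ?_
    simp only [Finset.mem_filter, Finset.mem_range] at hr hs
    have key : ∀ r, (a + r) / Δ ≠ (a + 1 + r) / Δ → Δ ∣ a + r + 1 := by
      intro r h
      by_contra hn
      rw [show a + 1 + r = a + r + 1 by ring, Nat.succ_div, if_neg hn] at h
      exact h rfl
    obtain ⟨u, hu⟩ := key r hr.2
    obtain ⟨v, hv⟩ := key s hs.2
    have : u = v := by
      rcases lt_trichotomy u v with h | h | h
      · have := Nat.mul_le_mul_left Δ h
        rw [Nat.mul_succ] at this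
        omega
      · exact h
      · have := Nat.mul_le_mul_left Δ h
        rw [Nat.mul_succ] at this
        omega
    subst this
    omega
  have hone : ∀ x y, H.Adj x y →
      ((Finset.range Δ).filter fun r => ¬ (chop H Δ r).Adj x y).card ≤ 1 := by
    intro x y h
    have h1 := bfsLevel_le (Within.of_adj h)
    have h2 := bfsLevel_le (Within.of_adj h.symm)
    have e : ((Finset.range Δ).filter fun r => ¬ (chop H Δ r).Adj x y)
        = (Finset.range Δ).filter fun r => (bfsLevel H x + r) / Δ ≠ (bfsLevel H y + r) / Δ :=
      Finset.filter_congr fun r _ => not_congr ⟨fun h' => h'.2, fun h' => ⟨h, h'⟩⟩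
    rw [e]
    by_cases h3 : bfsLevel H x = bfsLevel H y
    · rw [h3]
      simp
    · rcases Nat.lt_or_gt_of_ne h3 with h4 | h4
      · exact hstep _ _ (by omega)
      · rw [Finset.filter_congr fun r _ => ne_comm]
        exact hstep _ _ (by omega)
  -- Averaging: if every shift were expensive, the sum over all Δ shifts would exceed the total
  -- weight, although each edge is cut by at most one shift.
  by_contra hn
  push Not at hn
  have hlt : ∑ r ∈ Finset.range Δ, (1 / (Δ : ℝ) * ∑ e : Q × Q, if H.Adj e.1 e.2 then c e.1 e.2 else 0)
      < ∑ r ∈ Finset.range Δ, ∑ e : Q × Q,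
        (if H.Adj e.1 e.2 ∧ ¬ (chop H Δ r).Adj e.1 e.2 then c e.1 e.2 else 0) :=
    Finset.sum_lt_sum_of_nonempty (Finset.nonempty_range_iff.2 hΔ.ne') fun r _ => hn r
  rw [Finset.sum_const, Finset.card_range, nsmul_eq_mul, ← mul_assoc,
    mul_one_div_cancel (by exact_mod_cast hΔ.ne'), one_mul, Finset.sum_comm] at hlt
  refine absurd hlt (not_lt.2 (Finset.sum_le_sum fun e _ => ?_))
  by_cases h : H.Adj e.1 e.2
  · simp only [h, true_and, if_true]
    rw [← Finset.sum_filter, Finset.sum_const, nsmul_eq_mul]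
    have : (((Finset.range Δ).filter fun r => ¬ (chop H Δ r).Adj e.1 e.2).card : ℝ) ≤ 1 := by
      exact_mod_cast hone _ _ h
    nlinarith [hc e.1 e.2]
  · simp [h]

open Classical in
/-- A graph of bounded degree without a minor `K_{3,7}` can be cut into parts of bounded size by
deleting a small fraction of its edges. -/
theorem exists_small_parts {δ : ℕ} (hδ : ∀ x, (Finset.univ.filter fun y => H.Adj x y).card ≤ δ)
    (hH : ¬ ∃ I L, BipartiteMinor H I L) {Δ : ℕ} (hΔ : 0 < Δ) (c : Q → Q → ℝ)
    (hc : ∀ x y, 0 ≤ c x y) :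
    ∃ H' : SimpleGraph Q, (∀ x, (Finset.univ.filter fun y => H'.Reachable x y).card
        ≤ 6 * (δ + 1) ^ (24 * Δ)) ∧
      ∑ e : Q × Q, (if H.Adj e.1 e.2 ∧ ¬ H'.Reachable e.1 e.2 then c e.1 e.2 else 0)
        ≤ 3 / Δ * ∑ e : Q × Q, if H.Adj e.1 e.2 then c e.1 e.2 else 0 := by
  obtain ⟨r₀, h₀⟩ := exists_cheap_shift H hΔ c hc
  set H₁ := chop H Δ r₀ with e₁
  obtain ⟨r₁, h₁⟩ := exists_cheap_shift H₁ hΔ c hc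
  set H₂ := chop H₁ Δ r₁ with e₂
  obtain ⟨r₂, h₂⟩ := exists_cheap_shift H₂ hΔ c hc
  set H₃ := chop H₂ Δ r₂ with e₃
  have mono : ∀ K : SimpleGraph Q, K ≤ H → (∑ e : Q × Q, if K.Adj e.1 e.2 then c e.1 e.2 else 0)
      ≤ ∑ e : Q × Q, if H.Adj e.1 e.2 then c e.1 e.2 else 0 := fun K hK =>
    Finset.sum_le_sum fun e _ => by
      by_cases h : K.Adj e.1 e.2
      · rw [if_pos h, if_pos (hK h)]
      · rw [if_neg h]
        split_ifs
        · exact hc _ _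
        · exact le_rfl
  have m₁ := mono H₁ (chop_le _ _ _)
  have m₂ := mono H₂ ((chop_le _ _ _).trans (chop_le _ _ _))
  refine ⟨H₃, fun x => ?_, ?_⟩
  · set C := Finset.univ.filter fun y => H₃.Reachable x y with hC
    -- A largest set of pairwise far vertices in a component has at most six elements, since seven
    -- would give a minor `K_{3,7}`. By maximality the balls of radius 24 Δ around it cover the
    -- component.
    let fam : Finset (Finset Q) := C.powerset.filter fun S =>
      ∀ y ∈ S, ∀ z ∈ S, y ≠ z → ¬ Within H (24 * Δ) y z
    obtain ⟨S, hS, hmax⟩ := Finset.exists_max_image fam Finset.card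
      ⟨∅, by simp [fam]⟩
    obtain ⟨hSC, hSfar⟩ := Finset.mem_filter.1 hS
    rw [Finset.mem_powerset] at hSC
    have hcard : S.card ≤ 6 := by
      by_contra hn
      have hle : Fintype.card (Fin 7) ≤ Fintype.card S := by
        rw [Fintype.card_fin, Fintype.card_coe]; omega
      obtain ⟨f⟩ := Function.Embedding.nonempty_of_card_le hle
      refine hH (exists_bipartiteMinor_of_far hΔ e₁ e₂ e₃ (fun t => (f t : Q)) (fun t t' => ?_)
        fun t t' htt => hSfar _ (f t).2 _ (f t').2 fun h => htt (f.injective (Subtype.ext h)))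
      exact (Finset.mem_filter.1 (hSC (f t).2)).2.symm.trans
        (Finset.mem_filter.1 (hSC (f t').2)).2
    have hcover : C ⊆ S.biUnion fun s => Finset.univ.filter fun y => Within H (24 * Δ) s y := by
      intro y hy
      rw [Finset.mem_biUnion]
      by_contra hn
      push Not at hn
      have hfar : ∀ s ∈ S, ¬ Within H (24 * Δ) s y := fun s hs h =>
        hn s hs (Finset.mem_filter.2 ⟨Finset.mem_univ _, h⟩)
      have hyS : y ∉ S := fun h => hfar y h (Within.refl _ _)
      have := hmax (insert y S) (Finset.mem_filter.2 ⟨Finset.mem_powerset.2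
        (Finset.insert_subset hy hSC), fun a ha b hb hab h => ?_⟩)
      · rw [Finset.card_insert_of_notMem hyS] at this
        omega
      · rcases Finset.mem_insert.1 ha with ha | ha <;> rcases Finset.mem_insert.1 hb with hb | hb
        · exact hab (ha.trans hb.symm)
        · exact hfar b hb (ha ▸ h.symm)
        · exact hfar a ha (hb ▸ h)
        · exact hSfar a ha b hb hab h
    calc C.card ≤ _ := Finset.card_le_card hcover
      _ ≤ S.card * (δ + 1) ^ (24 * Δ) :=
        Finset.card_biUnion_le_card_mul _ _ _ fun s _ => card_within_le hδ _ s
      _ ≤ _ := Nat.mul_le_mul_right _ hcard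
  · have hsplit : ∑ e : Q × Q, (if H.Adj e.1 e.2 ∧ ¬ H₃.Reachable e.1 e.2 then c e.1 e.2 else 0)
        ≤ ∑ e : Q × Q, (if H.Adj e.1 e.2 ∧ ¬ H₁.Adj e.1 e.2 then c e.1 e.2 else 0)
        + ∑ e : Q × Q, (if H₁.Adj e.1 e.2 ∧ ¬ H₂.Adj e.1 e.2 then c e.1 e.2 else 0)
        + ∑ e : Q × Q, (if H₂.Adj e.1 e.2 ∧ ¬ H₃.Adj e.1 e.2 then c e.1 e.2 else 0) := by
      rw [← Finset.sum_add_distrib, ← Finset.sum_add_distrib]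
      refine Finset.sum_le_sum fun e _ => ?_
      have h0 := hc e.1 e.2
      have hite : ∀ (p : Prop) [Decidable p], 0 ≤ if p then c e.1 e.2 else 0 := fun p _ => by
        split_ifs
        · exact h0
        · exact le_rfl
      by_cases hcut : H.Adj e.1 e.2 ∧ ¬ H₃.Reachable e.1 e.2
      · have h3 : ¬ H₃.Adj e.1 e.2 := fun h => hcut.2 h.reachable
        rw [if_pos hcut]
        by_cases a1 : H₁.Adj e.1 e.2
        · by_cases a2 : H₂.Adj e.1 e.2
          · rw [if_pos (⟨a2, h3⟩ : H₂.Adj e.1 e.2 ∧ ¬ H₃.Adj e.1 e.2)]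
            linarith [hite (H.Adj e.1 e.2 ∧ ¬ H₁.Adj e.1 e.2),
              hite (H₁.Adj e.1 e.2 ∧ ¬ H₂.Adj e.1 e.2)]
          · rw [if_pos (⟨a1, a2⟩ : H₁.Adj e.1 e.2 ∧ ¬ H₂.Adj e.1 e.2)]
            linarith [hite (H.Adj e.1 e.2 ∧ ¬ H₁.Adj e.1 e.2),
              hite (H₂.Adj e.1 e.2 ∧ ¬ H₃.Adj e.1 e.2)]
        · rw [if_pos (⟨hcut.1, a1⟩ : H.Adj e.1 e.2 ∧ ¬ H₁.Adj e.1 e.2)]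
          linarith [hite (H₁.Adj e.1 e.2 ∧ ¬ H₂.Adj e.1 e.2),
            hite (H₂.Adj e.1 e.2 ∧ ¬ H₃.Adj e.1 e.2)]
      · rw [if_neg hcut]
        exact add_nonneg (add_nonneg (hite _) (hite _)) (hite _)
    have hpos : (0 : ℝ) < 1 / Δ := by positivity
    have n₁ := mul_le_mul_of_nonneg_left m₁ hpos.le
    have n₂ := mul_le_mul_of_nonneg_left m₂ hpos.le
    rw [show (3 : ℝ) / Δ = 1 / Δ + 1 / Δ + 1 / Δ by ring, add_mul, add_mul]
    linarith

end Partition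

end SteinerNetwork

namespace SteinerNetwork

/-! ### Shortest path forests and their decomposition into blobs -/

/-- A rooted forest on a finite set, with non-negative edge lengths and at most two children at
every node; `dist` is the distance to the root. -/
structure LengthForest (D : Type*) [Fintype D] where
  next : D → D
  root : D → Prop
  rank : D → ℕ
  len : D → ℝ
  dist : D → ℝ
  rank_lt : ∀ d, ¬ root d → rank (next d) < rank d
  len_nonneg : ∀ d, 0 ≤ len d
  dist_root : ∀ d, root d → dist d = 0
  dist_next : ∀ d, ¬ root d → dist d = len d + dist (next d)
  children : ∀ d c₁ c₂ c₃, ¬ root c₁ → ¬ root c₂ → ¬ root c₃ → next c₁ = d → next c₂ = d →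
    next c₃ = d → c₁ = c₂ ∨ c₁ = c₃ ∨ c₂ = c₃

namespace LengthForest

open Classical

variable {D : Type*} [Fintype D] (T : LengthForest D)

theorem dist_nonneg (d : D) : 0 ≤ T.dist d := by
  induction hn : T.rank d using Nat.strong_induction_on generalizing d with
  | _ n ih =>
    by_cases h : T.root d
    · rw [T.dist_root d h]
    · rw [T.dist_next d h]
      exact add_nonneg (T.len_nonneg d) (ih _ (hn ▸ T.rank_lt d h) _ rfl)

theorem wellFounded_children : WellFounded fun c d : D => ¬ T.root c ∧ T.next c = d := by
  have : Std.Irrefl (fun c d : D => T.rank d < T.rank c) := ⟨fun _ h => lt_irrefl _ h⟩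
  have : IsTrans D (fun c d : D => T.rank d < T.rank c) := ⟨fun _ _ _ h h' => h'.trans h⟩
  refine Subrelation.wf (r := fun c d : D => T.rank d < T.rank c) ?_
    (Finite.wellFounded_of_trans_of_irrefl _)
  rintro c _ ⟨h, rfl⟩
  exact T.rank_lt c h

/-- The total length of the part of the subtree below a node that has not been cut off. -/
noncomputable def load : D → ℝ :=
  T.wellFounded_children.fix fun d rec => ∑ c : D,
    if h : ¬ T.root c ∧ T.next c = d then
      (if T.dist c ≤ 4 * (rec c h + T.len c) then 0 else rec c h + T.len c) else 0

/-- A node is cut from its parent if the load hanging below its parent edge is large. -/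
def cut (d : D) : Prop := T.root d ∨ T.dist d ≤ 4 * (T.load d + T.len d)

/-- The children of a node that are not cut off. -/
noncomputable def kids (d : D) : Finset D := Finset.univ.filter fun c => ¬ T.cut c ∧ T.next c = d

variable {T} in
theorem mem_kids {c d : D} : c ∈ T.kids d ↔ ¬ T.cut c ∧ T.next c = d := by simp [kids]

theorem not_root {d : D} (h : ¬ T.cut d) : ¬ T.root d := fun hr => h (Or.inl hr)

theorem load_eq (d : D) : T.load d = ∑ c ∈ T.kids d, (T.load c + T.len c) := by
  unfold load
  rw [WellFounded.fix_eq]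
  rw [kids, Finset.sum_filter]
  refine Finset.sum_congr rfl fun c _ => ?_
  by_cases h : ¬ T.root c ∧ T.next c = d
  · rw [dif_pos h]
    by_cases h2 : T.cut c
    · have h3 := h2.resolve_left h.1
      rw [load] at h3
      rw [if_pos h3, if_neg (fun h' => h'.1 h2)]
    · have h3 : ¬ (T.dist c ≤ 4 * (T.load c + T.len c)) := fun h' => h2 (Or.inr h')
      rw [load] at h3
      rw [if_neg h3, if_pos ⟨h2, h.2⟩]
  · rw [dif_neg h, if_neg (fun h' => h ⟨T.not_root h'.1, h'.2⟩)]

theorem card_kids_le (d : D) : (T.kids d).card ≤ 2 := by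
  by_contra hn
  obtain ⟨c₁, c₂, c₃, h₁, h₂, h₃, h12, h13, h23⟩ := Finset.two_lt_card_iff.1 (not_le.1 hn)
  rw [mem_kids] at h₁ h₂ h₃
  rcases T.children d c₁ c₂ c₃ (T.not_root h₁.1) (T.not_root h₂.1) (T.not_root h₃.1) h₁.2 h₂.2 h₃.2
    with h | h | h
  · exact h12 h
  · exact h13 h
  · exact h23 h

theorem load_nonneg (d : D) : 0 ≤ T.load d := by
  induction d using T.wellFounded_children.induction with
  | _ d ih =>
    rw [load_eq]
    refine Finset.sum_nonneg fun c hc => ?_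
    rw [mem_kids] at hc
    exact add_nonneg (ih c ⟨T.not_root hc.1, hc.2⟩) (T.len_nonneg c)

/-- An uncut child `c` of `d` satisfies `4 * (load c + len c) < dist c = len c + dist d`, so it
contributes at most a third of `dist d`. There are at most two such children. -/
theorem load_le (d : D) : T.load d ≤ 2 / 3 * T.dist d := by
  have h0 := T.dist_nonneg d
  have key : ∀ c ∈ T.kids d, T.load c + T.len c ≤ 1 / 3 * T.dist d := by
    intro c hc
    rw [mem_kids] at hc
    have h1 : ¬ T.dist c ≤ 4 * (T.load c + T.len c) := fun h => hc.1 (Or.inr h)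
    have h2 := T.dist_next c (T.not_root hc.1)
    rw [hc.2] at h2
    have h3 := T.load_nonneg c
    linarith
  rw [load_eq]
  refine (Finset.sum_le_card_nsmul _ _ _ key).trans ?_
  rw [nsmul_eq_mul]
  have : ((T.kids d).card : ℝ) ≤ 2 := by exact_mod_cast T.card_kids_le d
  nlinarith

theorem sum_kids (f : D → ℝ) :
    ∑ d, ∑ c ∈ T.kids d, f c = ∑ c ∈ Finset.univ.filter (fun c => ¬ T.cut c), f c := by
  rw [← Finset.sum_fiberwise _ T.next f]
  refine Finset.sum_congr rfl fun d _ => ?_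
  refine Finset.sum_congr ?_ fun _ _ => rfl
  ext c
  simp [mem_kids]

/-- Every length is charged once. Summing the recursion for `load` over all nodes, the loads of
uncut nodes cancel, and the loads of cut nodes add up to the length of all uncut edges. -/
theorem sum_cut_dist_le :
    ∑ d ∈ Finset.univ.filter T.cut, T.dist d ≤ 4 * ∑ d, T.len d := by
  have h1 : ∑ d, T.load d
      = ∑ c ∈ Finset.univ.filter (fun c => ¬ T.cut c), (T.load c + T.len c) := by
    rw [← sum_kids]
    exact Finset.sum_congr rfl fun d _ => T.load_eq d
  rw [← Finset.sum_filter_add_sum_filter_not Finset.univ T.cut, Finset.sum_add_distrib] at h1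
  have h2 : ∑ d ∈ Finset.univ.filter T.cut, T.dist d
      ≤ ∑ d ∈ Finset.univ.filter T.cut, 4 * (T.load d + T.len d) := by
    refine Finset.sum_le_sum fun d hd => ?_
    rcases (Finset.mem_filter.1 hd).2 with h | h
    · rw [T.dist_root d h]
      have := T.load_nonneg d
      have := T.len_nonneg d
      linarith
    · exact h
  rw [← Finset.mul_sum, Finset.sum_add_distrib] at h2
  have h3 := Finset.sum_filter_add_sum_filter_not Finset.univ T.cut T.len
  linarith

/-- The first cut node on the path from a node to its root. -/
noncomputable def blob (d : D) : D := if h : T.cut d then d else blob (T.next d)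
termination_by T.rank d
decreasing_by exact T.rank_lt d (T.not_root h)

variable {T}

theorem blob_of_cut {d : D} (h : T.cut d) : T.blob d = d := by
  rw [blob, dif_pos h]

theorem blob_next {d : D} (h : ¬ T.cut d) : T.blob (T.next d) = T.blob d := by
  conv_rhs => rw [blob, dif_neg h]

/-- Induction along the path from a node to the first cut node. -/
theorem induction_to_cut {P : D → Prop} (h₁ : ∀ d, T.cut d → P d)
    (h₂ : ∀ d, ¬ T.cut d → P (T.next d) → P d) (d : D) : P d := by
  induction hn : T.rank d using Nat.strong_induction_on generalizing d with
  | _ n ih =>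
    by_cases h : T.cut d
    · exact h₁ d h
    · exact h₂ d h (ih _ (hn ▸ T.rank_lt d (T.not_root h)) _ rfl)

variable (T)

theorem cut_blob (d : D) : T.cut (T.blob d) := by
  induction d using T.induction_to_cut with
  | h₁ d h => rwa [blob_of_cut h]
  | h₂ d h ih => rwa [blob_next h] at ih

/-- Going up one edge inside a blob lowers the distance by the length of the edge and raises the
load by at least that much. With `load_le` at the top this makes distances in a blob comparable. -/
theorem load_add_dist_le (d : D) :
    T.load d + T.dist d ≤ T.load (T.blob d) + T.dist (T.blob d) := by
  induction d using T.induction_to_cut with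
  | h₁ d h => rw [blob_of_cut h]
  | h₂ d h ih =>
    rw [blob_next h] at ih
    refine le_trans ?_ ih
    rw [T.dist_next d (T.not_root h), T.load_eq (T.next d)]
    have := Finset.single_le_sum (f := fun c => T.load c + T.len c)
      (fun c _ => add_nonneg (T.load_nonneg c) (T.len_nonneg c)) (mem_kids.2 ⟨h, rfl⟩)
    linarith

theorem dist_le_blob (d : D) : T.dist d ≤ 5 / 3 * T.dist (T.blob d) := by
  have h1 := T.load_add_dist_le d
  have h2 := T.load_le (T.blob d)
  have h3 := T.load_nonneg d
  linarith

theorem dist_blob_le (d : D) : T.dist (T.blob d) ≤ T.dist d := by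
  induction d using T.induction_to_cut with
  | h₁ d h => rw [blob_of_cut h]
  | h₂ d h ih =>
    rw [blob_next h] at ih
    refine ih.trans ?_
    rw [T.dist_next d (T.not_root h)]
    linarith [T.len_nonneg d]

/-- Telescoping of the recursion again, restricted to the nodes of one blob. -/
theorem load_blob (b : D) (hb : T.cut b) :
    T.load b = ∑ c ∈ Finset.univ.filter (fun c => ¬ T.cut c ∧ T.blob c = b), T.len c := by
  have h1 : ∑ d, (if T.blob d = b then T.load d else 0)
      = ∑ c ∈ Finset.univ.filter (fun c => ¬ T.cut c),
        if T.blob c = b then T.load c + T.len c else 0 := by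
    rw [← sum_kids]
    refine Finset.sum_congr rfl fun d _ => ?_
    split_ifs with h
    · rw [load_eq]
      refine Finset.sum_congr rfl fun c hc => ?_
      rw [mem_kids] at hc
      rw [if_pos]
      rw [← blob_next hc.1, hc.2, h]
    · symm
      refine Finset.sum_eq_zero fun c hc => ?_
      rw [mem_kids] at hc
      rw [if_neg]
      rwa [← blob_next hc.1, hc.2]
  rw [← Finset.sum_filter_add_sum_filter_not Finset.univ T.cut] at h1
  have h2 : ∑ d ∈ Finset.univ.filter T.cut, (if T.blob d = b then T.load d else 0) = T.load b := by
    rw [Finset.sum_eq_single b]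
    · rw [if_pos (blob_of_cut hb)]
    · intro d hd hdb
      rw [if_neg]
      rwa [blob_of_cut (Finset.mem_filter.1 hd).2]
    · exact fun h => absurd (Finset.mem_filter.2 ⟨Finset.mem_univ _, hb⟩) h
  have h3 : ∑ c ∈ Finset.univ.filter (fun c => ¬ T.cut c),
        (if T.blob c = b then T.load c + T.len c else 0)
      = ∑ c ∈ Finset.univ.filter (fun c => ¬ T.cut c), (if T.blob c = b then T.load c else 0)
        + ∑ c ∈ Finset.univ.filter (fun c => ¬ T.cut c), if T.blob c = b then T.len c else 0 := by
    rw [← Finset.sum_add_distrib]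
    exact Finset.sum_congr rfl fun c _ => by split_ifs <;> simp
  rw [h2, h3] at h1
  rw [← Finset.filter_filter, Finset.sum_filter (p := fun c => T.blob c = b)]
  linarith

/-- `x` lies on the path from `d` to its root. -/
def Above (d x : D) : Prop := Relation.ReflTransGen (fun p q => ¬ T.root p ∧ q = T.next p) d x

theorem sum_above_len (d : D) :
    ∑ x ∈ Finset.univ.filter (fun x => ¬ T.root x ∧ T.Above d x), T.len x = T.dist d := by
  induction hn : T.rank d using Nat.strong_induction_on generalizing d with
  | _ n ih =>
    by_cases h : T.root d
    · rw [T.dist_root d h]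
      refine Finset.sum_eq_zero fun x hx => ?_
      obtain ⟨-, hx, hdx⟩ := Finset.mem_filter.1 hx
      rcases Relation.ReflTransGen.cases_head hdx with rfl | ⟨y, hy, -⟩
      · exact absurd h hx
      · exact absurd h hy.1
    · have hrank : ∀ x, T.Above (T.next d) x → T.rank x < T.rank d := by
        intro x hx
        induction hx with
        | refl => exact T.rank_lt d h
        | tail _ h' ih =>
          obtain ⟨h1, rfl⟩ := h'
          exact (T.rank_lt _ h1).trans ih
      have e : Finset.univ.filter (fun x => ¬ T.root x ∧ T.Above d x)
          = insert d (Finset.univ.filter (fun x => ¬ T.root x ∧ T.Above (T.next d) x)) := by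
        ext x
        simp only [Finset.mem_filter, Finset.mem_univ, true_and, Finset.mem_insert]
        constructor
        · rintro ⟨h1, h2⟩
          rcases Relation.ReflTransGen.cases_head h2 with rfl | ⟨y, ⟨-, rfl⟩, hy⟩
          · exact Or.inl rfl
          · exact Or.inr ⟨h1, hy⟩
        · rintro (rfl | ⟨h1, h2⟩)
          · exact ⟨h, Relation.ReflTransGen.refl⟩
          · exact ⟨h1, Relation.ReflTransGen.head ⟨h, rfl⟩ h2⟩
      rw [e, Finset.sum_insert, ih _ (hn ▸ T.rank_lt d h) _ rfl, T.dist_next d h]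
      intro hmem
      exact lt_irrefl _ (hrank d (Finset.mem_filter.1 hmem).2.2)

/-- The non-root nodes on the paths from the nodes of a blob to their root. -/
noncomputable def hull (b : D) : Finset D :=
  Finset.univ.filter fun x => ¬ T.root x ∧ ∃ d, T.blob d = b ∧ T.Above d x

theorem not_root_of_mem_hull {b x : D} (h : x ∈ T.hull b) : ¬ T.root x :=
  (Finset.mem_filter.1 h).2.1

/-- The hull consists of the edges inside the blob, of total length `load b ≤ 2 / 3 * dist b`, and
of the path from `b` to its root, of length `dist b`. -/
theorem sum_hull_len_le (b : D) (hb : T.cut b) :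
    ∑ x ∈ T.hull b, T.len x ≤ 2 * T.dist b := by
  have hsub : T.hull b ⊆ Finset.univ.filter (fun c => ¬ T.cut c ∧ T.blob c = b)
      ∪ Finset.univ.filter (fun x => ¬ T.root x ∧ T.Above b x) := by
    intro x hx
    obtain ⟨-, hx, d, hd, hdx⟩ := Finset.mem_filter.1 hx
    simp only [Finset.mem_union, Finset.mem_filter, Finset.mem_univ, true_and]
    have : (¬ T.cut x ∧ T.blob x = b) ∨ T.Above b x := by
      induction hdx using Relation.ReflTransGen.head_induction_on with
      | refl =>
        by_cases hc : T.cut x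
        · rw [blob_of_cut hc] at hd
          rw [hd]
          exact Or.inr Relation.ReflTransGen.refl
        · exact Or.inl ⟨hc, hd⟩
      | @head p q h h' ih =>
        by_cases hc : T.cut p
        · rw [blob_of_cut hc] at hd
          rw [← hd]
          exact Or.inr (Relation.ReflTransGen.head h h')
        · refine ih ?_
          rw [h.2, blob_next hc, hd]
    exact this.imp id fun h => ⟨hx, h⟩
  calc ∑ x ∈ T.hull b, T.len x ≤ _ :=
        Finset.sum_le_sum_of_subset_of_nonneg hsub fun x _ _ => T.len_nonneg x
    _ ≤ ∑ c ∈ Finset.univ.filter (fun c => ¬ T.cut c ∧ T.blob c = b), T.len c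
        + ∑ x ∈ Finset.univ.filter (fun x => ¬ T.root x ∧ T.Above b x), T.len x := by
        rw [← Finset.sum_union_inter]
        exact le_add_of_nonneg_right (Finset.sum_nonneg fun x _ => T.len_nonneg x)
    _ = T.load b + T.dist b := by rw [T.sum_above_len, ← T.load_blob b hb]
    _ ≤ 2 * T.dist b := by
        have := T.load_le b
        have := T.dist_nonneg b
        linarith

/-- The root of the tree of a node. -/
noncomputable def rootOf (d : D) : D := if h : T.root d then d else rootOf (T.next d)
termination_by T.rank d
decreasing_by exact T.rank_lt d h

variable {T}

theorem rootOf_of_root {d : D} (h : T.root d) : T.rootOf d = d := by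
  rw [rootOf, dif_pos h]

theorem rootOf_next {d : D} (h : ¬ T.root d) : T.rootOf (T.next d) = T.rootOf d := by
  conv_rhs => rw [rootOf, dif_neg h]

variable (T)

theorem root_rootOf (d : D) : T.root (T.rootOf d) := by
  induction hn : T.rank d using Nat.strong_induction_on generalizing d with
  | _ n ih =>
    by_cases h : T.root d
    · rwa [rootOf_of_root h]
    · rw [← rootOf_next h]
      exact ih _ (hn ▸ T.rank_lt d h) _ rfl

theorem rootOf_blob (d : D) : T.rootOf (T.blob d) = T.rootOf d := by
  induction d using T.induction_to_cut with
  | h₁ d h => rw [blob_of_cut h]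
  | h₂ d h ih => rw [← blob_next h, ih, rootOf_next (T.not_root h)]

theorem above_rootOf (d : D) : T.Above d (T.rootOf d) := by
  induction hn : T.rank d using Nat.strong_induction_on generalizing d with
  | _ n ih =>
    by_cases h : T.root d
    · rw [rootOf_of_root h]
      exact Relation.ReflTransGen.refl
    · rw [← rootOf_next h]
      exact Relation.ReflTransGen.head ⟨h, rfl⟩ (ih _ (hn ▸ T.rank_lt d h) _ rfl)

/-- Every node of a blob is joined with the root by edges of the hull. -/
theorem hull_path (d : D) :
    Relation.ReflTransGen (fun p q => p ∈ T.hull (T.blob d) ∧ q = T.next p) d (T.rootOf d) := by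
  have : ∀ x, T.Above d x →
      Relation.ReflTransGen (fun p q => p ∈ T.hull (T.blob d) ∧ q = T.next p) d x := by
    intro x hx
    induction hx with
    | refl => exact Relation.ReflTransGen.refl
    | @tail y z h h' ih =>
      exact ih.tail ⟨Finset.mem_filter.2 ⟨Finset.mem_univ _, h'.1, d, rfl, h⟩, h'.2⟩
  exact this _ (T.above_rootOf d)

end LengthForest

end SteinerNetwork

/-! ### Adjacent blobs and the sparsity of planar graphs -/

namespace SteinerNetwork

open Classical in
/-- If every set of vertices spans at most three times as many edges as it has vertices, then the
sum over the edges of the smaller weight of an endpoint is at most three times the total weight. -/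
theorem sum_min_le {D Z : Type*} [Fintype D] [Fintype Z] (i j : Z → D)
    (h : ∀ S : Finset D, (Finset.univ.filter fun z => i z ∈ S ∧ j z ∈ S).card ≤ 3 * S.card)
    (S : Finset D) (f : D → ℝ) (hf : ∀ d ∈ S, 0 ≤ f d) :
    ∑ z ∈ Finset.univ.filter (fun z => i z ∈ S ∧ j z ∈ S), min (f (i z)) (f (j z))
      ≤ 3 * ∑ d ∈ S, f d := by
  induction hn : S.card generalizing S f with
  | zero =>
    rw [Finset.card_eq_zero] at hn
    subst hn
    simp
  | succ n ih =>
    obtain ⟨b, hb, hmin⟩ := Finset.exists_min_image S f (Finset.card_pos.1 (by omega))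
    -- Layer by layer: the smallest value `f b` is subtracted everywhere. The removed layer costs at
    -- most `3 * S.card * f b` by the edge bound, and edges at `b` contribute nothing positive to
    -- the rest.
    have h1 := ih (S.erase b) (fun d => f d - f b)
      (fun d hd => sub_nonneg.2 (hmin d (Finset.mem_of_mem_erase hd)))
      (by rw [Finset.card_erase_of_mem hb]; omega)
    have h2 : ∑ z ∈ Finset.univ.filter (fun z => i z ∈ S ∧ j z ∈ S), min (f (i z)) (f (j z))
        = (Finset.univ.filter fun z => i z ∈ S ∧ j z ∈ S).card * f b
          + ∑ z ∈ Finset.univ.filter (fun z => i z ∈ S ∧ j z ∈ S),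
            min (f (i z) - f b) (f (j z) - f b) := by
      rw [← nsmul_eq_mul, ← Finset.sum_const, ← Finset.sum_add_distrib]
      exact Finset.sum_congr rfl fun z _ => by rw [min_sub_sub_right]; ring
    have h3 : ∑ z ∈ Finset.univ.filter (fun z => i z ∈ S ∧ j z ∈ S),
          min (f (i z) - f b) (f (j z) - f b)
        ≤ ∑ z ∈ Finset.univ.filter (fun z => i z ∈ S.erase b ∧ j z ∈ S.erase b),
          min (f (i z) - f b) (f (j z) - f b) := by
      have hsub : Finset.univ.filter (fun z => i z ∈ S.erase b ∧ j z ∈ S.erase b)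
          ⊆ Finset.univ.filter (fun z => i z ∈ S ∧ j z ∈ S) := fun z hz => by
        simp only [Finset.mem_filter, Finset.mem_univ, true_and, Finset.mem_erase] at hz ⊢
        exact ⟨hz.1.2, hz.2.2⟩
      rw [← Finset.sum_sdiff hsub]
      refine add_le_of_nonpos_left (Finset.sum_nonpos fun z hz => ?_)
      simp only [Finset.mem_sdiff, Finset.mem_filter, Finset.mem_univ, true_and,
        Finset.mem_erase] at hz
      by_cases hi : i z = b
      · exact (min_le_left _ _).trans (by rw [hi, sub_self])
      · have hj : j z = b := by
          by_contra hj
          exact hz.2 ⟨⟨hi, hz.1.1⟩, hj, hz.1.2⟩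
        exact (min_le_right _ _).trans (by rw [hj, sub_self])
    have h4 : ((Finset.univ.filter fun z => i z ∈ S ∧ j z ∈ S).card : ℝ) ≤ 3 * S.card := by
      exact_mod_cast h S
    have h5 : ∑ d ∈ S.erase b, (f d - f b) = ∑ d ∈ S, f d - S.card * f b := by
      have : ∑ d ∈ S, (f d - f b) = ∑ d ∈ S, f d - S.card * f b := by
        rw [Finset.sum_sub_distrib, Finset.sum_const, nsmul_eq_mul]
      rw [← this, ← Finset.add_sum_erase S _ hb, sub_self, zero_add]
    rw [h5] at h1
    have h6 := mul_le_mul_of_nonneg_right h4 (hf b hb)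
    rw [h2]
    linarith

/-- A graph of maximum degree four on the nodes of a forest of shortest paths. -/
structure ForestGraph (D Y : Type*) [Fintype D] [Fintype Y] extends LengthForest D where
  fst : Y → D
  snd : Y → D
  valid : Y → Prop
  wt : Y → ℝ
  wt_nonneg : ∀ y, 0 ≤ wt y
  dist_fst_le : ∀ y, valid y → dist (fst y) ≤ dist (snd y) + wt y
  dist_snd_le : ∀ y, valid y → dist (snd y) ≤ dist (fst y) + wt y
  fst_fibre : ∀ y₁ y₂ y₃, fst y₁ = fst y₂ → fst y₁ = fst y₃ → y₁ = y₂ ∨ y₁ = y₃ ∨ y₂ = y₃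
  snd_fibre : ∀ y₁ y₂ y₃, snd y₁ = snd y₂ → snd y₁ = snd y₃ → y₁ = y₂ ∨ y₁ = y₃ ∨ y₂ = y₃
  parent_edge : ∀ d, ¬ root d →
    ∃ y, valid y ∧ ((fst y = d ∧ snd y = next d) ∨ (fst y = next d ∧ snd y = d))

namespace ForestGraph

open Classical

variable {D Y : Type*} [Fintype D] [Fintype Y] (T : ForestGraph D Y)

/-- The pairs of adjacent blobs. -/
noncomputable def pairs : Finset (Sym2 D) :=
  (Finset.univ.filter fun y => T.valid y ∧ T.blob (T.fst y) ≠ T.blob (T.snd y)).image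
    fun y => s(T.blob (T.fst y), T.blob (T.snd y))

variable {T} in
theorem mem_pairs {z : Sym2 D} : z ∈ T.pairs ↔ ∃ y, (T.valid y ∧
    T.blob (T.fst y) ≠ T.blob (T.snd y)) ∧ s(T.blob (T.fst y), T.blob (T.snd y)) = z := by
  simp [pairs]

/-- A representative edge between two adjacent blobs. -/
noncomputable def rep (z : T.pairs) : Y := (mem_pairs.1 z.2).choose

theorem rep_valid (z : T.pairs) : T.valid (T.rep z) := (mem_pairs.1 z.2).choose_spec.1.1

theorem rep_ne (z : T.pairs) : T.blob (T.fst (T.rep z)) ≠ T.blob (T.snd (T.rep z)) :=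
  (mem_pairs.1 z.2).choose_spec.1.2

theorem rep_eq (z : T.pairs) : s(T.blob (T.fst (T.rep z)), T.blob (T.snd (T.rep z))) = z.1 :=
  (mem_pairs.1 z.2).choose_spec.2

theorem rep_injective : Function.Injective T.rep := fun z z' h => Subtype.ext (by
  rw [← T.rep_eq z, ← T.rep_eq z', h])

theorem eqvGen_next {I : Type*} {μ : D → Option I} {i : I} {d : D} (hd : ¬ T.root d)
    (h₁ : μ d = some i) (h₂ : μ (T.next d) = some i) :
    Relation.EqvGen (fun p q => μ p = some i ∧ μ q = some i ∧ ∃ y, T.fst y = p ∧ T.snd y = q)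
      d (T.next d) := by
  obtain ⟨y, -, ⟨h3, h4⟩ | ⟨h3, h4⟩⟩ := T.parent_edge d hd
  · exact Relation.EqvGen.rel _ _ ⟨h₁, h₂, y, h3, h4⟩
  · exact (Relation.EqvGen.rel _ _ ⟨h₂, h₁, y, h3, h4⟩).symm

/-- Blobs are connected through parent edges, so contracting those in `S` gives a minor in which the
representative edges join distinct vertices, at most one for each pair. -/
theorem card_pairs_le {F : Type*} [Finite F] {l r : Y → F}
    (hdual : IsAlgebraicDual T.fst T.snd l r) (S : Finset D) :
    (Finset.univ.filter fun z : T.pairs =>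
      T.blob (T.fst (T.rep z)) ∈ S ∧ T.blob (T.snd (T.rep z)) ∈ S).card ≤ 3 * S.card := by
  let Z := {z : T.pairs // T.blob (T.fst (T.rep z)) ∈ S ∧ T.blob (T.snd (T.rep z)) ∈ S}
  let μ : D → Option S := fun d => if h : T.blob d ∈ S then some ⟨T.blob d, h⟩ else none
  have hμ : ∀ {d : D} {i : S}, μ d = some i ↔ T.blob d = i := by
    intro d i
    by_cases h : T.blob d ∈ S
    · simp only [μ, dif_pos h, Option.some.injEq, Subtype.ext_iff]
    · simp only [μ, dif_neg h, reduceCtorEq, false_iff]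
      exact fun h' => h (h' ▸ i.2)
  have hconn : FibreConnected T.fst T.snd μ := by
    have key : ∀ (i : S) (x : D), μ x = some i → Relation.EqvGen
        (fun p q => μ p = some i ∧ μ q = some i ∧ ∃ y, T.fst y = p ∧ T.snd y = q) x i := by
      intro i x
      induction x using T.induction_to_cut with
      | h₁ d h =>
        intro hd
        rw [hμ, LengthForest.blob_of_cut h] at hd
        rw [hd]
        exact Relation.EqvGen.refl _
      | h₂ d h ih =>
        intro hd
        have hd' : μ (T.next d) = some i := by
          rw [hμ, LengthForest.blob_next h, ← hμ, hd]
        exact (T.eqvGen_next (T.not_root h) hd hd').trans _ _ _ (ih hd')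
    exact fun i x x' hx hx' => (key i x hx).trans _ _ _ (key i x' hx').symm
  have := hdual.simple_minor_card_le (Z := Z) (fun z => T.rep z.1)
    (fun z z' h => Subtype.ext (T.rep_injective h)) μ hconn (fun z => ⟨_, z.2.1⟩)
    (fun z => ⟨_, z.2.2⟩) (fun z => hμ.2 rfl) (fun z => hμ.2 rfl)
    (fun z h => T.rep_ne z.1 (Subtype.ext_iff.1 h)) (fun z z' h => by
      have h' := congrArg (Sym2.map Subtype.val) h
      simp only [Sym2.map_mk] at h'
      rw [T.rep_eq, T.rep_eq] at h'
      exact Subtype.ext (Subtype.ext h'))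
  rw [Fintype.card_coe] at this
  rwa [← Fintype.card_subtype]

/-- The distances of adjacent blobs sum to at most a constant times the total length. -/
theorem sum_pairs_dist_le {F : Type*} [Finite F] {l r : Y → F}
    (hdual : IsAlgebraicDual T.fst T.snd l r) :
    ∑ z : T.pairs, (T.dist (T.blob (T.fst (T.rep z))) + T.dist (T.blob (T.snd (T.rep z))))
      ≤ 3 * ∑ y, T.wt y + 60 * ∑ d, T.len d := by
  -- The ends of an edge differ in distance by at most its weight, and a distance is at most 5/3 of
  -- that of its blob. So the larger blob distance is at most 5/3 of the smaller one plus the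
  -- weight; the constants 3 and 5 are generous. The final 60 is 5 · 3 · 4.
  have hz : ∀ z : T.pairs,
      T.dist (T.blob (T.fst (T.rep z))) + T.dist (T.blob (T.snd (T.rep z)))
        ≤ 3 * T.wt (T.rep z)
          + 5 * min (T.dist (T.blob (T.fst (T.rep z)))) (T.dist (T.blob (T.snd (T.rep z)))) := by
    intro z
    have h1 := T.dist_fst_le _ (T.rep_valid z)
    have h2 := T.dist_snd_le _ (T.rep_valid z)
    have h3 := T.dist_le_blob (T.fst (T.rep z))
    have h4 := T.dist_le_blob (T.snd (T.rep z))
    have h5 := T.dist_blob_le (T.fst (T.rep z))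
    have h6 := T.dist_blob_le (T.snd (T.rep z))
    have h7 := T.dist_nonneg (T.blob (T.fst (T.rep z)))
    have h8 := T.dist_nonneg (T.blob (T.snd (T.rep z)))
    rcases min_cases (T.dist (T.blob (T.fst (T.rep z)))) (T.dist (T.blob (T.snd (T.rep z))))
      with ⟨h, h'⟩ | ⟨h, h'⟩ <;> rw [h] <;> linarith
  have h1 : ∑ z : T.pairs, T.wt (T.rep z) ≤ ∑ y, T.wt y := by
    rw [← Finset.sum_image (f := T.wt) (s := Finset.univ) (g := T.rep)
      fun z _ z' _ h => T.rep_injective h]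
    exact Finset.sum_le_sum_of_subset_of_nonneg (Finset.subset_univ _) fun y _ _ => T.wt_nonneg y
  have h2 := sum_min_le (fun z : T.pairs => T.blob (T.fst (T.rep z)))
    (fun z => T.blob (T.snd (T.rep z))) (T.card_pairs_le hdual) (Finset.univ.filter T.cut) T.dist
    fun d _ => T.dist_nonneg d
  have h3 : Finset.univ.filter (fun z : T.pairs => T.blob (T.fst (T.rep z)) ∈
      Finset.univ.filter T.cut ∧ T.blob (T.snd (T.rep z)) ∈ Finset.univ.filter T.cut)
        = Finset.univ :=
    Finset.filter_true_of_mem fun z _ => ⟨Finset.mem_filter.2 ⟨Finset.mem_univ _, T.cut_blob _⟩,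
      Finset.mem_filter.2 ⟨Finset.mem_univ _, T.cut_blob _⟩⟩
  rw [h3] at h2
  have h4 := T.sum_cut_dist_le
  have h5 := Finset.sum_le_sum fun z (_ : z ∈ Finset.univ) => hz z
  simp only [Finset.sum_add_distrib, ← Finset.mul_sum] at h5 ⊢
  linarith

end ForestGraph

end SteinerNetwork

namespace SteinerNetwork

/-! ### A contraction of bounded degree -/

namespace ForestGraph

open Classical

variable {D Y : Type*} [Fintype D] [Fintype Y] (T : ForestGraph D Y)

/-- An endpoint of a representative edge between two blobs. -/
def IsPort (q : D) : Prop := ∃ z, T.fst (T.rep z) = q ∨ T.snd (T.rep z) = q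

/-- The part of the blob below a node contains a port. -/
def Live (d : D) : Prop :=
  ∃ p, T.IsPort p ∧ Relation.ReflTransGen (fun x y => ¬ T.cut x ∧ y = T.next x) p d

/-- A node with two live children in its blob. -/
def IsBranching (d : D) : Prop := ∃ c ∈ T.kids d, ∃ c' ∈ T.kids d, c ≠ c' ∧ T.Live c ∧ T.Live c'

/-- The nodes of the contracted graph. -/
def Essential (q : D) : Prop := T.IsPort q ∨ T.cut q ∨ T.IsBranching q

/-- The nodes contracted to the essential node `q`: the path from `q` upwards to the next
essential node. -/
def InFibre (q x : D) : Prop :=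
  T.Essential q ∧
    Relation.ReflTransGen (fun x y => ¬ T.cut x ∧ y = T.next x ∧ ¬ T.Essential y) q x

variable {T}

theorem Live.next {c : D} (h : T.Live c) (hc : ¬ T.cut c) : T.Live (T.next c) := by
  obtain ⟨p, hp, hpc⟩ := h
  exact ⟨p, hp, hpc.tail ⟨hc, rfl⟩⟩

theorem InFibre.self {q : D} (h : T.Essential q) : T.InFibre q q :=
  ⟨h, Relation.ReflTransGen.refl⟩

theorem InFibre.live {q x : D} (h : T.InFibre q x) (hx : ¬ T.cut x) : T.Live x := by
  obtain ⟨hq, hqx⟩ := h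
  induction hqx with
  | refl =>
    rcases hq with h | h | ⟨c, hc, -, -, -, h, -⟩
    · exact ⟨q, h, Relation.ReflTransGen.refl⟩
    · exact absurd h hx
    · rw [LengthForest.mem_kids] at hc
      rw [← hc.2]
      exact h.next hc.1
  | tail _ h ih =>
    obtain ⟨h1, rfl, -⟩ := h
    exact (ih h1).next h1

theorem InFibre.eq_of_essential {q x : D} (h : T.InFibre q x) (hx : T.Essential x) : q = x := by
  rcases Relation.ReflTransGen.cases_tail h.2 with h | ⟨c, -, h⟩
  · exact h.symm
  · exact absurd hx h.2.2

/-- If two upward paths met at a non-essential node through different children, both children would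
be live. The node would then be branching, hence essential. -/
theorem InFibre.unique {q q' x : D} (h : T.InFibre q x) (h' : T.InFibre q' x) : q = q' := by
  obtain ⟨hq, hqx⟩ := h
  induction hqx with
  | refl => exact (h'.eq_of_essential hq).symm
  | @tail c x hc hcx ih =>
    obtain ⟨h1, h2, h3⟩ := hcx
    rcases Relation.ReflTransGen.cases_tail h'.2 with h | ⟨c', hc', h1', h2', -⟩
    · exact absurd (h ▸ h'.1) h3
    · refine ih ?_
      have hcc : c = c' := by
        by_contra hne
        exact h3 (Or.inr (Or.inr ⟨c, LengthForest.mem_kids.2 ⟨h1, h2.symm⟩, c',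
          LengthForest.mem_kids.2 ⟨h1', h2'.symm⟩, hne, InFibre.live ⟨hq, hc⟩ h1,
          InFibre.live ⟨h'.1, hc'⟩ h1'⟩))
      rw [hcc]
      exact ⟨h'.1, hc'⟩

theorem InFibre.blob_eq {q x : D} (h : T.InFibre q x) : T.blob x = T.blob q := by
  obtain ⟨-, hqx⟩ := h
  induction hqx with
  | refl => rfl
  | tail _ h ih =>
    obtain ⟨h1, rfl, -⟩ := h
    rw [LengthForest.blob_next h1, ih]

theorem InFibre.rank_le {q x : D} (h : T.InFibre q x) : T.rank x ≤ T.rank q := by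
  obtain ⟨-, hqx⟩ := h
  induction hqx with
  | refl => exact le_rfl
  | tail _ h ih =>
    obtain ⟨h1, rfl, -⟩ := h
    exact (T.rank_lt _ (T.not_root h1)).le.trans ih

theorem exists_top {q : D} (hq : T.Essential q) (hc : ¬ T.cut q) :
    ∃ x, T.InFibre q x ∧ ¬ T.cut x ∧ T.Essential (T.next x) := by
  have key : ∀ x, T.InFibre q x → ¬ T.cut x →
      ∃ x, T.InFibre q x ∧ ¬ T.cut x ∧ T.Essential (T.next x) := by
    intro x
    induction x using T.induction_to_cut with
    | h₁ d h => exact fun _ h' => absurd h h'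
    | h₂ d h ih =>
      intro hd _
      by_cases he : T.Essential (T.next d)
      · exact ⟨d, hd, h, he⟩
      · exact ih ⟨hd.1, hd.2.tail ⟨h, rfl, he⟩⟩ fun h' => he (Or.inr (Or.inl h'))
  exact key q (InFibre.self hq) hc

variable (T)

/-- The last node on the path from `q` before the next essential node. -/
noncomputable def top (q : D) : D :=
  if h : T.Essential q ∧ ¬ T.cut q then (exists_top h.1 h.2).choose else q

/-- The next essential node above `q`. -/
noncomputable def parent (q : D) : D := T.next (T.top q)

variable {T}

theorem top_spec {q : D} (hq : T.Essential q) (hc : ¬ T.cut q) :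
    T.InFibre q (T.top q) ∧ ¬ T.cut (T.top q) ∧ T.Essential (T.parent q) := by
  unfold parent top
  rw [dif_pos ⟨hq, hc⟩]
  exact (exists_top hq hc).choose_spec

theorem blob_parent {q : D} (hq : T.Essential q) (hc : ¬ T.cut q) :
    T.blob (T.parent q) = T.blob q := by
  obtain ⟨h1, h2, -⟩ := top_spec hq hc
  rw [parent, LengthForest.blob_next h2, h1.blob_eq]

theorem rank_parent {q : D} (hq : T.Essential q) (hc : ¬ T.cut q) :
    T.rank (T.parent q) < T.rank q := by
  obtain ⟨h1, h2, -⟩ := top_spec hq hc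
  exact (T.rank_lt _ (T.not_root h2)).trans_le h1.rank_le

theorem essential_fst_rep (z : T.pairs) : T.Essential (T.fst (T.rep z)) := Or.inl ⟨z, Or.inl rfl⟩

theorem essential_snd_rep (z : T.pairs) : T.Essential (T.snd (T.rep z)) := Or.inl ⟨z, Or.inr rfl⟩

variable (T)

/-- The oriented edges of the contracted graph. -/
def Arc (x y : D) : Prop :=
  (T.Essential x ∧ ¬ T.cut x ∧ y = T.parent x) ∨ ∃ z, T.fst (T.rep z) = x ∧ T.snd (T.rep z) = y

/-- The graph obtained by contracting every path between consecutive essential nodes. -/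
def contracted : SimpleGraph D := SimpleGraph.fromRel T.Arc

variable {T}

theorem Arc.essential {x y : D} (h : T.Arc x y) : T.Essential x ∧ T.Essential y := by
  rcases h with ⟨h1, h2, rfl⟩ | ⟨z, rfl, rfl⟩
  · exact ⟨h1, (top_spec h1 h2).2.2⟩
  · exact ⟨essential_fst_rep z, essential_snd_rep z⟩

theorem Arc.ne {x y : D} (h : T.Arc x y) : x ≠ y := by
  rintro rfl
  rcases h with ⟨h1, h2, h3⟩ | ⟨z, h1, h2⟩
  · have := rank_parent h1 h2
    rw [← h3] at this
    exact lt_irrefl _ this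
  · exact T.rep_ne z (by rw [h1, h2])

theorem Arc.adj {x y : D} (h : T.Arc x y) : T.contracted.Adj x y := ⟨h.ne, Or.inl h⟩

theorem Arc.edge {x y : D} (h : T.Arc x y) : ∃ e,
    (T.InFibre x (T.fst e) ∧ T.InFibre y (T.snd e)) ∨
      (T.InFibre y (T.fst e) ∧ T.InFibre x (T.snd e)) := by
  have hy := h.essential.2
  rcases h with ⟨h1, h2, rfl⟩ | ⟨z, rfl, rfl⟩
  · obtain ⟨h3, h4, h5⟩ := top_spec h1 h2
    obtain ⟨e, -, ⟨h6, h7⟩ | ⟨h6, h7⟩⟩ := T.parent_edge _ (T.not_root h4)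
    · exact ⟨e, Or.inl ⟨h6 ▸ h3, h7 ▸ InFibre.self hy⟩⟩
    · exact ⟨e, Or.inr ⟨h6 ▸ InFibre.self hy, h7 ▸ h3⟩⟩
  · exact ⟨T.rep z, Or.inl ⟨InFibre.self (essential_fst_rep z), InFibre.self hy⟩⟩

theorem contracted_edge {x y : D} (h : T.contracted.Adj x y) : ∃ e,
    (T.InFibre x (T.fst e) ∧ T.InFibre y (T.snd e)) ∨
      (T.InFibre y (T.fst e) ∧ T.InFibre x (T.snd e)) := by
  rcases h.2 with h | h
  · exact h.edge
  · obtain ⟨e, he⟩ := h.edge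
    exact ⟨e, he.symm⟩

theorem contracted_essential {x y : D} (h : T.contracted.Adj x y) : T.Essential x := by
  rcases h.2 with h | h
  · exact h.essential.1
  · exact h.essential.2

/-- One edge leads to the parent and at most two come from below, since `top` maps these neighbours
injectively to the kids. Representative edges add at most two for either end, by the fibre
conditions. -/
theorem contracted_degree_le (x : D) :
    (Finset.univ.filter fun y => T.contracted.Adj x y).card ≤ 7 := by
  let A : Finset D := Finset.univ.filter fun q => (T.Essential q ∧ ¬ T.cut q) ∧ T.parent q = x
  let B : Finset D := (Finset.univ.filter fun e => T.fst e = x).image T.snd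
  let C : Finset D := (Finset.univ.filter fun e => T.snd e = x).image T.fst
  have hA : A.card ≤ 2 := by
    refine le_trans (Finset.card_le_card_of_injOn T.top (fun q hq => ?_) fun q hq q' hq' h => ?_)
      (T.card_kids_le x)
    · obtain ⟨-, ⟨h1, h2⟩, h3⟩ := Finset.mem_filter.1 hq
      exact LengthForest.mem_kids.2 ⟨(top_spec h1 h2).2.1, h3⟩
    · obtain ⟨-, ⟨h1, h2⟩, -⟩ := Finset.mem_filter.1 hq
      obtain ⟨-, ⟨h1', h2'⟩, -⟩ := Finset.mem_filter.1 hq'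
      exact (top_spec h1 h2).1.unique (h ▸ (top_spec h1' h2').1)
  have hB : B.card ≤ 2 := by
    refine Finset.card_image_le.trans ?_
    by_contra hn
    obtain ⟨y₁, y₂, y₃, h₁, h₂, h₃, h12, h13, h23⟩ := Finset.two_lt_card_iff.1 (not_le.1 hn)
    simp only [Finset.mem_filter, Finset.mem_univ, true_and] at h₁ h₂ h₃
    rcases T.fst_fibre y₁ y₂ y₃ (h₁.trans h₂.symm) (h₁.trans h₃.symm) with h | h | h
    · exact h12 h
    · exact h13 h
    · exact h23 h
  have hC : C.card ≤ 2 := by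
    refine Finset.card_image_le.trans ?_
    by_contra hn
    obtain ⟨y₁, y₂, y₃, h₁, h₂, h₃, h12, h13, h23⟩ := Finset.two_lt_card_iff.1 (not_le.1 hn)
    simp only [Finset.mem_filter, Finset.mem_univ, true_and] at h₁ h₂ h₃
    rcases T.snd_fibre y₁ y₂ y₃ (h₁.trans h₂.symm) (h₁.trans h₃.symm) with h | h | h
    · exact h12 h
    · exact h13 h
    · exact h23 h
  have hsub : (Finset.univ.filter fun y => T.contracted.Adj x y) ⊆ insert (T.parent x) (A ∪ B ∪ C) := by
    intro y hy
    simp only [Finset.mem_insert, Finset.mem_union]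
    rcases (Finset.mem_filter.1 hy).2.2 with (⟨-, -, h⟩ | ⟨z, h, h'⟩) | (⟨h1, h2, h3⟩ | ⟨z, h, h'⟩)
    · exact Or.inl h
    · exact Or.inr (Or.inl (Or.inr (Finset.mem_image.2
        ⟨T.rep z, Finset.mem_filter.2 ⟨Finset.mem_univ _, h⟩, h'⟩)))
    · exact Or.inr (Or.inl (Or.inl (Finset.mem_filter.2 ⟨Finset.mem_univ _, ⟨h1, h2⟩, h3.symm⟩)))
    · exact Or.inr (Or.inr (Finset.mem_image.2
        ⟨T.rep z, Finset.mem_filter.2 ⟨Finset.mem_univ _, h'⟩, h⟩))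
  have h1 := Finset.card_le_card hsub
  have h2 := Finset.card_insert_le (T.parent x) (A ∪ B ∪ C)
  have h3 := Finset.card_union_le (A ∪ B) C
  have h4 := Finset.card_union_le A B
  omega

variable (T)

/-- The total distance over essential nodes is controlled by the one over ports and cut nodes. -/
theorem sum_essential_dist_le :
    ∑ q ∈ Finset.univ.filter T.Essential, T.dist (T.blob q)
      ≤ 2 * ∑ z : T.pairs, (T.dist (T.blob (T.fst (T.rep z))) + T.dist (T.blob (T.snd (T.rep z))))
        + ∑ d ∈ Finset.univ.filter T.cut, T.dist d := by
  have g0 : ∀ d, 0 ≤ T.dist (T.blob d) := fun d => T.dist_nonneg _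
  set P := ∑ q ∈ Finset.univ.filter T.IsPort, T.dist (T.blob q) with hP
  set B := ∑ q ∈ Finset.univ.filter T.IsBranching, T.dist (T.blob q) with hB
  set C := ∑ d ∈ Finset.univ.filter T.cut, T.dist d with hC
  have h1 : ∑ q ∈ Finset.univ.filter T.Essential, T.dist (T.blob q) ≤ P + C + B := by
    have hC' : C = ∑ q ∈ Finset.univ.filter T.cut, T.dist (T.blob q) :=
      Finset.sum_congr rfl fun d hd => by
        rw [LengthForest.blob_of_cut (Finset.mem_filter.1 hd).2]
    rw [hC', hP, hB, Finset.sum_filter, Finset.sum_filter, Finset.sum_filter, Finset.sum_filter,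
      ← Finset.sum_add_distrib, ← Finset.sum_add_distrib]
    refine Finset.sum_le_sum fun q _ => ?_
    have := g0 q
    unfold Essential
    by_cases a : T.IsPort q <;> by_cases b : T.cut q <;> by_cases c : T.IsBranching q <;>
      simp only [a, b, c, true_or, or_true, or_self, if_true, if_false] <;> linarith
  have h2 : P ≤ ∑ z : T.pairs,
      (T.dist (T.blob (T.fst (T.rep z))) + T.dist (T.blob (T.snd (T.rep z)))) := by
    have hsub : Finset.univ.filter T.IsPort ⊆
        (Finset.univ.image fun z => T.fst (T.rep z)) ∪ Finset.univ.image fun z => T.snd (T.rep z) := by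
      intro q hq
      obtain ⟨-, z, h | h⟩ := Finset.mem_filter.1 hq
      · exact Finset.mem_union_left _ (Finset.mem_image.2 ⟨z, Finset.mem_univ _, h⟩)
      · exact Finset.mem_union_right _ (Finset.mem_image.2 ⟨z, Finset.mem_univ _, h⟩)
    rw [Finset.sum_add_distrib]
    calc P ≤ _ := Finset.sum_le_sum_of_subset_of_nonneg hsub fun q _ _ => g0 q
      _ ≤ ∑ q ∈ Finset.univ.image (fun z => T.fst (T.rep z)), T.dist (T.blob q)
          + ∑ q ∈ Finset.univ.image (fun z => T.snd (T.rep z)), T.dist (T.blob q) := by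
          rw [← Finset.sum_union_inter]
          exact le_add_of_nonneg_right (Finset.sum_nonneg fun q _ => g0 q)
      _ ≤ _ := add_le_add
          (Finset.sum_image_le_of_nonneg fun q _ => g0 q)
          (Finset.sum_image_le_of_nonneg fun q _ => g0 q)
  -- As in a binary tree, where branchings are fewer than leaves: a branching node has two live
  -- kids, and any other live node is a port or has a live kid. Summing the resulting inequality
  -- over all nodes, the live terms telescope, because the weight is constant on a blob.
  have h3 : B ≤ P := by
    let n : D → ℝ := fun d => if T.Live d then T.dist (T.blob d) else 0
    have n0 : ∀ d, 0 ≤ n d := fun d => by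
      simp only [n]
      split_ifs
      · exact g0 d
      · exact le_rfl
    have hd : ∀ d, (if T.IsBranching d then T.dist (T.blob d) else 0) + n d
        ≤ ∑ c ∈ T.kids d, n c + if T.IsPort d then T.dist (T.blob d) else 0 := by
      intro d
      have hg := g0 d
      have hkid : ∀ c ∈ T.kids d, T.Live c → n c = T.dist (T.blob d) := by
        intro c hc hl
        rw [LengthForest.mem_kids] at hc
        simp only [n]
        rw [if_pos hl, ← LengthForest.blob_next hc.1, hc.2]
      have hport : 0 ≤ if T.IsPort d then T.dist (T.blob d) else 0 := by
        split_ifs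
        · exact hg
        · exact le_rfl
      have hnd : n d ≤ T.dist (T.blob d) := by
        simp only [n]
        split_ifs
        · exact le_rfl
        · exact hg
      by_cases hbr : T.IsBranching d
      · rw [if_pos hbr]
        obtain ⟨c, hc, c', hc', hne, hl, hl'⟩ := hbr
        have h5 : ∑ x ∈ {c, c'}, n x ≤ ∑ x ∈ T.kids d, n x :=
          Finset.sum_le_sum_of_subset_of_nonneg
            (Finset.insert_subset hc (Finset.singleton_subset_iff.2 hc')) fun x _ _ => n0 x
        rw [Finset.sum_pair hne, hkid c hc hl, hkid c' hc' hl'] at h5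
        linarith
      · rw [if_neg hbr, zero_add]
        have hs : 0 ≤ ∑ c ∈ T.kids d, n c := Finset.sum_nonneg fun c _ => n0 c
        by_cases hl : T.Live d
        · obtain ⟨p, hp, hpd⟩ := hl
          rcases Relation.ReflTransGen.cases_tail hpd with h | ⟨c, hpc, hc, h⟩
          · rw [h, if_pos hp, ← h]
            linarith
          · have hck : c ∈ T.kids d := LengthForest.mem_kids.2 ⟨hc, h.symm⟩
            have h5 := Finset.single_le_sum (f := n) (fun x _ => n0 x) hck
            rw [hkid c hck ⟨p, hp, hpc⟩] at h5
            linarith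
        · have : n d = 0 := if_neg hl
          rw [this]
          linarith
    have h4 := Finset.sum_le_sum fun d (_ : d ∈ Finset.univ) => hd d
    rw [Finset.sum_add_distrib, Finset.sum_add_distrib, T.sum_kids] at h4
    rw [hB, hP, Finset.sum_filter, Finset.sum_filter]
    have h5 : ∑ c ∈ Finset.univ.filter (fun c => ¬ T.cut c), n c ≤ ∑ d, n d :=
      Finset.sum_le_sum_of_subset_of_nonneg (Finset.subset_univ _) fun d _ _ => n0 d
    linarith
  linarith

variable {T}

/-- Every edge of the contracted graph is realized by an edge between two fibres, and fibres are
connected and disjoint. The minor therefore lifts to the graph with the algebraic dual. -/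
theorem no_bipartiteMinor {F : Type*} [Finite F] {l r : Y → F}
    (hdual : IsAlgebraicDual T.fst T.snd l r) : ¬ ∃ I L, BipartiteMinor T.contracted I L := by
  rintro ⟨I, L, hIL⟩
  let S : Fin 3 ⊕ Fin 7 → Set D := Sum.elim I L
  have hdisj : ∀ i i' q, q ∈ S i → q ∈ S i' → i = i' := by
    rintro (c | t) (c' | t') q h h'
    · rw [hIL.left_disjoint c c' q h h']
    · exact absurd h' (hIL.disjoint c t' q h)
    · exact absurd h (hIL.disjoint c' t q h')
    · rw [hIL.right_disjoint t t' q h h']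
  have hjoin : ∀ i, ∀ x ∈ S i, ∀ y ∈ S i, JoinedIn T.contracted (S i) x y := by
    rintro (c | t)
    · exact hIL.left_joined c
    · exact hIL.right_joined t
  let μ : D → Option (Fin 3 ⊕ Fin 7) := fun x =>
    if h : ∃ i, ∃ q ∈ S i, T.InFibre q x then some h.choose else none
  have hμ : ∀ x i, μ x = some i ↔ ∃ q ∈ S i, T.InFibre q x := by
    intro x i
    by_cases h : ∃ i, ∃ q ∈ S i, T.InFibre q x
    · obtain ⟨q, hq, hqx⟩ := h.choose_spec
      simp only [μ, dif_pos h, Option.some.injEq]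
      constructor
      · rintro rfl
        exact ⟨q, hq, hqx⟩
      · rintro ⟨q', hq', hqx'⟩
        have := hqx.unique hqx'
        subst this
        exact hdisj _ _ _ hq hq'
    · simp only [μ, dif_neg h, reduceCtorEq, false_iff]
      exact fun h' => h ⟨i, h'⟩
  have hconn : FibreConnected T.fst T.snd μ := by
    intro i x x' hx hx'
    have hfib : ∀ q x, q ∈ S i → T.InFibre q x → Relation.EqvGen
        (fun p q => μ p = some i ∧ μ q = some i ∧ ∃ y, T.fst y = p ∧ T.snd y = q) q x := by
      rintro q x hq ⟨he, hqx⟩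
      induction hqx with
      | refl => exact Relation.EqvGen.refl _
      | @tail c d hc h ih =>
        refine ih.trans _ _ _ ?_
        obtain ⟨h1, rfl, h3⟩ := h
        exact T.eqvGen_next (T.not_root h1) ((hμ _ _).2 ⟨q, hq, he, hc⟩)
          ((hμ _ _).2 ⟨q, hq, he, hc.tail ⟨h1, rfl, h3⟩⟩)
    obtain ⟨q, hq, hqx⟩ := (hμ _ _).1 hx
    obtain ⟨q', hq', hqx'⟩ := (hμ _ _).1 hx'
    refine (hfib q x hq hqx).symm.trans _ _ _ (Relation.EqvGen.trans _ _ _ ?_ (hfib q' x' hq' hqx'))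
    have hj := hjoin i q hq q' hq'
    clear hqx hqx' hx hx' hq hq'
    induction hj with
    | refl => exact Relation.EqvGen.refl _
    | @tail a b _ h ih =>
      refine ih.trans _ _ _ ?_
      obtain ⟨hab, ha, hb⟩ := h
      obtain ⟨e, ⟨h1, h2⟩ | ⟨h1, h2⟩⟩ := contracted_edge hab
      · exact (hfib a _ ha h1).trans _ _ _ (Relation.EqvGen.trans _ _ _
          (Relation.EqvGen.rel _ _ ⟨(hμ _ _).2 ⟨a, ha, h1⟩, (hμ _ _).2 ⟨b, hb, h2⟩, e, rfl, rfl⟩)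
          (hfib b _ hb h2).symm)
      · exact (hfib a _ ha h2).trans _ _ _ (Relation.EqvGen.trans _ _ _
          (Relation.EqvGen.rel _ _
            ⟨(hμ _ _).2 ⟨b, hb, h1⟩, (hμ _ _).2 ⟨a, ha, h2⟩, e, rfl, rfl⟩).symm
          (hfib b _ hb h1).symm)
  have hadj : ∀ z : Fin 3 × Fin 7, ∃ e,
      (μ (T.fst e) = some (Sum.inl z.1) ∧ μ (T.snd e) = some (Sum.inr z.2)) ∨
        (μ (T.fst e) = some (Sum.inr z.2) ∧ μ (T.snd e) = some (Sum.inl z.1)) := by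
    intro z
    obtain ⟨x, hx, y, hy, hxy⟩ := hIL.adj z.1 z.2
    obtain ⟨e, ⟨h1, h2⟩ | ⟨h1, h2⟩⟩ := contracted_edge hxy
    · exact ⟨e, Or.inl ⟨(hμ _ (Sum.inl z.1)).2 ⟨x, hx, h1⟩, (hμ _ (Sum.inr z.2)).2 ⟨y, hy, h2⟩⟩⟩
    · exact ⟨e, Or.inr ⟨(hμ _ (Sum.inr z.2)).2 ⟨y, hy, h1⟩, (hμ _ (Sum.inl z.1)).2 ⟨x, hx, h2⟩⟩⟩
  choose ι hι using hadj
  exact hdual.not_minor_bipartite ι μ hconn hι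

end ForestGraph

end SteinerNetwork

namespace SteinerNetwork

/-! ### Clusters of essential nodes and pieces of edges -/

namespace ForestGraph

open Classical

variable {D Y : Type*} [Fintype D] [Fintype Y] (T : ForestGraph D Y)

/-- Degree 7 gives the base 8. Weighting each oriented edge by the blob distance of its source
totals at most seven times the sum over essential nodes, which is at most 6 weights plus 124 = 2 ·
60 + 4 lengths. The three rounds of chopping turn 7 into 21. -/
theorem exists_contracted_parts {F : Type*} [Finite F] {l r : Y → F}
    (hdual : IsAlgebraicDual T.fst T.snd l r) {Δ : ℕ} (hΔ : 0 < Δ) :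
    ∃ cl : D → D, (∀ κ, (Finset.univ.filter fun q => cl q = κ).card ≤ 6 * 8 ^ (24 * Δ)) ∧
      ∑ e : D × D, (if T.contracted.Adj e.1 e.2 ∧ cl e.1 ≠ cl e.2 then T.dist (T.blob e.1) else 0)
        ≤ 21 / Δ * (6 * ∑ y, T.wt y + 124 * ∑ d, T.len d) := by
  obtain ⟨H', h1, h2⟩ := exists_small_parts contracted_degree_le (no_bipartiteMinor hdual) hΔ
    (fun x _ => T.dist (T.blob x)) (fun x _ => T.dist_nonneg _)
  let cl : D → D := fun q => Quot.out (H'.connectedComponentMk q)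
  have hcl : ∀ x y, cl x = cl y ↔ H'.Reachable x y := by
    intro x y
    rw [← SimpleGraph.ConnectedComponent.eq]
    refine ⟨fun h => ?_, fun h => ?_⟩
    · have hx : H'.connectedComponentMk (cl x) = H'.connectedComponentMk x := Quot.out_eq _
      have hy : H'.connectedComponentMk (cl y) = H'.connectedComponentMk y := Quot.out_eq _
      rw [← hx, ← hy, h]
    · exact congrArg Quot.out h
  refine ⟨cl, fun κ => ?_, ?_⟩
  · by_cases h : ∃ x, cl x = κ
    · obtain ⟨x, rfl⟩ := h
      refine le_trans (Finset.card_le_card fun y hy => ?_) (h1 x)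
      rw [Finset.mem_filter] at hy ⊢
      exact ⟨hy.1, (hcl _ _).1 hy.2.symm⟩
    · rw [Finset.filter_false_of_mem fun x _ hx => h ⟨x, hx⟩]
      simp
  · simp only [ne_eq, hcl]
    refine h2.trans ?_
    have h3 : ∑ e : D × D, (if T.contracted.Adj e.1 e.2 then T.dist (T.blob e.1) else 0)
        ≤ 7 * ∑ q ∈ Finset.univ.filter T.Essential, T.dist (T.blob q) := by
      rw [Fintype.sum_prod_type, Finset.mul_sum, Finset.sum_filter]
      refine Finset.sum_le_sum fun x _ => ?_
      by_cases hx : T.Essential x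
      · rw [if_pos hx, ← Finset.sum_filter]
        simp only [Finset.sum_const, nsmul_eq_mul]
        exact mul_le_mul_of_nonneg_right (by exact_mod_cast contracted_degree_le x)
          (T.dist_nonneg _)
      · rw [if_neg hx]
        exact (Finset.sum_eq_zero fun y _ => if_neg fun h => hx (contracted_essential h)).le
    have h4 := T.sum_essential_dist_le
    have h5 := T.sum_pairs_dist_le hdual
    have h6 := T.sum_cut_dist_le
    have h7 : (0 : ℝ) ≤ 3 / Δ := by positivity
    calc _ ≤ (3 / Δ : ℝ) * (7 * (6 * ∑ y, T.wt y + 124 * ∑ d, T.len d)) :=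
          mul_le_mul_of_nonneg_left (by linarith) h7
      _ = _ := by ring

/-- The edges of a forest graph can be partitioned into pieces that meet few blobs, such that the
blobs that meet several pieces have small total distance. -/
theorem exists_pieces {F : Type*} [Finite F] {l r : Y → F}
    (hdual : IsAlgebraicDual T.fst T.snd l r) {Δ : ℕ} (hΔ : 0 < Δ) :
    ∃ (piece : Y → D) (att : D → Finset D),
      (∀ y, T.valid y → piece y ∈ att (T.blob (T.fst y)) ∧ piece y ∈ att (T.blob (T.snd y))) ∧
      (∀ b, (att b).Nonempty → T.cut b) ∧
      (∀ κ, (Finset.univ.filter fun b => κ ∈ att b).card ≤ 48 * 8 ^ (24 * Δ)) ∧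
      ∑ b, (if 2 ≤ (att b).card then (att b).card * T.dist b else 0)
        ≤ 63 / Δ * (6 * ∑ y, T.wt y + 124 * ∑ d, T.len d) := by
  obtain ⟨cl, h1, h2⟩ := T.exists_contracted_parts hdual hΔ
  -- A blob meets the clusters of its essential nodes. It also meets the cluster at the first end of
  -- each representative edge whose second end it contains, since that edge is assigned to the
  -- cluster of its first end.
  let att : D → Finset D := fun b => Finset.univ.filter fun κ =>
    (∃ q, T.Essential q ∧ T.blob q = b ∧ cl q = κ) ∨
      ∃ z, T.blob (T.snd (T.rep z)) = b ∧ cl (T.fst (T.rep z)) = κ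
  -- All edges between the same two blobs go to the piece of their representative. Where the pair is
  -- not listed, which for a valid edge means that it lies inside a blob, the blob's top node
  -- decides.
  let piece : Y → D := fun y =>
    if h : s(T.blob (T.fst y), T.blob (T.snd y)) ∈ T.pairs then cl (T.fst (T.rep ⟨_, h⟩))
    else cl (T.blob (T.fst y))
  have hatt : ∀ {b κ}, κ ∈ att b ↔ (∃ q, T.Essential q ∧ T.blob q = b ∧ cl q = κ) ∨
      ∃ z, T.blob (T.snd (T.rep z)) = b ∧ cl (T.fst (T.rep z)) = κ := by simp [att]
  refine ⟨piece, att, fun y hy => ?_, fun b hb => ?_, fun κ => ?_, ?_⟩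
  · by_cases h : s(T.blob (T.fst y), T.blob (T.snd y)) ∈ T.pairs
    · have hp : piece y = cl (T.fst (T.rep ⟨_, h⟩)) := dif_pos h
      have h3 := T.rep_eq ⟨_, h⟩
      have h4 : piece y ∈ att (T.blob (T.fst (T.rep ⟨_, h⟩))) :=
        hatt.2 (Or.inl ⟨_, essential_fst_rep _, rfl, hp.symm⟩)
      have h5 : piece y ∈ att (T.blob (T.snd (T.rep ⟨_, h⟩))) :=
        hatt.2 (Or.inr ⟨_, rfl, hp.symm⟩)
      rcases Sym2.eq_iff.1 h3 with ⟨e1, e2⟩ | ⟨e1, e2⟩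
      · rw [e1] at h4
        rw [e2] at h5
        exact ⟨h4, h5⟩
      · rw [e1] at h4
        rw [e2] at h5
        exact ⟨h5, h4⟩
    · have hp : piece y = cl (T.blob (T.fst y)) := dif_neg h
      have hb : T.blob (T.fst y) = T.blob (T.snd y) := by
        by_contra hne
        exact h (mem_pairs.2 ⟨y, ⟨hy, hne⟩, rfl⟩)
      have h3 : piece y ∈ att (T.blob (T.fst y)) := hatt.2 (Or.inl ⟨_, Or.inr (Or.inl (T.cut_blob _)),
        LengthForest.blob_of_cut (T.cut_blob _), hp.symm⟩)
      exact ⟨h3, hb ▸ h3⟩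
  · obtain ⟨κ, hκ⟩ := hb
    rcases hatt.1 hκ with ⟨q, -, rfl, -⟩ | ⟨z, rfl, -⟩
    · exact T.cut_blob _
    · exact T.cut_blob _
  · set C := Finset.univ.filter fun q => cl q = κ with hC
    have hsub : (Finset.univ.filter fun b => κ ∈ att b) ⊆ C.image T.blob ∪ C.biUnion fun q =>
        (Finset.univ.filter fun y => T.contracted.Adj q y).image T.blob := by
      intro b hb
      rw [Finset.mem_union]
      rcases hatt.1 (Finset.mem_filter.1 hb).2 with ⟨q, -, h, h'⟩ | ⟨z, h, h'⟩
      · exact Or.inl (Finset.mem_image.2 ⟨q, Finset.mem_filter.2 ⟨Finset.mem_univ _, h'⟩, h⟩)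
      · refine Or.inr (Finset.mem_biUnion.2 ⟨_, Finset.mem_filter.2 ⟨Finset.mem_univ _, h'⟩,
          Finset.mem_image.2 ⟨_, Finset.mem_filter.2 ⟨Finset.mem_univ _, ?_⟩, h⟩⟩)
        exact Arc.adj (Or.inr ⟨z, rfl, rfl⟩)
    have h3 := Finset.card_le_card hsub
    have h4 := Finset.card_union_le (C.image T.blob) (C.biUnion fun q =>
        (Finset.univ.filter fun y => T.contracted.Adj q y).image T.blob)
    have h5 : (C.image T.blob).card ≤ C.card := Finset.card_image_le
    have h6 := Finset.card_biUnion_le_card_mul C (fun q =>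
        (Finset.univ.filter fun y => T.contracted.Adj q y).image T.blob) 7
        fun q _ => Finset.card_image_le.trans (contracted_degree_le q)
    have h7 := h1 κ
    rw [← hC] at h7
    omega
  -- Oriented contracted edges that leave a node of the blob `b` and are cut by the clustering; the
  -- bound on `att b` charges to these.
  · let E : D → Finset (D × D) := fun b => Finset.univ.filter fun e =>
      (T.contracted.Adj e.1 e.2 ∧ cl e.1 ≠ cl e.2) ∧ T.blob e.1 = b
    have hE : ∀ {b x y}, T.contracted.Adj x y → cl x ≠ cl y → T.blob x = b → (x, y) ∈ E b :=
      fun h h' h'' => Finset.mem_filter.2 ⟨Finset.mem_univ _, ⟨h, h'⟩, h''⟩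
    have hess : ∀ q, T.Essential q →
        cl q ∈ insert (cl (T.blob q)) ((E (T.blob q)).image fun e => cl e.1) := by
      intro q hq
      induction hn : T.rank q using Nat.strong_induction_on generalizing q with
      | _ n ih =>
        rw [Finset.mem_insert]
        by_cases hc : T.cut q
        · rw [LengthForest.blob_of_cut hc]
          exact Or.inl rfl
        · by_cases hcl : cl q = cl (T.parent q)
          · have := ih _ (hn ▸ rank_parent hq hc) _ (top_spec hq hc).2.2 rfl
            rwa [blob_parent hq hc, ← hcl, Finset.mem_insert] at this
          · exact Or.inr (Finset.mem_image.2
              ⟨(q, T.parent q), hE (Arc.adj (Or.inl ⟨hq, hc, rfl⟩)) hcl rfl, rfl⟩)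
    -- Climbing from an essential node to the top of its blob, the cluster changes only along cut
    -- edges, so every cluster other than the top's is seen at one of them. If at least two clusters
    -- occur then `E b` is nonempty and the bound becomes `3 * (E b).card`, which turns 21 into 63.
    have hcard : ∀ b, (att b).card ≤ 1 + 2 * (E b).card := by
      intro b
      have hsub : att b ⊆ insert (cl b) ((E b).image fun e => cl e.1) ∪
          (E b).image fun e => cl e.2 := by
        intro κ hκ
        rw [Finset.mem_union]
        rcases hatt.1 hκ with ⟨q, h, rfl, rfl⟩ | ⟨z, rfl, rfl⟩
        · exact Or.inl (hess q h)
        · by_cases hcl : cl (T.fst (T.rep z)) = cl (T.snd (T.rep z))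
          · rw [hcl]
            exact Or.inl (hess _ (essential_snd_rep z))
          · exact Or.inr (Finset.mem_image.2 ⟨(T.snd (T.rep z), T.fst (T.rep z)),
              hE (Arc.adj (Or.inr ⟨z, rfl, rfl⟩)).symm (Ne.symm hcl) rfl, rfl⟩)
      have h3 := Finset.card_le_card hsub
      have h4 := Finset.card_union_le (insert (cl b) ((E b).image fun e => cl e.1))
        ((E b).image fun e => cl e.2)
      have h5 := Finset.card_insert_le (cl b) ((E b).image fun e => cl e.1)
      have h6 : ((E b).image fun e => cl e.1).card ≤ (E b).card := Finset.card_image_le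
      have h7 : ((E b).image fun e => cl e.2).card ≤ (E b).card := Finset.card_image_le
      omega
    calc ∑ b, (if 2 ≤ (att b).card then (att b).card * T.dist b else 0)
        ≤ ∑ b, 3 * ∑ e ∈ E b, T.dist (T.blob e.1) := by
          refine Finset.sum_le_sum fun b _ => ?_
          have h3 : ∑ e ∈ E b, T.dist (T.blob e.1) = (E b).card * T.dist b := by
            rw [← nsmul_eq_mul, ← Finset.sum_const]
            exact Finset.sum_congr rfl fun e he => by rw [(Finset.mem_filter.1 he).2.2]
          rw [h3, ← mul_assoc]
          split_ifs with h
          · refine mul_le_mul_of_nonneg_right ?_ (T.dist_nonneg b)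
            have := hcard b
            exact_mod_cast (by omega : (att b).card ≤ 3 * (E b).card)
          · have := T.dist_nonneg b
            positivity
      _ = 3 * ∑ e : D × D,
          (if T.contracted.Adj e.1 e.2 ∧ cl e.1 ≠ cl e.2 then T.dist (T.blob e.1) else 0) := by
          rw [← Finset.mul_sum, ← Finset.sum_filter, ← Finset.sum_fiberwise _ fun e : D × D => T.blob e.1]
          simp only [E, Finset.filter_filter]
      _ ≤ 3 * (21 / Δ * (6 * ∑ y, T.wt y + 124 * ∑ d, T.len d)) := by linarith
      _ = _ := by ring

end ForestGraph

end SteinerNetwork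

namespace SteinerNetwork

/-! ### The shortest path forest of an embedded graph -/

section ShortestPaths

open Classical

variable {V : Type*} [Finite V] {Γ : SimpleGraph V}

/-- Distances to a set of vertices, with values in an ordered monoid. -/
theorem exists_distance {K : Type*} [AddCommMonoid K] [LinearOrder K] [IsOrderedAddMonoid K]
    (e : Γ.Dart → K) (he : ∀ d, 0 ≤ e d) (R : Set V) :
    ∃ key : V → K, (∀ r ∈ R, key r = 0) ∧
      (∀ d : Γ.Dart, (∃ r ∈ R, Γ.Reachable d.snd r) → key d.fst ≤ e d + key d.snd) ∧
      ∀ v ∉ R, (∃ r ∈ R, Γ.Reachable v r) →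
        ∃ d : Γ.Dart, d.fst = v ∧ key v = e d + key d.snd := by
  have := Fintype.ofFinite V
  let f : ∀ {u v : V}, Γ.Walk u v → K := fun p => (p.darts.map e).sum
  have hf0 : ∀ {u v : V} (p : Γ.Walk u v), 0 ≤ f p := fun p =>
    List.sum_nonneg fun x hx => by
      obtain ⟨d, -, rfl⟩ := List.mem_map.1 hx
      exact he d
  have hmin : ∀ v, (∃ r ∈ R, Γ.Reachable v r) →
      ∃ k, (∃ r ∈ R, ∃ p : Γ.Walk v r, f p = k) ∧ ∀ r ∈ R, ∀ p : Γ.Walk v r, k ≤ f p := by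
    rintro v ⟨r, hr, ⟨p⟩⟩
    -- The minimum is taken over the finitely many paths; shortcutting a walk to a path does not
    -- increase its length.
    have : Nonempty (Σ r : R, Γ.Path v r) := ⟨⟨⟨r, hr⟩, p.toPath⟩⟩
    obtain ⟨⟨r₀, p₀⟩, h⟩ := Finite.exists_min fun x : Σ r : R, Γ.Path v r => f x.2.1
    refine ⟨f p₀.1, ⟨r₀, r₀.2, p₀.1, rfl⟩, fun r hr p => (h ⟨⟨r, hr⟩, p.toPath⟩).trans ?_⟩
    refine List.Sublist.sum_le_sum (p.darts_bypass_sublist_darts.map e) fun x hx => ?_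
    obtain ⟨d, -, rfl⟩ := List.mem_map.1 hx
    exact he d
  choose! key h1 h2 using hmin
  have h0 : ∀ r ∈ R, key r = 0 := fun r hr => by
    have hrr : ∃ r' ∈ R, Γ.Reachable r r' := ⟨r, hr, SimpleGraph.Reachable.refl r⟩
    obtain ⟨r', hr', p, hp⟩ := h1 r hrr
    refine le_antisymm ?_ (hp ▸ hf0 p)
    simpa [f] using h2 r hrr r hr SimpleGraph.Walk.nil
  have hstep : ∀ d : Γ.Dart, (∃ r ∈ R, Γ.Reachable d.snd r) → key d.fst ≤ e d + key d.snd := by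
    intro d hd
    obtain ⟨r, hr, p, hp⟩ := h1 _ hd
    have := h2 d.fst ⟨r, hr, d.adj.reachable.trans ⟨p⟩⟩ r hr (SimpleGraph.Walk.cons d.adj p)
    rw [← hp]
    simpa [f] using this
  refine ⟨key, h0, hstep, fun v hv hvR => ?_⟩
  obtain ⟨r, hr, p, hp⟩ := h1 v hvR
  cases p with
  | nil => exact absurd hr hv
  | @cons _ u _ h p =>
    refine ⟨⟨(v, u), h⟩, rfl, ?_⟩
    have hu : ∃ r ∈ R, Γ.Reachable u r := ⟨r, hr, ⟨p⟩⟩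
    refine le_antisymm (hstep ⟨(v, u), h⟩ hu) ?_
    rw [← hp]
    simpa [f] using add_le_add_right (h2 u hu r hr p) (e ⟨(v, u), h⟩)

/-- Pairs (length, number of edges) are minimized lexicographically. Among shortest paths the hop
count decides, so it drops strictly towards the terminals even along edges of weight zero and the
predecessors cannot form cycles. -/
theorem exists_shortest_paths (w : V → V → ℝ) (hw : ∀ d : Γ.Dart, 0 ≤ w d.fst d.snd) (R : Set V) :
    ∃ (dd : V → ℝ) (hop : V → ℕ) (pr : V → V), (∀ r ∈ R, dd r = 0) ∧
      (∀ d : Γ.Dart, (∃ r ∈ R, Γ.Reachable d.snd r) → dd d.fst ≤ w d.fst d.snd + dd d.snd) ∧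
      ∀ v ∉ R, (∃ r ∈ R, Γ.Reachable v r) →
        Γ.Adj v (pr v) ∧ dd v = w v (pr v) + dd (pr v) ∧ hop (pr v) < hop v := by
  obtain ⟨key, h0, h1, h2⟩ := exists_distance (K := ℝ ×ₗ ℕ)
    (fun d : Γ.Dart => toLex (w d.fst d.snd, 1)) (fun d => by
      refine Prod.Lex.le_iff.2 ?_
      rcases (hw d).lt_or_eq with h | h
      · exact Or.inl h
      · exact Or.inr ⟨h, Nat.zero_le _⟩) R
  have h3 : ∀ v, ∃ u, v ∉ R → (∃ r ∈ R, Γ.Reachable v r) →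
      Γ.Adj v u ∧ key v = toLex (w v u, 1) + key u := by
    intro v
    by_cases hv : v ∉ R ∧ ∃ r ∈ R, Γ.Reachable v r
    · obtain ⟨d, rfl, hd⟩ := h2 v hv.1 hv.2
      exact ⟨d.snd, fun _ _ => ⟨d.adj, hd⟩⟩
    · exact ⟨v, fun h h' => absurd ⟨h, h'⟩ hv⟩
  choose pr hpr using h3
  refine ⟨fun v => (ofLex (key v)).1, fun v => (ofLex (key v)).2, pr, fun r hr => ?_,
    fun d hd => ?_, fun v hv hvR => ?_⟩
  · simp only [h0 r hr]
    rfl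
  · exact Prod.Lex.monotone_fst _ _ (h1 d hd)
  · obtain ⟨h4, h5⟩ := hpr v hv hvR
    refine ⟨h4, ?_, ?_⟩
    · simp only
      conv_lhs => rw [h5]
      rfl
    · simp only
      conv_rhs => rw [h5]
      change _ < 1 + (ofLex (key (pr v))).2
      exact Nat.lt_add_of_pos_left one_pos

/-- The shortest path forest on the darts of an embedded graph. -/
theorem exists_forestGraph [Fintype Γ.Dart] {ρ : Equiv.Perm Γ.Dart} (hρ : IsRotationSystem Γ ρ)
    (w : V → V → ℝ) (hw : ∀ d : Γ.Dart, 0 ≤ w d.fst d.snd)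
    (hsymm : ∀ d : Γ.Dart, w d.snd d.fst = w d.fst d.snd) (R : Set V) :
    ∃ T : ForestGraph Γ.Dart (Γ.Dart ⊕ Γ.Dart),
      T.fst = truncFst ∧ T.snd = truncSnd ρ (dartReverse Γ) ∧
      (∀ d, T.root d ↔ ¬ (d.fst ∉ R ∧ ∃ r ∈ R, Γ.Reachable d.fst r)) ∧
      (∀ d, T.valid (Sum.inl d) ↔ d.fst ∉ R ∧ ∃ r ∈ R, Γ.Reachable d.fst r) ∧
      (∀ d, T.valid (Sum.inr d) ↔ ∃ r ∈ R, Γ.Reachable d.fst r) ∧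
      (∀ d, T.wt (Sum.inl d) = 0) ∧ (∀ d, T.wt (Sum.inr d) = w d.fst d.snd) ∧
      (∀ d, T.len d ≤ w d.fst d.snd) ∧
      ∀ d, ¬ T.root d →
        (T.next d).fst = d.fst ∨ (T.next d = d.symm ∧ T.len d = w d.fst d.snd) := by
  obtain ⟨dd, hop, pr, h0, h1, h2⟩ := exists_shortest_paths w hw R
  let I : V → Prop := fun v => v ∉ R ∧ ∃ r ∈ R, Γ.Reachable v r
  have hρ1 : ∀ d, (ρ d).fst = d.fst := fun d =>
    ((hρ d (ρ d)).1 (Equiv.Perm.sameCycle_apply_right.2 (Equiv.Perm.SameCycle.refl ρ d))).symm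
  -- At a non-terminal vertex the forest turns around the vertex, at no cost, until it reaches the
  -- dart towards the predecessor, and then crosses that edge. Only crossings have positive length.
  let next : Γ.Dart → Γ.Dart := fun d =>
    if I d.fst then if d.snd = pr d.fst then d.symm else ρ d else d
  have next_of : ∀ d, I d.fst → d.snd = pr d.fst → next d = d.symm := fun d h h' => by
    simp only [next, if_pos h, if_pos h']
  have next_of_not : ∀ d, I d.fst → d.snd ≠ pr d.fst → next d = ρ d := fun d h h' => by
    simp only [next, if_pos h, if_neg h']
  -- The number of turns left before crossing. The rank orders darts by hop count first and by this
  -- number second, so its multiplier `M` exceeds every value of `turn`.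
  let turn : Γ.Dart → ℕ := fun d => sInf {k | ((ρ ^ k) d).snd = pr d.fst}
  have turn_lt : ∀ d, I d.fst → d.snd ≠ pr d.fst → turn (ρ d) < turn d := by
    intro d hd hne
    have hex : {k | ((ρ ^ k) d).snd = pr d.fst}.Nonempty := by
      obtain ⟨k, hk⟩ := ((hρ d ⟨(d.fst, pr d.fst), (h2 _ hd.1 hd.2).1⟩).2 rfl).exists_nat_pow_eq
      exact ⟨k, by rw [Set.mem_ofPred_eq, hk]⟩
    have hmem : ((ρ ^ turn d) d).snd = pr d.fst := Nat.sInf_mem hex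
    obtain ⟨k, hk⟩ : ∃ k, turn d = k + 1 := Nat.exists_eq_succ_of_ne_zero fun h => by
      rw [h] at hmem
      exact hne hmem
    rw [hk, pow_succ, Equiv.Perm.mul_apply] at hmem
    rw [hk, Nat.lt_succ_iff]
    exact Nat.sInf_le (by rw [Set.mem_ofPred_eq, hmem, hρ1])
  let M : ℕ := Finset.univ.sup turn + 1
  have turn_lt_M : ∀ d, turn d < M := fun d =>
    Nat.lt_succ_of_le (Finset.le_sup (f := turn) (Finset.mem_univ d))
  -- Darts at terminals and in components without terminals are roots, hence the value 0.
  let dist : Γ.Dart → ℝ := fun d => if I d.fst then dd d.fst else 0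
  have hdist : ∀ d : Γ.Dart, (∃ r ∈ R, Γ.Reachable d.fst r) → dist d = dd d.fst := by
    intro d hd
    by_cases h : d.fst ∈ R
    · rw [h0 _ h]
      exact if_neg fun h' => h'.1 h
    · exact if_pos ⟨h, hd⟩
  have hreach : ∀ d : Γ.Dart, (∃ r ∈ R, Γ.Reachable d.fst r) → ∃ r ∈ R, Γ.Reachable d.snd r :=
    fun d ⟨r, hr, h⟩ => ⟨r, hr, d.adj.symm.reachable.trans h⟩
  -- A node is entered only by crossing its own edge or by one turn of the rotation, so it has at
  -- most two children.
  have hsucc : ∀ c d, I c.fst → next c = d → c = d.symm ∨ c = ρ⁻¹ d := by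
    rintro c d hc rfl
    by_cases h : c.snd = pr c.fst
    · rw [next_of c hc h]
      exact Or.inl (SimpleGraph.Dart.symm_symm c).symm
    · rw [next_of_not c hc h]
      exact Or.inr (ρ.symm_apply_apply c).symm
  refine ⟨{
    next := next
    root := fun d => ¬ I d.fst
    rank := fun d => hop d.fst * M + turn d
    len := fun d => if I d.fst ∧ d.snd = pr d.fst then w d.fst d.snd else 0
    dist := dist
    rank_lt := fun d hd => ?_
    len_nonneg := fun d => ?_
    dist_root := fun d hd => if_neg hd
    dist_next := fun d hd => ?_
    children := fun d c₁ c₂ c₃ r₁ r₂ r₃ e₁ e₂ e₃ => ?_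
    fst := truncFst
    snd := truncSnd ρ (dartReverse Γ)
    valid := Sum.elim (fun d => I d.fst) (fun d => ∃ r ∈ R, Γ.Reachable d.fst r)
    wt := Sum.elim (fun _ => 0) (fun d => w d.fst d.snd)
    wt_nonneg := ?_
    dist_fst_le := ?_
    dist_snd_le := ?_
    fst_fibre := ?_
    snd_fibre := ?_
    parent_edge := fun d hd => ?_ }, rfl, rfl, fun d => Iff.rfl, fun d => Iff.rfl, fun d => Iff.rfl,
    fun d => rfl, fun d => rfl, fun d => ?_, fun d hd => ?_⟩
  · rw [not_not] at hd
    by_cases h : d.snd = pr d.fst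
    · rw [next_of d hd h]
      have h3 := (h2 _ hd.1 hd.2).2.2
      rw [← h] at h3
      have h4 := turn_lt_M d.symm
      change hop d.snd * M + turn d.symm < _
      have h5 := Nat.mul_le_mul_right M h3
      rw [Nat.succ_mul] at h5
      omega
    · rw [next_of_not d hd h, hρ1]
      exact Nat.add_lt_add_left (turn_lt d hd h) _
  · split_ifs
    · exact hw d
    · exact le_rfl
  · rw [not_not] at hd
    rw [hdist d hd.2]
    by_cases h : d.snd = pr d.fst
    · rw [next_of d hd h, if_pos ⟨hd, h⟩, hdist d.symm (hreach d hd.2), (h2 _ hd.1 hd.2).2.1, ← h]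
      rfl
    · rw [next_of_not d hd h, if_neg fun h' => h h'.2, zero_add, hdist, hρ1]
      rw [hρ1]
      exact hd.2
  · rw [not_not] at r₁ r₂ r₃
    rcases hsucc _ _ r₁ e₁ with h | h <;> rcases hsucc _ _ r₂ e₂ with h' | h' <;>
      rcases hsucc _ _ r₃ e₃ with h'' | h'' <;> simp only [h, h', h'', true_or, or_true]
  · rintro (d | d)
    · exact le_rfl
    · exact hw d
  · rintro (d | d) hd
    · change dist d ≤ dist (ρ d) + 0
      simp only [dist, hρ1, add_zero, le_rfl]
    · change dist d ≤ dist d.symm + w d.fst d.snd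
      rw [hdist d hd, hdist d.symm (hreach d hd), add_comm]
      exact h1 d (hreach d hd)
  · rintro (d | d) hd
    · change dist (ρ d) ≤ dist d + 0
      simp only [dist, hρ1, add_zero, le_rfl]
    · change dist d.symm ≤ dist d + w d.fst d.snd
      rw [hdist d hd, hdist d.symm (hreach d hd), add_comm, ← hsymm d]
      exact h1 d.symm hd
  · rintro (d₁ | d₁) (d₂ | d₂) (d₃ | d₃) h h' <;>
      simp only [truncFst, Sum.elim_inl, Sum.elim_inr, id_eq] at h h' <;> subst h <;> subst h' <;>
      simp
  · rintro (d₁ | d₁) (d₂ | d₂) (d₃ | d₃) h h' <;>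
      simp only [truncSnd, Sum.elim_inl, Sum.elim_inr] at h h' <;>
      simp only [Sum.inl.injEq, Sum.inr.injEq, reduceCtorEq, false_or, or_false]
    · exact Or.inl (ρ.injective h)
    · exact ρ.injective h
    · exact ρ.injective h'
    · exact (dartReverse Γ).injective (h.symm.trans h')
    · exact ρ.injective (h.symm.trans h')
    · exact (dartReverse Γ).injective h'
    · exact (dartReverse Γ).injective h
    · exact Or.inl ((dartReverse Γ).injective h)
  · rw [not_not] at hd
    by_cases h : d.snd = pr d.fst
    · exact ⟨Sum.inr d, hd.2, Or.inl ⟨rfl, (next_of d hd h).symm⟩⟩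
    · exact ⟨Sum.inl d, hd, Or.inl ⟨rfl, (next_of_not d hd h).symm⟩⟩
  · simp only
    split_ifs
    · exact le_rfl
    · exact hw d
  · simp only [not_not] at hd
    by_cases h : d.snd = pr d.fst
    · exact Or.inr ⟨next_of d hd h, if_pos ⟨hd, h⟩⟩
    · left
      change (next d).fst = _
      rw [next_of_not d hd h, hρ1]

end ShortestPaths

end SteinerNetwork

namespace SteinerNetwork

/-! ### The networks of the pieces -/

section Pieces

open Classical

variable {V : Type*} {Γ : SimpleGraph V} [Fintype Γ.Dart]

/-- The part of the network `N` that belongs to the piece `κ`, together with the shortest path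
trees of all the blobs that meet `κ` and another piece. -/
def pieceNetwork (N : Digraph V) (T : LengthForest Γ.Dart) (piece : Γ.Dart → Γ.Dart)
    (att : Γ.Dart → Finset Γ.Dart) (κ : Γ.Dart) : Digraph V where
  Adj u v := ∃ d : Γ.Dart, d.fst = u ∧ d.snd = v ∧ ((N.Adj u v ∧ piece d = κ) ∨
    ∃ b, κ ∈ att b ∧ 2 ≤ (att b).card ∧ ((d ∈ T.hull b ∧ T.next d = d.symm) ∨
      (d.symm ∈ T.hull b ∧ T.next d.symm = d)))

/-- The demands between the terminals of the piece `κ` that are satisfied by its network. -/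
noncomputable def piecePattern (R : Finset V) (N : Digraph V) (T : LengthForest Γ.Dart)
    (piece : Γ.Dart → Γ.Dart) (att : Γ.Dart → Finset Γ.Dart) (κ : Γ.Dart) : Pattern V where
  verts := R.filter fun v => ∃ b, κ ∈ att b ∧ (T.rootOf b).fst = v
  Adj s t := (s ∈ R.filter fun v => ∃ b, κ ∈ att b ∧ (T.rootOf b).fst = v) ∧
    (t ∈ R.filter fun v => ∃ b, κ ∈ att b ∧ (T.rootOf b).fst = v) ∧
    Relation.ReflTransGen (pieceNetwork N T piece att κ).Adj s t
  left_mem _ _ h := h.1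
  right_mem _ _ h := h.2.1

variable {R : Finset V} {N : Digraph V} {T : LengthForest Γ.Dart} {piece : Γ.Dart → Γ.Dart}
  {att : Γ.Dart → Finset Γ.Dart} {κ : Γ.Dart}

theorem pieceNetwork_adj {u v : V} (h : (pieceNetwork N T piece att κ).Adj u v) : Γ.Adj u v := by
  obtain ⟨d, rfl, rfl, -⟩ := h
  exact d.adj

theorem mem_piecePattern_verts {v : V} :
    v ∈ (piecePattern R N T piece att κ).verts ↔
      v ∈ R ∧ ∃ b, κ ∈ att b ∧ (T.rootOf b).fst = v :=
  Finset.mem_filter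

theorem card_piecePattern_verts_le :
    (piecePattern R N T piece att κ).verts.card
      ≤ (Finset.univ.filter fun b => κ ∈ att b).card := by
  refine le_trans (Finset.card_le_card fun v hv => ?_)
    (Finset.card_image_le (f := fun b => (T.rootOf b).fst))
  obtain ⟨-, b, hb, h⟩ := mem_piecePattern_verts.1 hv
  exact Finset.mem_image.2 ⟨b, Finset.mem_filter.2 ⟨Finset.mem_univ _, hb⟩, h⟩

theorem isSolution_pieceNetwork {G : Digraph V} (hG : ∀ u v, Γ.Adj u v → G.Adj u v) :
    IsSolution G (piecePattern R N T piece att κ) (pieceNetwork N T piece att κ) :=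
  ⟨fun _ _ h => hG _ _ (pieceNetwork_adj h), fun _ _ h => h.2.2⟩

/-- A node of a blob that meets several pieces is joined with its root inside every piece. -/
theorem pieceNetwork_reach_root
    (hnext : ∀ d, ¬ T.root d → (T.next d).fst = d.fst ∨ T.next d = d.symm) {x : Γ.Dart}
    (hκ : κ ∈ att (T.blob x)) (hcard : 2 ≤ (att (T.blob x)).card) :
    Relation.ReflTransGen (pieceNetwork N T piece att κ).Adj x.fst (T.rootOf x).fst ∧
      Relation.ReflTransGen (pieceNetwork N T piece att κ).Adj (T.rootOf x).fst x.fst := by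
  have h := T.hull_path x
  generalize T.rootOf x = y at h ⊢
  induction h with
  | refl => exact ⟨Relation.ReflTransGen.refl, Relation.ReflTransGen.refl⟩
  | @tail p q _ h ih =>
    obtain ⟨hp, rfl⟩ := h
    rcases hnext p (T.not_root_of_mem_hull hp) with h | h
    · rwa [h]
    · refine ⟨ih.1.tail ⟨p, rfl, by rw [h]; rfl, Or.inr ⟨_, hκ, hcard, Or.inl ⟨hp, h⟩⟩⟩,
        ih.2.head ⟨p.symm, by rw [h], rfl, Or.inr ⟨_, hκ, hcard, Or.inr ⟨?_, ?_⟩⟩⟩⟩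
      · rwa [SimpleGraph.Dart.symm_symm]
      · rwa [SimpleGraph.Dart.symm_symm]

/-- The demands of the pieces imply all the demands satisfied by `N`. -/
theorem reflTransGen_of_pieces {ρ : Equiv.Perm Γ.Dart} (hρ : IsRotationSystem Γ ρ)
    (hN : ∀ u v, N.Adj u v → u ≠ v → Γ.Adj u v)
    (hnext : ∀ d, ¬ T.root d → (T.next d).fst = d.fst ∨ T.next d = d.symm)
    (hroot : ∀ d, T.root d ↔ ¬ (d.fst ∉ R ∧ ∃ r ∈ R, Γ.Reachable d.fst r))
    (hturn : ∀ d : Γ.Dart, (d.fst ∉ R ∧ ∃ r ∈ R, Γ.Reachable d.fst r) →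
      ∃ κ, κ ∈ att (T.blob d) ∧ κ ∈ att (T.blob (ρ d)))
    (hpiece : ∀ d : Γ.Dart, (∃ r ∈ R, Γ.Reachable d.fst r) →
      piece d ∈ att (T.blob d) ∧ piece d ∈ att (T.blob d.symm))
    {L : Digraph V} (hL : ∀ κ s t, (piecePattern R N T piece att κ).Adj s t →
      Relation.ReflTransGen L.Adj s t) {s t : V} (hs : s ∈ R) (ht : t ∈ R)
    (hst : Relation.ReflTransGen N.Adj s t) : Relation.ReflTransGen L.Adj s t := by
  -- The invariant along a demand path: the given solutions lead from `s` to some terminal `r` of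
  -- the piece, and the piece's own network leads on from `r` to the current vertex.
  let State : V → Γ.Dart → Γ.Dart → Prop := fun v x κ => κ ∈ att (T.blob x) ∧
    ∃ r ∈ (piecePattern R N T piece att κ).verts, Relation.ReflTransGen L.Adj s r ∧
      Relation.ReflTransGen (pieceNetwork N T piece att κ).Adj r v
  -- Changing pieces at a dart uses the root of its blob, a terminal of both pieces. In the old
  -- piece the demand from `r` to the root is closed; in the new piece the walk resumes from the
  -- root back to the vertex.
  have switch : ∀ x κ κ', (∃ r ∈ R, Γ.Reachable x.fst r) → State x.fst x κ →
      κ' ∈ att (T.blob x) → State x.fst x κ' := by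
    rintro x κ κ' ⟨r₀, hr₀, hx⟩ hκ hκ'
    by_cases hne : κ = κ'
    · exact hne ▸ hκ
    obtain ⟨hκ, r, hr, hsr, hrx⟩ := hκ
    have hcard : 2 ≤ (att (T.blob x)).card :=
      Finset.one_lt_card.2 ⟨κ, hκ, κ', hκ', hne⟩
    have h1 := pieceNetwork_reach_root (N := N) (piece := piece) hnext hκ hcard
    have h2 := pieceNetwork_reach_root (N := N) (piece := piece) hnext hκ' hcard
    have hreach : Γ.Reachable x.fst (T.rootOf x).fst := by
      rw [SimpleGraph.reachable_iff_reflTransGen]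
      exact Relation.ReflTransGen.mono (fun _ _ => pieceNetwork_adj) _ _ h1.1
    have hR : (T.rootOf x).fst ∈ R := by
      by_contra hn
      exact (hroot _).1 (T.root_rootOf x) ⟨hn, r₀, hr₀, hreach.symm.trans hx⟩
    have hv : ∀ κ, κ ∈ att (T.blob x) → (T.rootOf x).fst ∈ (piecePattern R N T piece att κ).verts :=
      fun κ h => mem_piecePattern_verts.2 ⟨hR, T.blob x, h, by rw [T.rootOf_blob]⟩
    exact ⟨hκ', _, hv κ' hκ', hsr.trans (hL κ _ _ ⟨hr, hv κ hκ, hrx.trans h1.1⟩), h2.2⟩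
  have key : ∀ v, Relation.ReflTransGen N.Adj s v →
      (v ∈ R ∧ Relation.ReflTransGen L.Adj s v) ∨
        (v ∉ R ∧ (∃ r ∈ R, Γ.Reachable v r) ∧ ∀ x : Γ.Dart, x.fst = v → ∃ κ, State v x κ) := by
    intro v hv
    induction hv with
    | refl => exact Or.inl ⟨hs, Relation.ReflTransGen.refl⟩
    | @tail u v _ huv ih =>
      by_cases hne : u = v
      · rwa [← hne]
      let d : Γ.Dart := ⟨(u, v), hN u v huv hne⟩
      have hu : ∃ r ∈ R, Γ.Reachable u r := by
        rcases ih with ⟨h, -⟩ | ⟨-, h, -⟩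
        · exact ⟨u, h, SimpleGraph.Reachable.refl u⟩
        · exact h
      have hv : ∃ r ∈ R, Γ.Reachable v r := by
        obtain ⟨r, hr, h⟩ := hu
        exact ⟨r, hr, d.adj.symm.reachable.trans h⟩
      obtain ⟨hp1, hp2⟩ := hpiece d hu
      have hd : State u d (piece d) := by
        rcases ih with ⟨h, h'⟩ | ⟨-, -, h⟩
        · have hrd : T.root d := (hroot d).2 fun h'' => h''.1 h
          refine ⟨hp1, u, mem_piecePattern_verts.2 ⟨h, T.blob d, hp1, ?_⟩, h',
            Relation.ReflTransGen.refl⟩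
          rw [T.rootOf_blob, LengthForest.rootOf_of_root hrd]
        · obtain ⟨κ, hκ⟩ := h d rfl
          exact switch d κ _ hu hκ hp1
      have hd' : State v d.symm (piece d) := by
        obtain ⟨-, r, hr, hsr, hru⟩ := hd
        exact ⟨hp2, r, hr, hsr, hru.tail ⟨d, rfl, rfl, Or.inl ⟨huv, rfl⟩⟩⟩
      by_cases hvR : v ∈ R
      · refine Or.inl ⟨hvR, ?_⟩
        -- A dart at a terminal is the root of its tree, so the terminal belongs to the pattern of
        -- the current piece and the open demand can be closed.
        have hrd : T.root d.symm := (hroot d.symm).2 fun h'' => h''.1 hvR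
        obtain ⟨-, r, hr, hsr, hrv⟩ := hd'
        have hverts : v ∈ (piecePattern R N T piece att (piece d)).verts := by
          refine mem_piecePattern_verts.2 ⟨hvR, T.blob d.symm, hp2, ?_⟩
          rw [T.rootOf_blob, LengthForest.rootOf_of_root hrd]
          rfl
        exact hsr.trans (hL (piece d) _ _ ⟨hr, hverts, hrv⟩)
      · refine Or.inr ⟨hvR, hv, fun x hx => ?_⟩
        -- At a non-terminal vertex the state is carried around by the rotation: consecutive darts
        -- have blobs that share a piece, to which one can switch before turning.
        obtain ⟨k, rfl⟩ := ((hρ d.symm x).2 hx.symm).exists_nat_pow_eq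
        clear hx
        induction k with
        | zero => exact ⟨_, hd'⟩
        | succ k ih' =>
          obtain ⟨κ, hκ⟩ := ih'
          have hfst : ((ρ ^ k) d.symm).fst = v :=
            ((hρ d.symm _).1 ⟨k, by rw [zpow_natCast]⟩).symm
          rw [pow_succ', Equiv.Perm.mul_apply]
          generalize (ρ ^ k) d.symm = y at hκ hfst ⊢
          obtain ⟨κ', h1, h2⟩ := hturn y (by rw [hfst]; exact ⟨hvR, hv⟩)
          have := switch y κ κ' (by rw [hfst]; exact hv) (by rw [hfst]; exact hκ) h1
          rw [hfst] at this
          exact ⟨κ', h2, this.2⟩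
  rcases key t hst with h | h
  · exact h.2
  · exact absurd ht h.1

/-! ### Costs -/

variable [Fintype V] {w : V → V → ℝ}

theorem sum_darts_eq (g : V × V → ℝ) (hg : ∀ e, ¬ Γ.Adj e.1 e.2 → g e = 0) :
    ∑ e, g e = ∑ d : Γ.Dart, g d.toProd := by
  rw [← Finset.sum_image (f := g) (s := Finset.univ) (g := fun d : Γ.Dart => d.toProd)
    fun d _ d' _ h => SimpleGraph.Dart.ext _ _ h]
  refine (Finset.sum_subset (Finset.subset_univ _) fun e _ he => hg e fun h => he ?_).symm
  exact Finset.mem_image.2 ⟨⟨e, h⟩, Finset.mem_univ _, rfl⟩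

theorem sum_darts_le_cost (hw : ∀ u v, N.Adj u v → 0 ≤ w u v) :
    ∑ d : Γ.Dart, (if N.Adj d.fst d.snd then w d.fst d.snd else 0) ≤ cost w N := by
  rw [← Finset.sum_image (f := fun e : V × V => if N.Adj e.1 e.2 then w e.1 e.2 else 0)
    (s := Finset.univ) (g := fun d : Γ.Dart => d.toProd)
    fun d _ d' _ h => SimpleGraph.Dart.ext _ _ h]
  refine Finset.sum_le_sum_of_subset_of_nonneg (Finset.subset_univ _) fun e _ _ => ?_
  split_ifs with h
  · exact hw _ _ h
  · exact le_rfl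

/-- Every dart or its reversal is an edge of `N`, of the same weight. Each edge of `N` thus pays for
at most two darts. -/
theorem sum_darts_weight_le (hw : ∀ u v, N.Adj u v → 0 ≤ w u v)
    (hN : ∀ d : Γ.Dart, N.Adj d.fst d.snd ∨ N.Adj d.snd d.fst)
    (hsymm : ∀ d : Γ.Dart, w d.snd d.fst = w d.fst d.snd) :
    ∑ d : Γ.Dart, w d.fst d.snd ≤ 2 * cost w N := by
  let g : Γ.Dart → ℝ := fun d => if N.Adj d.fst d.snd then w d.fst d.snd else 0
  have hg : ∀ d, 0 ≤ g d := fun d => by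
    simp only [g]
    split_ifs with h
    · exact hw _ _ h
    · exact le_rfl
  have h1 : ∑ d : Γ.Dart, g d.symm = ∑ d, g d := Equiv.sum_comp (dartReverse Γ) g
  have h2 : ∑ d : Γ.Dart, w d.fst d.snd ≤ ∑ d : Γ.Dart, (g d + g d.symm) := by
    refine Finset.sum_le_sum fun d _ => ?_
    rcases hN d with h | h
    · have h3 : g d = w d.fst d.snd := if_pos h
      linarith [hg d.symm]
    · have h3 : g d.symm = w d.snd d.fst := if_pos h
      linarith [hg d, hsymm d]
  have h3 : ∑ d, g d ≤ cost w N := sum_darts_le_cost hw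
  rw [Finset.sum_add_distrib] at h2
  linarith

/-- The edges of `N` are split among the pieces. What is added is the hull of each blob that meets
several pieces, once per such piece: its crossings have length at most `2 * dist b`, and both
directions are included. -/
theorem sum_cost_pieceNetwork_le (hw : ∀ d : Γ.Dart, 0 ≤ w d.fst d.snd)
    (hwN : ∀ u v, N.Adj u v → 0 ≤ w u v)
    (hsymm : ∀ d : Γ.Dart, w d.snd d.fst = w d.fst d.snd)
    (hlen : ∀ d, ¬ T.root d → T.next d = d.symm → T.len d = w d.fst d.snd)
    (hcut : ∀ b, (att b).Nonempty → T.cut b) :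
    ∑ κ, cost w (pieceNetwork N T piece att κ)
      ≤ cost w N + 4 * ∑ b, if 2 ≤ (att b).card then (att b).card * T.dist b else 0 := by
  let t : Γ.Dart → Γ.Dart → ℝ := fun b d =>
    if d ∈ T.hull b ∧ T.next d = d.symm then w d.fst d.snd else 0
  let f : Γ.Dart → Γ.Dart → ℝ := fun κ d =>
    if N.Adj d.fst d.snd ∧ piece d = κ then w d.fst d.snd else 0
  let g : Γ.Dart → Γ.Dart → Γ.Dart → ℝ := fun κ b d =>
    if κ ∈ att b ∧ 2 ≤ (att b).card then t b d + t b d.symm else 0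
  have t0 : ∀ b d, 0 ≤ t b d := fun b d => by
    simp only [t]
    split_ifs
    · exact hw d
    · exact le_rfl
  have f0 : ∀ κ d, 0 ≤ f κ d := fun κ d => by
    simp only [f]
    split_ifs
    · exact hw d
    · exact le_rfl
  have g0 : ∀ κ b d, 0 ≤ g κ b d := fun κ b d => by
    simp only [g]
    split_ifs
    · exact add_nonneg (t0 _ _) (t0 _ _)
    · exact le_rfl
  have ht : ∀ b, T.cut b → ∑ d : Γ.Dart, (t b d + t b d.symm) ≤ 4 * T.dist b := by
    intro b hb
    have h1 : ∑ d : Γ.Dart, t b d.symm = ∑ d, t b d := Equiv.sum_comp (dartReverse Γ) (t b)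
    have h2 : ∑ d, t b d ≤ ∑ d ∈ T.hull b, T.len d := by
      have h : ∀ d ∈ Finset.univ, d ∉ T.hull b → t b d = 0 := fun d _ hd => if_neg fun h => hd h.1
      rw [← Finset.sum_subset (Finset.subset_univ (T.hull b)) h]
      refine Finset.sum_le_sum fun d hd => ?_
      simp only [t]
      split_ifs with h
      · rw [hlen d (T.not_root_of_mem_hull hd) h.2]
      · exact T.len_nonneg d
    have h3 := T.sum_hull_len_le b hb
    rw [Finset.sum_add_distrib, h1]
    linarith
  have hcost : ∀ κ, cost w (pieceNetwork N T piece att κ) ≤ ∑ d, f κ d + ∑ b, ∑ d, g κ b d := by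
    intro κ
    unfold cost
    rw [sum_darts_eq (Γ := Γ) _ fun e he => if_neg fun h => he (pieceNetwork_adj h),
      Finset.sum_comm, ← Finset.sum_add_distrib]
    refine Finset.sum_le_sum fun d _ => ?_
    have hs : 0 ≤ ∑ b, g κ b d := Finset.sum_nonneg fun b _ => g0 _ _ _
    split_ifs with h
    · obtain ⟨d', h1, h2, h⟩ := h
      obtain rfl : d' = d := SimpleGraph.Dart.ext _ _ (Prod.ext h1 h2)
      rcases h with h | ⟨b, hb, hb2, h⟩
      · have : f κ d' = w d'.fst d'.snd := if_pos h
        linarith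
      · have h3 := Finset.single_le_sum (f := fun b => g κ b d') (fun b _ => g0 κ b d')
          (Finset.mem_univ b)
        have h4 : g κ b d' = t b d' + t b d'.symm := if_pos ⟨hb, hb2⟩
        have h5 := t0 b d'
        have h6 := t0 b d'.symm
        have h7 := f0 κ d'
        rcases h with h | h
        · have h8 : t b d' = w d'.fst d'.snd := if_pos h
          linarith
        · have h8 : t b d'.symm = w d'.snd d'.fst :=
            if_pos ⟨h.1, by rw [h.2, SimpleGraph.Dart.symm_symm]⟩
          linarith [hsymm d']
    · exact add_nonneg (f0 _ _) hs
  refine (Finset.sum_le_sum fun κ _ => hcost κ).trans ?_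
  rw [Finset.sum_add_distrib]
  refine add_le_add ?_ ?_
  · refine le_trans (le_of_eq ?_) (sum_darts_le_cost (Γ := Γ) hwN)
    rw [Finset.sum_comm]
    refine Finset.sum_congr rfl fun d _ => ?_
    by_cases h : N.Adj d.fst d.snd <;> simp [f, h]
  · rw [Finset.sum_comm, Finset.mul_sum]
    refine Finset.sum_le_sum fun b _ => ?_
    by_cases h : 2 ≤ (att b).card
    · have hb := ht b (hcut b (Finset.card_pos.1 (by omega)))
      rw [if_pos h]
      calc ∑ κ, ∑ d, g κ b d = ∑ κ ∈ att b, ∑ d : Γ.Dart, (t b d + t b d.symm) := by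
            rw [← Finset.sum_subset (Finset.subset_univ (att b)) fun κ _ hκ =>
              Finset.sum_eq_zero fun d _ => if_neg fun h' => hκ h'.1]
            exact Finset.sum_congr rfl fun κ hκ => Finset.sum_congr rfl fun d _ => if_pos ⟨hκ, h⟩
        _ ≤ ∑ κ ∈ att b, 4 * T.dist b := Finset.sum_le_sum fun _ _ => hb
        _ = _ := by
            rw [Finset.sum_const, nsmul_eq_mul]
            ring
    · rw [if_neg h, mul_zero]
      exact (Finset.sum_eq_zero fun κ _ => Finset.sum_eq_zero fun d _ => if_neg fun h' => h h'.2).le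

end Pieces

end SteinerNetwork

/-! ### Assembling the patterns and choosing the constants -/

namespace SteinerNetwork

open Classical in
/-- The decomposition of a planar solution, in terms of the number of levels of the clustering. -/
theorem exists_patterns {V : Type*} [Fintype V] {G : Digraph V} {w : V → V → ℝ}
    (hG : IsBidirected G w) (hw : ∀ a b, G.Adj a b → 0 ≤ w a b) {H : Pattern V} {N : Digraph V}
    (hN : IsPlanarSolution G H N) {Δ : ℕ} (hΔ : 0 < Δ) :
    ∃ (P : Finset (Pattern V)) (S : Pattern V → Digraph V),
      (∀ H' ∈ P, H'.verts ⊆ H.verts ∧ H'.verts.card ≤ 48 * 8 ^ (24 * Δ) ∧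
        IsPlanarSolution G H' (S H')) ∧
      IsPlanarSolution G H (⨆ H' ∈ P, S H') ∧
      ∑ H' ∈ P, cost w (S H') ≤ (1 + 65520 / Δ) * cost w N ∧
      ∀ M : Pattern V → Digraph V, (∀ H' ∈ P, IsSolution G H' (M H')) →
        IsSolution G H (⨆ H' ∈ P, M H') := by
  obtain ⟨⟨hNG, hNH⟩, hplanar⟩ := hN
  set Γ := N.toSimpleGraphInclusive with hΓ
  have : Finite Γ.Dart := Finite.of_injective _ SimpleGraph.Dart.toProd_injective
  have := Fintype.ofFinite Γ.Dart
  have hΓN : ∀ u v, Γ.Adj u v → N.Adj u v ∨ N.Adj v u := fun u v h => h.2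
  have hΓG : ∀ u v, Γ.Adj u v → G.Adj u v := fun u v h =>
    (hΓN u v h).elim (fun h => hNG h) fun h => hG.adj_symm _ _ (hNG h)
  have hwΓ : ∀ d : Γ.Dart, 0 ≤ w d.fst d.snd := fun d => hw _ _ (hΓG _ _ d.adj)
  have hwN : ∀ u v, N.Adj u v → 0 ≤ w u v := fun u v h => hw _ _ (hNG h)
  have hsymm : ∀ d : Γ.Dart, w d.snd d.fst = w d.fst d.snd := fun d =>
    hG.weight_symm _ _ (hΓG _ _ d.adj)
  obtain ⟨ρ, hρ, hex⟩ := isPlanar_iff_exact.1 hplanar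
  obtain ⟨T, hfst, hsnd, hroot, hinl, hinr, hwt0, hwt, hlen, hnext⟩ :=
    exists_forestGraph hρ w hwΓ hsymm (H.verts : Set V)
  have hdual : IsAlgebraicDual T.fst T.snd (truncLeft ρ (dartReverse Γ))
      (truncRight ρ (dartReverse Γ)) := by
    rw [hfst, hsnd]
    exact hex.isAlgebraicDual dartReverse_dartReverse dartReverse_ne
  obtain ⟨p, att, h1, h2, h3, h4⟩ := T.exists_pieces hdual hΔ
  rw [hfst, hsnd] at h1
  let piece : Γ.Dart → Γ.Dart := fun d => p (Sum.inr d)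
  let S₀ : Γ.Dart → Digraph V := pieceNetwork N T.toLengthForest piece att
  let P₀ : Γ.Dart → Pattern V := piecePattern H.verts N T.toLengthForest piece att
  have hne : ∀ d : Γ.Dart, d.symm.fst ≠ d.fst := fun d h => d.adj.ne h.symm
  -- Several pieces may have the same pattern; one of their networks then serves for all. Dropping
  -- the others only lowers the total cost.
  let S : Pattern V → Digraph V := fun H' => if h : ∃ κ, P₀ κ = H' then S₀ h.choose else ⊥
  have hS : ∀ H' ∈ Finset.univ.image P₀, ∃ κ, P₀ κ = H' ∧ S H' = S₀ κ := by
    intro H' hH'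
    obtain ⟨κ, -, hκ⟩ := Finset.mem_image.1 hH'
    have hex : ∃ κ, P₀ κ = H' := ⟨κ, hκ⟩
    exact ⟨hex.choose, hex.choose_spec, dif_pos hex⟩
  have hSΓ : ∀ H' ∈ Finset.univ.image P₀, ∀ u v, (S H').Adj u v → Γ.Adj u v := by
    intro H' hH' u v h
    obtain ⟨κ, -, hκ⟩ := hS H' hH'
    rw [hκ] at h
    exact pieceNetwork_adj h
  -- All the networks lie in the underlying graph of `N`, so planarity of each network and of their
  -- union is that of a subgraph.
  have hplan : ∀ M : Digraph V, (∀ u v, M.Adj u v → Γ.Adj u v) →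
      IsPlanar M.toSimpleGraphInclusive := fun M hM =>
    IsPlanar.mono (fun u v h => h.2.elim (hM u v) fun h' => (hM v u h').symm) hplanar
  have hsol : ∀ H' ∈ Finset.univ.image P₀, IsSolution G H' (S H') := by
    intro H' hH'
    obtain ⟨κ, rfl, hκ⟩ := hS H' hH'
    rw [hκ]
    exact isSolution_pieceNetwork hΓG
  have hunion : ∀ M : Pattern V → Digraph V,
      (∀ H' ∈ Finset.univ.image P₀, IsSolution G H' (M H')) →
        IsSolution G H (⨆ H' ∈ Finset.univ.image P₀, M H') := by
    intro M hM
    refine ⟨iSup₂_le fun H' hH' => (hM H' hH').1, fun s t hst => ?_⟩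
    refine reflTransGen_of_pieces (T := T.toLengthForest) (piece := piece) (att := att) hρ
      (fun u v h hne => ⟨hne, Or.inl h⟩) (fun d hd => (hnext d hd).imp id And.left) hroot
      (fun d hd => ⟨_, h1 (Sum.inl d) ((hinl d).2 hd)⟩)
      (fun d hd => h1 (Sum.inr d) ((hinr d).2 hd)) (fun κ s t h => ?_)
      (H.left_mem _ _ hst) (H.right_mem _ _ hst) (hNH s t hst)
    have hκ : P₀ κ ∈ Finset.univ.image P₀ := Finset.mem_image_of_mem _ (Finset.mem_univ κ)
    exact Relation.ReflTransGen.mono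
      (le_iSup₂ (f := fun (H' : Pattern V) (_ : H' ∈ Finset.univ.image P₀) => M H') (P₀ κ) hκ) _ _
      ((hM _ hκ).2 s t h)
  refine ⟨Finset.univ.image P₀, S, fun H' hH' => ?_, ⟨hunion S hsol, hplan _ fun u v h => ?_⟩, ?_,
    hunion⟩
  · refine ⟨?_, ?_, hsol H' hH', hplan _ (hSΓ H' hH')⟩
    · obtain ⟨κ, rfl, -⟩ := hS H' hH'
      exact fun v hv => (mem_piecePattern_verts.1 hv).1
    · obtain ⟨κ, rfl, -⟩ := hS H' hH'
      refine card_piecePattern_verts_le.trans (le_trans (le_of_eq ?_) (h3 κ))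
      congr 1
      ext b
      simp
  · simp only [Digraph.iSup_adj] at h
    obtain ⟨H', hH', h⟩ := h
    exact hSΓ H' hH' u v h
  · have h5 : ∑ H' ∈ Finset.univ.image P₀, cost w (S H') ≤ ∑ κ, cost w (S₀ κ) := by
      choose κ hκ hκ' using hS
      calc ∑ H' ∈ Finset.univ.image P₀, cost w (S H')
          = ∑ x ∈ (Finset.univ.image P₀).attach.image fun H' => κ H'.1 H'.2, cost w (S₀ x) := by
            rw [Finset.sum_image fun H₁ _ H₂ _ h => Subtype.ext (by
              rw [← hκ H₁.1 H₁.2, ← hκ H₂.1 H₂.2]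
              exact congrArg P₀ h), ← Finset.sum_attach]
            exact Finset.sum_congr rfl fun H' _ => by rw [hκ' H'.1 H'.2]
        _ ≤ _ := by
            refine Finset.sum_le_sum_of_subset_of_nonneg (Finset.subset_univ _) fun x _ _ => ?_
            refine Finset.sum_nonneg fun e _ => ?_
            split_ifs with h
            · exact hw _ _ (hΓG _ _ (pieceNetwork_adj h))
            · exact le_rfl
    have h6 := sum_cost_pieceNetwork_le (T := T.toLengthForest) (piece := piece) (att := att) hwΓ
      hwN hsymm (fun d hd h => ((hnext d hd).resolve_left (by rw [h]; exact hne d)).2) h2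
    have h7 := sum_darts_weight_le (Γ := Γ) hwN (fun d => hΓN _ _ d.adj) hsymm
    have h8 : ∑ d, T.len d ≤ ∑ d : Γ.Dart, w d.fst d.snd := Finset.sum_le_sum fun d _ => hlen d
    have h9 : ∑ y, T.wt y = ∑ d : Γ.Dart, w d.fst d.snd := by
      rw [Fintype.sum_sum_type, Finset.sum_eq_zero fun d _ => hwt0 d, zero_add]
      exact Finset.sum_congr rfl fun d _ => hwt d
    -- Weights and lengths both sum to at most twice the cost, hence 260 = 2 · 6 + 2 · 124. The
    -- factor 4 from the hulls then gives 65520 = 4 · 63 · 260.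
    have h10 : (63 / Δ : ℝ) * (6 * ∑ y, T.wt y + 124 * ∑ d, T.len d)
        ≤ 63 / Δ * (260 * cost w N) :=
      mul_le_mul_of_nonneg_left (by linarith) (by positivity)
    calc _ ≤ cost w N + 4 * (63 / Δ * (260 * cost w N)) := by linarith
      _ = _ := by ring

theorem card_bound_le {ε : ℝ} (hε : 0 < ε) :
    (48 * 8 ^ (24 * ⌈65520 / ε⌉₊) : ℝ) ≤ 2 ^ ((5000000 : ℝ) * max 1 (1 / ε)) := by
  set m := max 1 (1 / ε) with hm
  have h1 : 1 ≤ m := le_max_left _ _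
  have h2 : 65520 / ε ≤ 65520 * m := by
    rw [div_eq_mul_one_div]
    exact mul_le_mul_of_nonneg_left (le_max_right _ _) (by norm_num)
  have h3 := Nat.ceil_lt_add_one (a := 65520 / ε) (by positivity)
  set n := ⌈65520 / ε⌉₊
  -- The exponent is 6 + 72 n with `n < 65520 m + 1`, hence below 4717440 m + 78, which 5000000 m
  -- covers since `m ≥ 1`.
  calc (48 * 8 ^ (24 * n) : ℝ) ≤ 2 ^ 6 * (2 ^ 3) ^ (24 * n) := by
        norm_num
    _ = (2 : ℝ) ^ ((6 + 3 * (24 * n) : ℕ) : ℝ) := by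
        rw [Real.rpow_natCast, pow_add, pow_mul (2 : ℝ) 3]
    _ ≤ _ := by
        refine Real.rpow_le_rpow_of_exponent_le one_le_two ?_
        push_cast
        linarith

end SteinerNetwork

theorem mainTheorem2 :
    ∃ C : ℝ, 0 < C ∧
      ∀ (V : Type*) [Fintype V] (G : Digraph V) (w : V → V → ℝ),
        SteinerNetwork.IsBidirected G w →
        (∀ a b, G.Adj a b → 0 ≤ w a b) →
        ∀ (H : SteinerNetwork.Pattern V) (N : Digraph V),
          SteinerNetwork.IsOptimumPlanarSolution G w H N →
          ∀ ε : ℝ, 0 < ε →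
            ∃ (P : Finset (SteinerNetwork.Pattern V))
              (S : SteinerNetwork.Pattern V → Digraph V),
              (∀ H' ∈ P,
                H'.verts ⊆ H.verts ∧
                (H'.verts.card : ℝ) ≤ (2 : ℝ) ^ (C * max 1 (1 / ε)) ∧
                SteinerNetwork.IsPlanarSolution G H' (S H')) ∧
              SteinerNetwork.IsPlanarSolution G H (⨆ H' ∈ P, S H') ∧
              ∑ H' ∈ P, SteinerNetwork.cost w (S H')
                ≤ (1 + ε) * SteinerNetwork.cost w N ∧
              (∀ M : SteinerNetwork.Pattern V → Digraph V,
                (∀ H' ∈ P, SteinerNetwork.IsSolution G H' (M H')) →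
                SteinerNetwork.IsSolution G H (⨆ H' ∈ P, M H')) := by
  refine ⟨5000000, by norm_num, fun V _ G w hG hw H N hN ε hε => ?_⟩
  have hpos : 0 < 65520 / ε := by positivity
  -- This number of levels brings the relative overhead `65520 / Δ` down to at most `ε`.
  have hΔ : 0 < ⌈65520 / ε⌉₊ := Nat.ceil_pos.2 hpos
  obtain ⟨P, S, h1, h2, h3, h4⟩ := SteinerNetwork.exists_patterns hG hw hN.1 hΔ
  refine ⟨P, S, fun H' hH' => ⟨(h1 H' hH').1, ?_, (h1 H' hH').2.2⟩, h2, h3.trans ?_, h4⟩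
  · refine le_trans ?_ (SteinerNetwork.card_bound_le hε)
    exact_mod_cast (h1 H' hH').2.1
  · refine mul_le_mul_of_nonneg_right ?_ ?_
    · have h5 : 65520 / ε ≤ ⌈65520 / ε⌉₊ := Nat.le_ceil _
      have h6 : (65520 : ℝ) / ⌈65520 / ε⌉₊ ≤ ε := by
        rw [div_le_iff₀ (by exact_mod_cast hΔ)]
        rwa [div_le_iff₀ hε, mul_comm] at h5
      linarith
    · refine Finset.sum_nonneg fun e _ => ?_
      split_ifs with h
      · exact hw _ _ (hN.1.1.1 h)
      · exact le_rfl
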